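/- Let $V\in C^\infty(\mathbb R;\mathbb R)$ be of the form $V=V_{\rm per}+V_{\rm def}$ with $V_{\rm per}(x+1)=V_{\rm per}(x)$ for all $x$ and $V_{\rm def}(x)=0$ for $|x|>\rho$, where $\rho\ge 0$. Suppose that $H=-\partial_x^2+V$ has a bound state $0\neq\Phi\in L^2(\mathbb R)$, $H\Phi=E\Phi$, with $E>0$. For $M>0$ let $H_{\rm trunc}=-\partial_x^2+V\mathbf 1_{[-M,M]}$ on $L^2(\mathbb R)$. Throughout, $\sqrt{\cdot}$ is the principal branch on $\mathbb C\setminus(-\infty,0]$. A resonance of $H_{\rm trunc}$ is a number $z$ such that $\sqrt z$ is a pole of the meromorphic continuation in $\xi$, from the upper half-plane to $\mathbb C$, of the resolvent $(H_{\rm trunc}-\xi^2)^{-1}$ (as operators $L^2_{\rm comp}\to L^2_{\rm loc}$). A resonant state at $z$ is a nonzero $H^2_{\rm loc}$ solution of $(H_{\rm trunc}-z)\psi=0$ that equals a constant multiple of $e^{i\sqrt z x}$ near $+\infty$ and of $e^{-i\sqrt z x}$ near $-\infty$. For $\zeta=(w,z)\in\mathbb C^2$ let $u_\zeta,v_\zeta$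 be the solutions of $-y''+Vy=zy$ with initial data $$u_\zeta(0)=1,\quad u_\zeta'(0)=w,\quad v_\zeta(0)=\tfrac{-w}{1+w^2},\quad v_\zeta'(0)=\tfrac{1}{1+w^2}\qquad\text{if }\Phi(0)\ne0,$$ $$u_\zeta(0)=-w,\quad u_\zeta'(0)=1,\quad v_\zeta(0)=\tfrac{-1}{1+w^2},\quad v_\zeta'(0)=\tfrac{-w}{1+w^2}\qquad\text{if }\Phi(0)=0.$$ Put $w_0=\Phi'(0)/\Phi(0)$ if $\Phi(0)\neq0$ and $w_0=0$ otherwise, $\eta=(w_0,E)$, and write $u=u_\eta$, $v=v_\eta$, $$a_\pm=u'(\pm M)\mp i\sqrt E\,u(\pm M),\qquad b_\pm=v'(\pm M)\mp i\sqrt E\,v(\pm M),\qquad N=b_+b_-\int_{-M}^{M}u^2\,dy .$$ Then there is $\kappa>0$, the Floquet exponent of the bound state (that is, $\Phi(x+1)=\mu\,\Phi(x)$ for all $x\ge\rho$ with some $\mu\in\mathbb C$, $|\mu|=e^{-\kappa}$), and there are $M_0>\rho$ and $C$ such that for every $M\ge M_0$ one has $N\neq0$ and there is $\zeta^*=(w^*,z^*)\in\mathbb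 C^2$ (depending on $M$) with the following properties. (1) $\operatorname{Re}z^*>0$, $\operatorname{Im}z^*<0$, and $z^*$ is a resonance of $H_{\rm trunc}$. (2) Set $$r_z=z^*-\Big(E-\frac{b_+a_--b_-a_+}{N}\Big),\qquad r_w=w^*-\Big(w_0-\frac{b_-a_+\int_{-M}^0u^2\,dy+b_+a_-\int_0^Mu^2\,dy}{N}\Big).$$ Then $|r_z|\le CMe^{-4\kappa M}$ and $|r_w|\le CMe^{-4\kappa M}$. In particular, for every $0<k<\kappa$, both $r_z$ and $r_w$ are $O(e^{-4kM})$, uniformly for $M\ge M_0$. (3) The resonant states of $H_{\rm trunc}$ at $z^*$ are exactly the nonzero multiples of $$\Phi^*(x)=\begin{cases}u_{\zeta^*}(-M)\,e^{-i\sqrt{z^*}(x+M)},&x<-M,\\ u_{\zeta^*}(x),&|x|\le M,\\ u_{\zeta^*}(M)\,e^{i\sqrt{z^*}(x-M)},&x>M.\end{cases}$$ -/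

import Mathlib

open MeasureTheory Set
open scoped ContDiff

noncomputable section

/-- `-w'' + V w = h` on the line, in the Carathéodory sense: `w` is differentiable, and `w'` is the
indefinite integral of the locally integrable function `V w - h`. If `V` and `h` are continuous this
is the classical equation; if `V` is bounded and `w`, `h` are in `L²(ℝ)`, it says that
`w ∈ H²(ℝ)` and `(D_x² + V) w = h`. -/
def SchrodingerEq (V : ℝ → ℝ) (w h : ℝ → ℂ) : Prop :=
  Differentiable ℝ w ∧
  (∀ a b : ℝ, IntervalIntegrable (fun t => (V t : ℂ) * w t - h t) volume a b) ∧
  ∀ a b : ℝ, deriv w b - deriv w a = ∫ t in a..b, ((V t : ℂ) * w t - h t)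

/-- `Φ` is a bound state (eigenfunction in `L²(ℝ)`) of `D_x² + V` with eigenvalue `E`. -/
def IsBoundState (V : ℝ → ℝ) (E : ℝ) (Φ : ℝ → ℂ) : Prop :=
  Φ ≠ 0 ∧ MemLp Φ 2 volume ∧ SchrodingerEq V Φ (fun x => (E : ℂ) * Φ x)

/-- The potential truncated at `±M`. -/
def truncate (V : ℝ → ℝ) (M : ℝ) : ℝ → ℝ := fun x => if |x| ≤ M then V x else 0

/-- The graph of the operator `D_x² + V` on `L²(ℝ)`: `φ` is in the domain and `(D_x² + V) φ = h`. -/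
def SchrodingerGraph (V : ℝ → ℝ) (φ h : Lp ℂ 2 (volume : Measure ℝ)) : Prop :=
  ∃ w : ℝ → ℂ, (φ : ℝ → ℂ) =ᵐ[volume] w ∧ SchrodingerEq V w (h : ℝ → ℂ)

/-- `R = (H - z)⁻¹` for `H = D_x² + V` on `L²(ℝ)`: `R` is bounded, and `R h = φ` if and only if `φ`
is in the domain of `H` and `(H - z) φ = h`. -/
def IsResolvent (V : ℝ → ℝ) (z : ℂ)
    (R : Lp ℂ 2 (volume : Measure ℝ) →L[ℂ] Lp ℂ 2 (volume : Measure ℝ)) : Prop :=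
  ∀ φ h : Lp ℂ 2 (volume : Measure ℝ), R h = φ ↔ SchrodingerGraph V φ (h + z • φ)

/-- The element `f` of `L²(ℝ)` vanishes (almost everywhere) outside a bounded interval. -/
def HasBoundedSupport (f : Lp ℂ 2 (volume : Measure ℝ)) : Prop :=
  ∃ r : ℝ, ∀ᵐ x ∂(volume : Measure ℝ), r < |x| → f x = 0

/-- `F` is the meromorphic continuation to the whole `ξ`-plane of the matrix element
`⟨g, (H - ξ²)⁻¹ f⟩`, which is given in the upper half-plane wherever `ξ²` is in the resolvent set of
`H = D_x² + V`. -/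
def IsResolventContinuation (V : ℝ → ℝ) (f g : Lp ℂ 2 (volume : Measure ℝ)) (F : ℂ → ℂ) : Prop :=
  Meromorphic F ∧ ∀ ξ : ℂ, 0 < ξ.im → ∀ R, IsResolvent V (ξ ^ 2) R → F ξ = inner ℂ g (R f)

/-- Let `V` be bounded, measurable and compactly supported. `z` (off the half-line `(-∞, 0]`) is a
resonance of `H = D_x² + V`: the point `√z` (principal branch) is a pole of the resolvent
`(H - ξ²)⁻¹` continued meromorphically from the upper half-plane as a family of operators from
`L²_comp` to `L²_loc`. Poles of this family are the poles of its matrix elements between compactly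
supported elements of `L²(ℝ)`. -/
def IsResonance (V : ℝ → ℝ) (z : ℂ) : Prop :=
  ∃ f g : Lp ℂ 2 (volume : Measure ℝ), HasBoundedSupport f ∧ HasBoundedSupport g ∧
    ∃ F : ℂ → ℂ, IsResolventContinuation V f g F ∧ meromorphicOrderAt F (Complex.sqrt z) < 0

/-- `ψ` is a resonant state of `D_x² + V` (compactly supported `V`) at `z`: a nonzero solution of
`(D_x² + V - z) ψ = 0` which is outgoing, that is, a multiple of `exp (± i √z x)` near `±∞`. -/
def IsResonantState (V : ℝ → ℝ) (z : ℂ) (ψ : ℝ → ℂ) : Prop :=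
  ψ ≠ 0 ∧ SchrodingerEq V ψ (fun x => z * ψ x) ∧
  ∃ (r : ℝ) (a b : ℂ),
    (∀ x : ℝ, r < x → ψ x = a * Complex.exp (Complex.I * Complex.sqrt z * x)) ∧
    (∀ x : ℝ, x < -r → ψ x = b * Complex.exp (-(Complex.I * Complex.sqrt z * x)))

/-- The (unique, for continuous `V`) solution of
`(D_x² + V - z) y = 0`, `y 0 = y₀`, `y' 0 = y₁`. -/
def schrodingerSol (V : ℝ → ℝ) (z y₀ y₁ : ℂ) : ℝ → ℂ :=
  Classical.epsilon fun y : ℝ → ℂ =>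
    SchrodingerEq V y (fun x => z * y x) ∧ y 0 = y₀ ∧ deriv y 0 = y₁

open Classical in
/-- The solution `u_ζ`, `ζ = (w, z)`, relative to the bound state `Φ`. -/
def uSol (V : ℝ → ℝ) (Φ : ℝ → ℂ) (w z : ℂ) : ℝ → ℂ :=
  if Φ 0 = 0 then schrodingerSol V z (-w) 1 else schrodingerSol V z 1 w

open Classical in
/-- The solution `v_ζ`, `ζ = (w, z)`, relative to the bound state `Φ`. -/
def vSol (V : ℝ → ℝ) (Φ : ℝ → ℂ) (w z : ℂ) : ℝ → ℂ :=
  if Φ 0 = 0 then schrodingerSol V z (-1 / (1 + w ^ 2)) (-w / (1 + w ^ 2))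
  else schrodingerSol V z (-w / (1 + w ^ 2)) (1 / (1 + w ^ 2))

open Classical in
/-- The first component of `η = (w₀, E)`; it is `Φ' 0` if `Φ` is normalised by `Φ 0 = 1`. -/
def wZero (Φ : ℝ → ℂ) : ℂ := if Φ 0 = 0 then 0 else deriv Φ 0 / Φ 0

/-- `y' M - i √E y M` -/
def bPlus (E M : ℝ) (y : ℝ → ℂ) : ℂ := deriv y M - Complex.I * (Real.sqrt E : ℂ) * y M

/-- `y' (-M) + i √E y (-M)` -/
def bMinus (E M : ℝ) (y : ℝ → ℂ) : ℂ := deriv y (-M) + Complex.I * (Real.sqrt E : ℂ) * y (-M)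

/-- The common denominator of the correction terms of `z*` and `w*`. -/
def corrDenom (E M : ℝ) (u v : ℝ → ℂ) : ℂ :=
  (∫ y in (-M)..M, u y ^ 2) * bPlus E M v * bMinus E M v

/-- The explicit approximation of the resonance `z*`. -/
def zApprox (E M : ℝ) (u v : ℝ → ℂ) : ℂ :=
  E - (bPlus E M v * bMinus E M u - bMinus E M v * bPlus E M u) / corrDenom E M u v

/-- The explicit approximation of the parameter `w*`. -/
def wApprox (w₀ : ℂ) (E M : ℝ) (u v : ℝ → ℂ) : ℂ :=
  w₀ - ((∫ y in (-M)..0, u y ^ 2) * bMinus E M v * bPlus E M u +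
      (∫ y in (0 : ℝ)..M, u y ^ 2) * bPlus E M v * bMinus E M u) / corrDenom E M u v

/-- `u` on `[-M, M]`, extended by outgoing exponentials of frequency `√z`. -/
def outgoingExtension (M : ℝ) (z : ℂ) (u : ℝ → ℂ) : ℝ → ℂ := fun x =>
  if x < -M then u (-M) * Complex.exp (-(Complex.I * Complex.sqrt z * (x + M)))
  else if x ≤ M then u x
  else u M * Complex.exp (Complex.I * Complex.sqrt z * (x - M))

end

/-! Outside `[-M, M]` a resonant state is an outgoing exponential, so it corresponds to a solution
on `[-M, M]` with `y' = ± i √z y` at `± M`. The unknowns are the energy `z = E + l` and the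
direction `w` of the Cauchy data at `0`. Let `Y`, `Z` be the solutions at energy `E + l` with the
data of `u`, `v`. Up to a factor, `u_ζ` is `Y + τ Z`, where `τ` is a reparametrisation of `w - w₀`.
After division by the boundary values of `v`, the two conditions read `S₁ + τ S₂ = 0` at `M` and `T₁
- τ T₂ = 0` at `-M`. Eliminating `τ` leaves one analytic equation `S₁ T₂ + T₁ S₂ = 0` for `l`.

The bound state is a Floquet solution at both ends, with the same multiplier of modulus `e^{-κ}`.
Hence `u = O(e^{-κ|x|})` and `v = O(e^{κ|x|})`. Since `u`, `v` are real with Wronskian `1`, the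
outgoing boundary value of `v` is also bounded below by a multiple of `e^{κM}`
(`exists_floquet_exponent`). For `l = O(e^{-2κM})`, variation of parameters gives `S₁ = m₁ - l ∫₀^M
u² + O(M e^{-4κM})` and `S₂ = 1 + O(M e^{-2κM})` (`exists_scaled_bounds`); the same estimate,
applied after the reflection `x ↦ -x`, handles `T₁` and `T₂`. Here `m₁ = a₊/b₊`, `m₂ = -a₋/b₋`. The
equation for `l` is therefore affine up to `O(M e^{-4κM})`, and a contraction argument
(`exists_zero_near_affine`) places a zero that close to `(m₁ + m₂) / ∫ u²`. Then `τ = -S₁/S₂` yields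
`w` with the same accuracy (`exists_resonance_parameters`).

It remains to interpret this zero. Conservation of flux forces `Im √z < 0` (`im_neg_of_outgoing`),
hence `Im z < 0`. Uniqueness for the differential equation identifies all resonant states
(`isResonantState_truncate_iff`). For the pole, the resolvent is tested between indicators of unit
intervals adjacent to `[-M, M]`, one on each side: the matrix element is a function that does not
vanish at `√z`, divided by an entire function vanishing at `√z` but not identically
(`resolvent_matrix_element`, `isResonance_truncate`). -/

noncomputable section

/-! ### Linear ordinary differential equations -/

/-- The terms of the Volterra series of `Y' = A Y`, `Y 0 = v`. -/
def volterraTerm {E : Type*} [NormedAddCommGroup E] [NormedSpace ℝ E] (A : ℝ → E →L[ℝ] E) (v : E) :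
    ℕ → ℝ → E
  | 0 => fun _ => v
  | n + 1 => fun x => ∫ t in (0 : ℝ)..x, A t (volterraTerm A v n t)

theorem continuous_volterraTerm {E : Type*} [NormedAddCommGroup E] [NormedSpace ℝ E]
    [CompleteSpace E] {A : ℝ → E →L[ℝ] E} (hA : Continuous A) (v : E) (n : ℕ) :
    Continuous (volterraTerm A v n) := by
  induction n with
  | zero => exact continuous_const
  | succ n ih =>
    exact intervalIntegral.continuous_primitive
      (fun a b => (hA.clm_apply ih).intervalIntegrable a b) 0

/-- Each iterated integration of `|t| ^ n` gains a factor `1 / (n + 1)`. The factorial makes the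
series converge on every bounded interval, with no smallness of `A`. -/
theorem norm_volterraTerm_le {E : Type*} [NormedAddCommGroup E] [NormedSpace ℝ E]
    [CompleteSpace E] {A : ℝ → E →L[ℝ] E} (hA : Continuous A) (v : E) {R K : ℝ}
    (hK : ∀ x, |x| ≤ R → ‖A x‖ ≤ K) (n : ℕ) (x : ℝ) (hx : |x| ≤ R) :
    ‖volterraTerm A v n x‖ ≤ ‖v‖ * (K * |x|) ^ n / n.factorial := by
  have hK0 : 0 ≤ K := (norm_nonneg _).trans (hK x hx)
  induction n generalizing x with
  | zero => simp [volterraTerm]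
  | succ n ih =>
    have h1 : ‖volterraTerm A v (n + 1) x‖
        ≤ ∫ t in uIoc (0 : ℝ) x, ‖A t (volterraTerm A v n t)‖ :=
      intervalIntegral.norm_integral_le_integral_norm_uIoc
    have hc : Continuous fun t => ‖A t (volterraTerm A v n t)‖ :=
      (hA.clm_apply (continuous_volterraTerm hA v n)).norm
    have hc2 : Continuous fun t : ℝ => K * (‖v‖ * K ^ n / n.factorial) * |t - 0| ^ n := by
      fun_prop
    have h2 : ∫ t in uIoc (0 : ℝ) x, ‖A t (volterraTerm A v n t)‖
        ≤ ∫ t in uIoc (0 : ℝ) x, K * (‖v‖ * K ^ n / n.factorial) * |t - 0| ^ n := by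
      refine setIntegral_mono_on ?_ ?_ measurableSet_uIoc fun t ht => ?_
      · exact (hc.intervalIntegrable 0 x).def'
      · exact (hc2.intervalIntegrable 0 x).def'
      · have htx : |t| ≤ |x| := by
          rcases le_total 0 x with h | h
          · rw [uIoc_of_le h] at ht
            rw [abs_of_pos ht.1, abs_of_nonneg h]; exact ht.2
          · rw [uIoc_of_ge h] at ht
            rw [abs_of_nonpos ht.2, abs_of_nonpos h]; linarith [ht.1]
        calc ‖A t (volterraTerm A v n t)‖ ≤ ‖A t‖ * ‖volterraTerm A v n t‖ :=
              (A t).le_opNorm _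
          _ ≤ K * (‖v‖ * (K * |t|) ^ n / n.factorial) := by
              gcongr
              · exact hK t (htx.trans hx)
              · exact ih t (htx.trans hx)
          _ = _ := by rw [sub_zero, mul_pow]; ring
    refine h1.trans (h2.trans (le_of_eq ?_))
    rw [integral_const_mul, integral_pow_abs_sub_uIoc, sub_zero, Nat.factorial_succ]
    push_cast
    field_simp
    ring

theorem exists_linear_ode {E : Type*} [NormedAddCommGroup E] [NormedSpace ℝ E] [CompleteSpace E]
    {A : ℝ → E →L[ℝ] E} (hA : Continuous A) (v : E) :
    ∃ Y : ℝ → E, Y 0 = v ∧ ∀ x, HasDerivAt Y (A x (Y x)) x := by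
  have h0 : ∀ n, volterraTerm A v (n + 1) 0 = 0 := fun n => by simp [volterraTerm]
  have hsum0 : Summable fun n => volterraTerm A v n 0 := by
    rw [← summable_nat_add_iff 1]; simp [h0]
  refine ⟨fun x => ∑' n, volterraTerm A v n x, ?_, fun x => ?_⟩
  · change ∑' n, volterraTerm A v n 0 = v
    rw [hsum0.tsum_eq_zero_add]; simp [volterraTerm]
  -- Termwise differentiation needs a connected open set containing both `x` and the point `0`,
  -- where the series is known to converge.
  · set R := |x| + 1
    obtain ⟨K, hK⟩ := (isCompact_Icc (a := -R) (b := R)).exists_bound_of_continuousOn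
      hA.continuousOn
    replace hK : ∀ t, |t| ≤ R → ‖A t‖ ≤ K := fun t ht => hK t (abs_le.1 ht)
    have hK0 : 0 ≤ K := (norm_nonneg _).trans (hK x (by simp [R]))
    have hR0 : 0 ≤ R := by positivity
    let g' : ℕ → ℝ → E := fun n t => Nat.casesOn n 0 fun m => A t (volterraTerm A v m t)
    let u : ℕ → ℝ := fun n => Nat.casesOn n 0 fun m => K * (‖v‖ * ((K * R) ^ m / m.factorial))
    have hbound : ∀ n t, |t| ≤ R →
        ‖volterraTerm A v n t‖ ≤ ‖v‖ * ((K * R) ^ n / n.factorial) := by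
      intro n t ht
      refine (norm_volterraTerm_le hA v hK n t ht).trans ?_
      rw [mul_div_assoc]; gcongr
    have hexp : Summable fun m : ℕ => ‖v‖ * ((K * R) ^ m / m.factorial) :=
      (Real.summable_pow_div_factorial _).mul_left _
    have hu : Summable u := by
      rw [← summable_nat_add_iff 1]
      exact hexp.mul_left K
    have hmem : ∀ t, t ∈ Metric.ball (0 : ℝ) R ↔ |t| < R := fun t => by simp
    have hder := hasDerivAt_tsum_of_isPreconnected (g := fun n t => volterraTerm A v n t)
      (g' := g') (t := Metric.ball (0 : ℝ) R) (y₀ := 0) (y := x) hu Metric.isOpen_ball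
      (convex_ball _ _).isPreconnected ?_ ?_ ?_ hsum0 ?_
    · convert hder using 1
      have hs : Summable fun n => g' n x := Summable.of_norm_bounded hu fun n => by
        cases n with
        | zero => simp [g', u]
        | succ m =>
          exact ((A x).le_opNorm _).trans (mul_le_mul (hK x (by simp [R]))
            (hbound m x (by simp [R])) (norm_nonneg _) hK0)
      rw [hs.tsum_eq_zero_add]
      have hsY : Summable fun n => volterraTerm A v n x :=
        Summable.of_norm_bounded hexp fun n => hbound n x (by simp [R])
      exact ((A x).map_tsum hsY).trans (zero_add _).symm
    · intro n t _
      cases n with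
      | zero => exact hasDerivAt_const _ _
      | succ m =>
        have hc : Continuous fun t => A t (volterraTerm A v m t) :=
          hA.clm_apply (continuous_volterraTerm hA v m)
        exact intervalIntegral.integral_hasDerivAt_right (hc.intervalIntegrable _ _)
          (hc.stronglyMeasurableAtFilter _ _) hc.continuousAt
    · intro n t ht
      rw [hmem] at ht
      cases n with
      | zero => simp [g', u]
      | succ m =>
        exact ((A t).le_opNorm _).trans (mul_le_mul (hK t ht.le)
          (hbound m t ht.le) (norm_nonneg _) hK0)
    · rw [hmem, abs_zero]; positivity
    · rw [hmem]; simp [R]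

/-! ### The equation `y'' = q y` -/

/-- `y'' = q y` on `s`, with `y'` the derivative of `y`. -/
def SolOn (q : ℝ → ℂ) (y y' : ℝ → ℂ) (s : Set ℝ) : Prop :=
  ∀ x ∈ s, HasDerivWithinAt y (y' x) s x ∧ HasDerivWithinAt y' (q x * y x) s x

/-- The coefficient `V - z`. -/
def pot (V : ℝ → ℝ) (z : ℂ) : ℝ → ℂ := fun x => (V x : ℂ) - z

theorem continuous_pot {V : ℝ → ℝ} (hV : Continuous V) (z : ℂ) : Continuous (pot V z) := by
  unfold pot; fun_prop

theorem SolOn.mono {q y y' : ℝ → ℂ} {s t : Set ℝ} (h : SolOn q y y' s) (hts : t ⊆ s) :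
    SolOn q y y' t := fun x hx => ⟨(h x (hts hx)).1.mono hts, (h x (hts hx)).2.mono hts⟩

theorem SolOn.congr_coeff {q p y y' : ℝ → ℂ} {s : Set ℝ} (h : SolOn q y y' s)
    (hqp : ∀ x ∈ s, q x = p x) : SolOn p y y' s := fun x hx =>
  ⟨(h x hx).1, hqp x hx ▸ (h x hx).2⟩

theorem SolOn.lin {q y y' v v' : ℝ → ℂ} {s : Set ℝ} (hy : SolOn q y y' s) (hv : SolOn q v v' s)
    (a b : ℂ) :
    SolOn q (fun x => a * y x + b * v x) (fun x => a * y' x + b * v' x) s := fun x hx => by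
  refine ⟨((hy x hx).1.const_mul a).add ((hv x hx).1.const_mul b), ?_⟩
  exact (((hy x hx).2.const_mul a).add ((hv x hx).2.const_mul b)).congr_deriv (by ring)

theorem SolOn.continuousOn {q y y' : ℝ → ℂ} {s : Set ℝ} (h : SolOn q y y' s) :
    ContinuousOn y s := fun x hx => (h x hx).1.continuousWithinAt

theorem SolOn.continuousOn' {q y y' : ℝ → ℂ} {s : Set ℝ} (h : SolOn q y y' s) :
    ContinuousOn y' s := fun x hx => (h x hx).2.continuousWithinAt

theorem SolOn.continuous {q y y' : ℝ → ℂ} (h : SolOn q y y' univ) : Continuous y :=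
  continuousOn_univ.1 h.continuousOn

theorem SolOn.continuous' {q y y' : ℝ → ℂ} (h : SolOn q y y' univ) : Continuous y' :=
  continuousOn_univ.1 h.continuousOn'

theorem SolOn.hasDerivAt {q y y' : ℝ → ℂ} (h : SolOn q y y' univ) (x : ℝ) :
    HasDerivAt y (y' x) x := hasDerivWithinAt_univ.1 (h x (mem_univ x)).1

theorem SolOn.hasDerivAt' {q y y' : ℝ → ℂ} (h : SolOn q y y' univ) (x : ℝ) :
    HasDerivAt y' (q x * y x) x := hasDerivWithinAt_univ.1 (h x (mem_univ x)).2

theorem SolOn.deriv_eq {q y y' : ℝ → ℂ} (h : SolOn q y y' univ) : deriv y = y' :=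
  funext fun x => (h.hasDerivAt x).deriv

theorem SolOn.comp_add_const {q y y' : ℝ → ℂ} (h : SolOn q y y' univ) (c : ℝ) :
    SolOn (fun x => q (x + c)) (fun x => y (x + c)) (fun x => y' (x + c)) univ := fun x _ =>
  ⟨((h.hasDerivAt (x + c)).comp_add_const x c).hasDerivWithinAt,
    ((h.hasDerivAt' (x + c)).comp_add_const x c).hasDerivWithinAt⟩

theorem SolOn.reflect {q y y' : ℝ → ℂ} (h : SolOn q y y' univ) :
    SolOn (fun x => q (-x)) (fun x => y (-x)) (fun x => -y' (-x)) univ := fun x _ => by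
  constructor
  · have := (h.hasDerivAt (-x)).scomp x (hasDerivAt_neg x)
    exact (this.congr_deriv (by simp)).hasDerivWithinAt
  · have := ((h.hasDerivAt' (-x)).scomp x (hasDerivAt_neg x)).neg
    exact (this.congr_deriv (by simp)).hasDerivWithinAt

theorem exists_solOn {q : ℝ → ℂ} (hq : Continuous q) (a b : ℂ) :
    ∃ y y' : ℝ → ℂ, SolOn q y y' univ ∧ y 0 = a ∧ y' 0 = b := by
  -- `F q + G` is the companion matrix `(y, y') ↦ (y', q y)`. Writing its dependence on `q` as a
  -- continuous linear map makes continuity in `x` immediate.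
  let F : ℂ →L[ℝ] (ℂ × ℂ →L[ℝ] ℂ × ℂ) :=
    ((ContinuousLinearMap.compL ℝ (ℂ × ℂ) ℂ (ℂ × ℂ) (ContinuousLinearMap.inr ℝ ℂ ℂ)).comp
      ((ContinuousLinearMap.compL ℝ (ℂ × ℂ) ℂ ℂ).flip (ContinuousLinearMap.fst ℝ ℂ ℂ))).comp
      (ContinuousLinearMap.mul ℝ ℂ)
  let G : ℂ × ℂ →L[ℝ] ℂ × ℂ :=
    (ContinuousLinearMap.inl ℝ ℂ ℂ).comp (ContinuousLinearMap.snd ℝ ℂ ℂ)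
  obtain ⟨Y, hY0, hY⟩ := exists_linear_ode (A := fun x => F (q x) + G)
    ((F.continuous.comp hq).add continuous_const) (a, b)
  have hval : ∀ x, (F (q x) + G) (Y x) = ((Y x).2, q x * (Y x).1) := fun x => by simp [F, G]
  refine ⟨fun x => (Y x).1, fun x => (Y x).2, fun x _ => ⟨?_, ?_⟩, by simp [hY0], by simp [hY0]⟩
  · have := (ContinuousLinearMap.fst ℝ ℂ ℂ).hasFDerivAt.comp_hasDerivAt x (hY x)
    rw [hval] at this
    exact this.hasDerivWithinAt
  · have := (ContinuousLinearMap.snd ℝ ℂ ℂ).hasFDerivAt.comp_hasDerivAt x (hY x)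
    rw [hval] at this
    exact this.hasDerivWithinAt

/-- The Wronskian. -/
def wronsk (y y' v v' : ℝ → ℂ) (x : ℝ) : ℂ := y x * v' x - y' x * v x

theorem hasDerivWithinAt_wronsk {q p y y' v v' : ℝ → ℂ} {s : Set ℝ} (hy : SolOn q y y' s)
    (hv : SolOn p v v' s) {x : ℝ} (hx : x ∈ s) :
    HasDerivWithinAt (wronsk y y' v v') ((p x - q x) * (y x * v x)) s x := by
  exact (((hy x hx).1.mul (hv x hx).2).sub ((hy x hx).2.mul (hv x hx).1)).congr_deriv (by ring)

/-- One-sided derivatives at the ends of `s` do no harm: between `a` and `b` only interior points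
are differentiated, and there the derivative is two-sided. -/
theorem integral_eq_sub_of_hasDerivWithinAt {f f' : ℝ → ℂ} {s : Set ℝ} (hs : OrdConnected s)
    (hf : ∀ x ∈ s, HasDerivWithinAt f (f' x) s x) (hf' : ContinuousOn f' s) {a b : ℝ}
    (ha : a ∈ s) (hb : b ∈ s) : ∫ x in a..b, f' x = f b - f a := by
  have hsub : uIcc a b ⊆ s := hs.uIcc_subset ha hb
  refine intervalIntegral.integral_eq_sub_of_hasDeriv_right
    (fun x hx => ((hf x (hsub hx)).continuousWithinAt.mono hsub)) (fun x hx => ?_)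
    ((hf'.mono hsub).intervalIntegrable)
  have hmem : s ∈ nhds x := Filter.mem_of_superset (Icc_mem_nhds hx.1 hx.2) hsub
  exact ((hf x (mem_of_mem_nhds hmem)).hasDerivAt hmem).hasDerivWithinAt

/-- Lagrange's identity. It is the source of the perturbation formulas in the energy and, with the
second solution the conjugate of the first, of the flux identity. -/
theorem wronsk_sub_eq_integral {V : ℝ → ℝ} {z₁ z₂ : ℂ} {y y' v v' : ℝ → ℂ} {s : Set ℝ}
    (hs : OrdConnected s) (hy : SolOn (pot V z₁) y y' s) (hv : SolOn (pot V z₂) v v' s) {a b : ℝ}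
    (ha : a ∈ s) (hb : b ∈ s) :
    wronsk y y' v v' b - wronsk y y' v v' a = (z₁ - z₂) * ∫ x in a..b, y x * v x := by
  rw [← intervalIntegral.integral_const_mul]
  refine (integral_eq_sub_of_hasDerivWithinAt hs (fun x hx => ?_)
    (continuousOn_const.mul (hy.continuousOn.mul hv.continuousOn)) ha hb).symm
  convert hasDerivWithinAt_wronsk hy hv hx using 1
  simp [pot]

theorem wronsk_const {q y y' v v' : ℝ → ℂ} {s : Set ℝ} (hs : OrdConnected s)
    (hy : SolOn q y y' s) (hv : SolOn q v v' s) {a b : ℝ} (ha : a ∈ s) (hb : b ∈ s) :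
    wronsk y y' v v' a = wronsk y y' v v' b := by
  have := integral_eq_sub_of_hasDerivWithinAt hs (f := wronsk y y' v v') (f' := fun _ => 0)
    (fun x hx => by simpa using hasDerivWithinAt_wronsk hy hv hx) continuousOn_const ha hb
  simp only [intervalIntegral.integral_zero] at this
  linear_combination this

/-- No Gronwall estimate is needed: the Wronskians of `y` with a fundamental system `C`, `S` vanish
at `c`, hence on all of `s`, and `W(C, S) = 1` recovers `y` and `y'` from them by Cramer's rule. -/
theorem SolOn.eq_zero {q y y' : ℝ → ℂ} {s : Set ℝ} (hq : Continuous q) (hs : OrdConnected s)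
    (hy : SolOn q y y' s) {c : ℝ} (hc : c ∈ s) (h0 : y c = 0) (h0' : y' c = 0) {x : ℝ}
    (hx : x ∈ s) : y x = 0 ∧ y' x = 0 := by
  obtain ⟨C, C', hC, hC0, hC0'⟩ := exists_solOn hq 1 0
  obtain ⟨S, S', hS, hS0, hS0'⟩ := exists_solOn hq 0 1
  have hW : wronsk C C' S S' x = 1 := by
    rw [wronsk_const ordConnected_univ hC hS (mem_univ x) (mem_univ 0)]
    simp [wronsk, hC0, hS0', hC0']
  have h1 := wronsk_const hs hy (hC.mono (subset_univ s)) hc hx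
  have h2 := wronsk_const hs hy (hS.mono (subset_univ s)) hc hx
  simp only [wronsk, h0, h0', zero_mul, sub_zero] at h1 h2 hW
  constructor
  · linear_combination (-y x) * hW - C x * h2 + S x * h1
  · linear_combination (-y' x) * hW - C' x * h2 + S' x * h1

theorem SolOn.unique {q y y' v v' : ℝ → ℂ} {s : Set ℝ} (hq : Continuous q) (hs : OrdConnected s)
    (hy : SolOn q y y' s) (hv : SolOn q v v' s) {c : ℝ} (hc : c ∈ s) (h0 : y c = v c)
    (h0' : y' c = v' c) {x : ℝ} (hx : x ∈ s) : y x = v x ∧ y' x = v' x := by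
  have := (hy.lin hv 1 (-1)).eq_zero hq hs hc (by simp [h0]) (by simp [h0']) hx
  constructor
  · linear_combination this.1
  · linear_combination this.2

theorem SolOn.unique_lin {q y y' v v' w w' : ℝ → ℂ} {s : Set ℝ} (hq : Continuous q)
    (hs : OrdConnected s) (hy : SolOn q y y' s) (hv : SolOn q v v' s) (hw : SolOn q w w' s)
    {a b : ℂ} {c : ℝ} (hc : c ∈ s) (h0 : y c = a * v c + b * w c)
    (h0' : y' c = a * v' c + b * w' c) {x : ℝ} (hx : x ∈ s) :
    y x = a * v x + b * w x ∧ y' x = a * v' x + b * w' x :=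
  hy.unique hq hs (hv.lin hw a b) hc h0 h0' hx

theorem schrodingerEq_iff {V : ℝ → ℝ} (hV : Continuous V) (z : ℂ) (w : ℝ → ℂ) :
    SchrodingerEq V w (fun x => z * w x) ↔ SolOn (pot V z) w (deriv w) univ := by
  constructor
  · rintro ⟨h1, h2, h3⟩ x _
    refine ⟨(h1 x).hasDerivAt.hasDerivWithinAt, HasDerivAt.hasDerivWithinAt ?_⟩
    have hc : Continuous fun t => (V t : ℂ) * w t - z * w t := by
      have := h1.continuous
      fun_prop
    have h4 : deriv w = fun b => deriv w 0 + ∫ t in (0 : ℝ)..b, ((V t : ℂ) * w t - z * w t) := by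
      funext b
      rw [← h3 0 b]; ring
    rw [h4]
    have := (intervalIntegral.integral_hasDerivAt_right (hc.intervalIntegrable 0 x)
      (hc.stronglyMeasurableAtFilter _ _) hc.continuousAt).const_add (deriv w 0)
    convert this using 1
    simp [pot, sub_mul]
  · intro h
    have hc : Continuous fun t => (V t : ℂ) * w t - z * w t := by
      have := h.continuous
      fun_prop
    refine ⟨fun x => (h.hasDerivAt x).differentiableAt, fun a b => hc.intervalIntegrable a b,
      fun a b => ?_⟩
    refine (integral_eq_sub_of_hasDerivWithinAt ordConnected_univ (fun x hx => ?_)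
      hc.continuousOn (mem_univ a) (mem_univ b)).symm
    convert (h x hx).2 using 1
    simp [pot, sub_mul]

theorem schrodingerSol_spec {V : ℝ → ℝ} (hV : Continuous V) (z a b : ℂ) :
    SolOn (pot V z) (schrodingerSol V z a b) (deriv (schrodingerSol V z a b)) univ ∧
      schrodingerSol V z a b 0 = a ∧ deriv (schrodingerSol V z a b) 0 = b := by
  have hex : ∃ y : ℝ → ℂ, SchrodingerEq V y (fun x => z * y x) ∧ y 0 = a ∧ deriv y 0 = b := by
    obtain ⟨y, y', hy, h0, h1⟩ := exists_solOn (continuous_pot hV z) a b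
    obtain rfl := hy.deriv_eq
    exact ⟨y, (schrodingerEq_iff hV z y).2 hy, h0, h1⟩
  have := Classical.epsilon_spec hex
  exact ⟨(schrodingerEq_iff hV z _).1 this.1, this.2⟩

/-- Variation of parameters. -/
theorem eq_wronsk_combination {u u' v v' y y' : ℝ → ℂ} {x : ℝ} (hW : wronsk u u' v v' x = 1) :
    y x = wronsk y y' v v' x * u x + wronsk u u' y y' x * v x ∧
      y' x = wronsk y y' v v' x * u' x + wronsk u u' y y' x * v' x := by
  simp only [wronsk] at *
  constructor
  · linear_combination (-y x) * hW
  · linear_combination (-y' x) * hW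

/-! ### Analytic dependence on the spectral parameter -/

theorem norm_integral_le_mul_of_uIcc {f : ℝ → ℂ} {x t B : ℝ} (ht : t ∈ uIcc 0 x) (hB : 0 ≤ B)
    (hf : ∀ s ∈ uIcc 0 x, ‖f s‖ ≤ B) : ‖∫ s in (0 : ℝ)..t, f s‖ ≤ B * |x| := by
  have hsub : uIcc 0 t ⊆ uIcc 0 x := uIcc_subset_uIcc_left ht
  refine (intervalIntegral.norm_integral_le_of_norm_le_const
    fun s hs => hf s (hsub (uIoc_subset_uIcc hs))).trans ?_
  have : |t - 0| ≤ |x - 0| := abs_sub_left_of_mem_uIcc ht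
  rw [sub_zero, sub_zero] at this
  rw [sub_zero]
  gcongr

theorem hasDerivAt_of_norm_sub_le_sq {f : ℂ → ℂ} {z d : ℂ} {C δ : ℝ} (hδ : 0 < δ)
    (h : ∀ w, ‖w - z‖ ≤ δ → ‖f w - f z - (w - z) * d‖ ≤ C * ‖w - z‖ ^ 2) : HasDerivAt f d z := by
  rw [hasDerivAt_iff_isLittleO]
  have h1 : (fun w => f w - f z - (w - z) • d) =O[nhds z] fun w => ‖w - z‖ ^ 2 := by
    refine Asymptotics.IsBigO.of_bound C ?_
    filter_upwards [Metric.closedBall_mem_nhds z hδ] with w hw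
    rw [Metric.mem_closedBall, dist_eq_norm] at hw
    rw [norm_pow, norm_norm]
    exact h w hw
  refine h1.trans_isLittleO ?_
  have h2 : (fun w : ℂ => ‖w - z‖ ^ 2) =o[nhds z] fun w => ‖w - z‖ ^ 1 := by
    have ht : Filter.Tendsto (fun w : ℂ => ‖w - z‖) (nhds z) (nhds 0) := by
      have : Continuous fun w : ℂ => ‖w - z‖ := by fun_prop
      simpa using this.tendsto z
    exact (Asymptotics.isLittleO_pow_pow one_lt_two).comp_tendsto ht
  simp only [pow_one] at h2
  exact h2.of_norm_right

/-- Variation of parameters around the energy `z` expresses `Y w - Y z` as `w - z` times integrals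
of `Y w` against `u` and `v`. This first gives `Y w - Y z = O(w - z)` uniformly up to `x`. Inserting
that bound into the same formula leaves a quadratic error around the linear term. -/
theorem differentiable_schrodingerSol {V : ℝ → ℝ} (hV : Continuous V) (a b : ℂ) (x : ℝ) :
    Differentiable ℂ (fun z => schrodingerSol V z a b x) ∧
      Differentiable ℂ (fun z => deriv (schrodingerSol V z a b) x) := by
  rw [Differentiable, Differentiable, ← forall_and]
  intro z
  obtain ⟨hu, hu0, hu0'⟩ := schrodingerSol_spec hV z 1 0
  obtain ⟨hv, hv0, hv0'⟩ := schrodingerSol_spec hV z 0 1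
  obtain ⟨hy, hy0, hy0'⟩ := schrodingerSol_spec hV z a b
  have hY := fun w => schrodingerSol_spec hV w a b
  set u := schrodingerSol V z 1 0
  set v := schrodingerSol V z 0 1
  set y := schrodingerSol V z a b
  set Y := fun w => schrodingerSol V w a b with hYdef
  change ∀ w, SolOn (pot V w) (Y w) (deriv (Y w)) univ ∧ Y w 0 = a ∧ deriv (Y w) 0 = b at hY
  have hW : ∀ t, wronsk u (deriv u) v (deriv v) t = 1 := fun t => by
    rw [wronsk_const ordConnected_univ hu hv (mem_univ t) (mem_univ 0)]
    simp [wronsk, hu0, hu0', hv0']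
  have hbd : ∀ f : ℝ → ℂ, Continuous f → ∃ K, ∀ t ∈ uIcc 0 x, ‖f t‖ ≤ K := fun f hf =>
    isCompact_uIcc.exists_bound_of_continuousOn hf.continuousOn
  obtain ⟨K1, hK1⟩ := hbd u hu.continuous
  obtain ⟨K2, hK2⟩ := hbd v hv.continuous
  obtain ⟨K3, hK3⟩ := hbd (deriv u) hu.continuous'
  obtain ⟨K4, hK4⟩ := hbd (deriv v) hv.continuous'
  obtain ⟨s₀, hs₀⟩ := hbd y hy.continuous
  set K := max (max K1 K2) (max K3 K4)
  have hu1 : ∀ t ∈ uIcc 0 x, ‖u t‖ ≤ K := fun t ht => (hK1 t ht).trans (by simp [K])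
  have hv1 : ∀ t ∈ uIcc 0 x, ‖v t‖ ≤ K := fun t ht => (hK2 t ht).trans (by simp [K])
  have hu2 : ∀ t ∈ uIcc 0 x, ‖deriv u t‖ ≤ K := fun t ht => (hK3 t ht).trans (by simp [K])
  have hv2 : ∀ t ∈ uIcc 0 x, ‖deriv v t‖ ≤ K := fun t ht => (hK4 t ht).trans (by simp [K])
  have hx : x ∈ uIcc 0 x := right_mem_uIcc
  have hK0 : 0 ≤ K := (norm_nonneg _).trans (hu1 x hx)
  have hs0 : 0 ≤ s₀ := (norm_nonneg _).trans (hs₀ x hx)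
  have hA : ∀ w t, wronsk (Y w) (deriv (Y w)) v (deriv v) t
      = a + (w - z) * ∫ s in (0 : ℝ)..t, Y w s * v s := fun w t => by
    rw [← wronsk_sub_eq_integral ordConnected_univ (hY w).1 hv (mem_univ 0) (mem_univ t)]
    simp [wronsk, (hY w).2.1, hv0, hv0']
  have hB : ∀ w t, wronsk u (deriv u) (Y w) (deriv (Y w)) t
      = b - (w - z) * ∫ s in (0 : ℝ)..t, u s * Y w s := fun w t => by
    have := wronsk_sub_eq_integral ordConnected_univ hu (hY w).1 (mem_univ 0) (mem_univ t)
    have h0 : wronsk u (deriv u) (Y w) (deriv (Y w)) 0 = b := by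
      simp [wronsk, (hY w).2.2, hu0, hu0']
    linear_combination this + h0
  have hYz : Y z = y := rfl
  set L := 2 * K * K * |x| with hL
  have hL0 : 0 ≤ L := by positivity
  -- the difference of two solutions in terms of `p = u` or `u'`, `r = v` or `v'`
  have key : ∀ (p r : ℂ) (w : ℂ) (g : ℝ → ℂ) (t : ℝ) (B : ℝ), ‖p‖ ≤ K → ‖r‖ ≤ K →
      t ∈ uIcc 0 x → 0 ≤ B → (∀ s ∈ uIcc 0 x, ‖g s‖ ≤ B) →
      ‖w * ((∫ s in (0 : ℝ)..t, g s * v s) * p - (∫ s in (0 : ℝ)..t, u s * g s) * r)‖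
        ≤ ‖w‖ * (L * B) := by
    intro p r w g t B hp hr ht hB0 hg
    have h1 : ‖∫ s in (0 : ℝ)..t, g s * v s‖ ≤ B * K * |x| :=
      norm_integral_le_mul_of_uIcc ht (by positivity) fun s hs => by
        rw [norm_mul]; exact mul_le_mul (hg s hs) (hv1 s hs) (norm_nonneg _) hB0
    have h2 : ‖∫ s in (0 : ℝ)..t, u s * g s‖ ≤ K * B * |x| :=
      norm_integral_le_mul_of_uIcc ht (by positivity) fun s hs => by
        rw [norm_mul]; exact mul_le_mul (hu1 s hs) (hg s hs) (norm_nonneg _) hK0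
    rw [norm_mul]
    refine mul_le_mul_of_nonneg_left ((norm_sub_le _ _).trans ?_) (norm_nonneg _)
    rw [norm_mul, norm_mul]
    calc _ ≤ B * K * |x| * K + K * B * |x| * K := by gcongr
      _ = L * B := by rw [hL]; ring
  have hdiff : ∀ w t, Y w t - y t = (w - z) * ((∫ s in (0 : ℝ)..t, Y w s * v s) * u t
      - (∫ s in (0 : ℝ)..t, u s * Y w s) * v t) := fun w t => by
    have h1 := (eq_wronsk_combination (y := Y w) (y' := deriv (Y w)) (hW t)).1
    have h2 := (eq_wronsk_combination (y := Y z) (y' := deriv (Y z)) (hW t)).1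
    rw [hA, hB] at h1 h2
    rw [← hYz]
    linear_combination h1 - h2
  have hdiff' : ∀ w t, deriv (Y w) t - deriv y t = (w - z) * ((∫ s in (0 : ℝ)..t, Y w s * v s) *
      deriv u t - (∫ s in (0 : ℝ)..t, u s * Y w s) * deriv v t) := fun w t => by
    have h1 := (eq_wronsk_combination (y := Y w) (y' := deriv (Y w)) (hW t)).2
    have h2 := (eq_wronsk_combination (y := Y z) (y' := deriv (Y z)) (hW t)).2
    rw [hA, hB] at h1 h2
    rw [← hYz]
    linear_combination h1 - h2
  -- The radius makes `‖w - z‖ * L ≤ 1 / 2`, so the maximum of `‖Y w‖` is absorbed and is at most `2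
  -- * s₀`.
  have hsmall : ∀ w, ‖w - z‖ ≤ 1 / (2 * (L + 1)) → ∀ t ∈ uIcc 0 x,
      ‖Y w t - y t‖ ≤ ‖w - z‖ * (2 * L * s₀) := by
    intro w hw t ht
    obtain ⟨t₀, ht₀, hmax⟩ := isCompact_uIcc.exists_isMaxOn (s := uIcc 0 x) ⟨x, hx⟩
      (hY w).1.continuous.norm.continuousOn
    have hb := fun t ht => key (u t) (v t) (w - z) (Y w) t ‖Y w t₀‖ (hu1 t ht) (hv1 t ht) ht
      (norm_nonneg _) fun s hs => hmax hs
    have hhL : ‖w - z‖ * L ≤ 1 / 2 := by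
      rw [le_div_iff₀ (by positivity)] at hw
      nlinarith [norm_nonneg (w - z)]
    have h1 : ‖Y w t₀‖ ≤ s₀ + 1 / 2 * ‖Y w t₀‖ := by
      have h2 := hb t₀ ht₀
      rw [← hdiff] at h2
      have h3 := norm_sub_norm_le (Y w t₀) (y t₀)
      have h4 := hs₀ t₀ ht₀
      nlinarith [norm_nonneg (Y w t₀)]
    have h2 := hb t ht
    rw [← hdiff] at h2
    refine h2.trans ?_
    have : L * ‖Y w t₀‖ ≤ 2 * L * s₀ := by nlinarith
    gcongr
  have main : ∀ (p r : ℂ), ‖p‖ ≤ K → ‖r‖ ≤ K → ∀ f : ℂ → ℂ, (∀ w, f w - f z =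
      (w - z) * ((∫ s in (0 : ℝ)..x, Y w s * v s) * p - (∫ s in (0 : ℝ)..x, u s * Y w s) * r)) →
      DifferentiableAt ℂ f z := by
    intro p r hp hr f hf
    refine (hasDerivAt_of_norm_sub_le_sq (d := (∫ s in (0 : ℝ)..x, y s * v s) * p
      - (∫ s in (0 : ℝ)..x, u s * y s) * r) (C := L * (2 * L * s₀)) (δ := 1 / (2 * (L + 1)))
      (by positivity) fun w hw => ?_).differentiableAt
    have h1 := key p r (w - z) (fun s => Y w s - y s) x (‖w - z‖ * (2 * L * s₀)) hp hr hx
      (by positivity) (hsmall w hw)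
    have hYc := (hY w).1.continuous
    have hyc := hy.continuous
    have huc := hu.continuous
    have hvc := hv.continuous
    have e1 : ∫ s in (0 : ℝ)..x, (Y w s - y s) * v s
        = (∫ s in (0 : ℝ)..x, Y w s * v s) - ∫ s in (0 : ℝ)..x, y s * v s := by
      simp_rw [sub_mul]
      exact intervalIntegral.integral_sub ((hYc.mul hvc).intervalIntegrable _ _)
        ((hyc.mul hvc).intervalIntegrable _ _)
    have e2 : ∫ s in (0 : ℝ)..x, u s * (Y w s - y s)
        = (∫ s in (0 : ℝ)..x, u s * Y w s) - ∫ s in (0 : ℝ)..x, u s * y s := by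
      simp_rw [mul_sub]
      exact intervalIntegral.integral_sub ((huc.mul hYc).intervalIntegrable _ _)
        ((huc.mul hyc).intervalIntegrable _ _)
    simp only [e1, e2] at h1
    rw [hf w]
    calc _ = _ := by congr 1; ring
      _ ≤ _ := h1
      _ = _ := by ring
  exact ⟨main (u x) (v x) (hu1 x hx) (hv1 x hx) _ fun w => hdiff w x,
    main (deriv u x) (deriv v x) (hu2 x hx) (hv2 x hx) _ fun w => hdiff' w x⟩

/-! ### Complex conjugation and the flux identity -/

theorem SolOn.conj {V : ℝ → ℝ} {z : ℂ} {y y' : ℝ → ℂ} {s : Set ℝ} (hy : SolOn (pot V z) y y' s) :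
    SolOn (pot V (starRingEnd ℂ z)) (fun x => starRingEnd ℂ (y x))
      (fun x => starRingEnd ℂ (y' x)) s := fun x hx => by
  have h := hy x hx
  refine ⟨h.1.star, h.2.star.congr_deriv ?_⟩
  simp [pot]

/-- An outgoing solution on `[-M, M]` of frequency `ξ`, `Re ξ ≠ 0`, forces `Im ξ < 0`. -/
theorem im_neg_of_outgoing {V : ℝ → ℝ} (hV : Continuous V) {ξ : ℂ} (hξ : ξ.re ≠ 0) {M : ℝ}
    (hM : 0 ≤ M) {y y' : ℝ → ℂ} (hy : SolOn (pot V (ξ ^ 2)) y y' (Icc (-M) M))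
    (hp : y' M = Complex.I * ξ * y M) (hm : y' (-M) = -(Complex.I * ξ * y (-M)))
    (h0 : ∃ x ∈ Icc (-M) M, y x ≠ 0) : ξ.im < 0 := by
  have hMM : M ∈ Icc (-M) M := ⟨by linarith, le_rfl⟩
  have hmM : -M ∈ Icc (-M) M := ⟨le_rfl, by linarith⟩
  have h := wronsk_sub_eq_integral ordConnected_Icc hy hy.conj hmM hMM
  have e : ∀ x, y x * starRingEnd ℂ (y x) = ((‖y x‖ ^ 2 : ℝ) : ℂ) := fun x => by
    rw [Complex.mul_conj, Complex.normSq_eq_norm_sq]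
  simp_rw [e] at h
  rw [intervalIntegral.integral_ofReal] at h
  set J := ∫ x in (-M)..M, ‖y x‖ ^ 2
  have hJ : 0 ≤ J := intervalIntegral.integral_nonneg (by linarith) fun x _ => by positivity
  have e1 := e M
  have e2 := e (-M)
  simp only [wronsk, hp, hm, map_mul, map_neg, Complex.conj_I, map_pow] at h
  -- The Wronskian of `y` with its conjugate equals `∓ 2 i Re ξ ‖y‖²` at `± M`, by the outgoing
  -- conditions, and changes by `4 i Re ξ Im ξ J` in between.
  have key : (ξ.re : ℂ) * ((‖y M‖ ^ 2 + ‖y (-M)‖ ^ 2 + 2 * ξ.im * J : ℝ) : ℂ) = 0 := by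
    have hre : ξ + starRingEnd ℂ ξ = 2 * (ξ.re : ℂ) := by rw [Complex.add_conj]; push_cast; ring
    have him : ξ - starRingEnd ℂ ξ = 2 * (ξ.im : ℂ) * Complex.I := by
      rw [Complex.sub_conj]; push_cast; ring
    have h2 : -(Complex.I * (2 * (ξ.re : ℂ))) * (((‖y M‖ ^ 2 : ℝ) : ℂ) + ((‖y (-M)‖ ^ 2 : ℝ) : ℂ))
        = (2 * (ξ.re : ℂ)) * (2 * (ξ.im : ℂ) * Complex.I) * J := by
      rw [← hre, ← him, ← e1, ← e2]
      linear_combination h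
    push_cast at h2 ⊢
    have hI : Complex.I * Complex.I = -1 := Complex.I_mul_I
    linear_combination (Complex.I / 2) * h2 + ((ξ.re : ℂ) * (‖y M‖ ^ 2 + ‖y (-M)‖ ^ 2) +
      2 * (ξ.re : ℂ) * ξ.im * J) * hI
  have key2 : ‖y M‖ ^ 2 + ‖y (-M)‖ ^ 2 + 2 * ξ.im * J = 0 := by
    rcases mul_eq_zero.1 key with h | h
    · exact absurd (by exact_mod_cast h) hξ
    · exact_mod_cast h
  by_contra hneg
  push Not at hneg
  -- With `Im ξ ≥ 0` the three terms of `key2` are nonnegative. So `y M` vanishes, then `y' M` by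
  -- the boundary condition, and `y` is trivial.
  have hyM : y M = 0 := by
    have : ‖y M‖ ^ 2 = 0 := by nlinarith [sq_nonneg ‖y M‖, sq_nonneg ‖y (-M)‖, mul_nonneg hneg hJ]
    simpa using this
  obtain ⟨x, hx, hx0⟩ := h0
  exact hx0 (hy.eq_zero (continuous_pot hV _) ordConnected_Icc hMM hyM (by simp [hp, hyM]) hx).1

/-! ### Square integrable solutions on a half-line -/

/-- The continuous function `y` is square integrable on `[a, ∞)`. -/
def SqBdd (y : ℝ → ℂ) (a : ℝ) : Prop := ∃ B : ℝ, ∀ b, a ≤ b → ∫ x in a..b, ‖y x‖ ^ 2 ≤ B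

theorem SqBdd.of_memLp {y : ℝ → ℂ} (hy : MemLp y 2 volume) (a : ℝ) : SqBdd y a := by
  have hi : Integrable (fun x => ‖y x‖ ^ 2) := hy.integrable_norm_pow (by norm_num)
  refine ⟨∫ x, ‖y x‖ ^ 2, fun b hb => ?_⟩
  rw [intervalIntegral.integral_of_le hb]
  exact setIntegral_le_integral hi (Filter.Eventually.of_forall fun x => by positivity)

theorem sqBdd_shift {y : ℝ → ℂ} (hc : Continuous y) {a : ℝ} (h : SqBdd y a) :
    SqBdd (fun x => y (x + 1)) a := by
  obtain ⟨B, hB⟩ := h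
  have hc2 : Continuous fun x => ‖y x‖ ^ 2 := by fun_prop
  refine ⟨B, fun b hb => ?_⟩
  rw [intervalIntegral.integral_comp_add_right (fun x => ‖y x‖ ^ 2)]
  have h1 := intervalIntegral.integral_add_adjacent_intervals
    (hc2.intervalIntegrable a (a + 1)) (hc2.intervalIntegrable (a + 1) (b + 1)) (μ := volume)
  have h2 : 0 ≤ ∫ x in a..a + 1, ‖y x‖ ^ 2 :=
    intervalIntegral.integral_nonneg (by linarith) fun x _ => by positivity
  linarith [hB (b + 1) (by linarith)]

/-- With `G = (‖y‖²)'` one has `G' = 2 ((V - E) ‖y‖² + ‖y'‖²)`. If `∫ ‖y'‖²` were unbounded while `∫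
‖y‖²` is bounded, `G` would eventually stay above `1`, and `‖y‖²` would grow at least linearly. -/
theorem sqBdd_deriv {V : ℝ → ℝ} {E a K : ℝ} (hV : Continuous V) (hK : ∀ x, a ≤ x → |V x - E| ≤ K)
    {y y' : ℝ → ℂ} (hy : SolOn (pot V E) y y' univ) (h : SqBdd y a) : SqBdd y' a := by
  have hyc := hy.continuous
  have hyc' := hy.continuous'
  obtain ⟨B, hB⟩ := h
  have hK0 : 0 ≤ K := (abs_nonneg _).trans (hK a le_rfl)
  by_contra hcon
  simp only [SqBdd, not_exists, not_forall, not_le] at hcon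
  let G : ℝ → ℝ := fun x => 2 * inner ℝ (y x) (y' x)
  have hG0 : ∀ x, HasDerivAt (fun x => ‖y x‖ ^ 2) (G x) x := fun x => (hy.hasDerivAt x).norm_sq
  have hG : ∀ x, HasDerivAt G (2 * ((V x - E) * ‖y x‖ ^ 2 + ‖y' x‖ ^ 2)) x := fun x => by
    refine (((hy.hasDerivAt x).inner ℝ (hy.hasDerivAt' x)).const_mul 2).congr_deriv ?_
    have : pot V E x * y x = (V x - E) • y x := by simp [pot, Complex.real_smul]
    rw [this, inner_smul_right, real_inner_self_eq_norm_sq, real_inner_self_eq_norm_sq]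
  have hGc : Continuous fun x => 2 * ((V x - E) * ‖y x‖ ^ 2 + ‖y' x‖ ^ 2) := by fun_prop
  have hc1 : Continuous fun x => ‖y x‖ ^ 2 := by fun_prop
  have hc2 : Continuous fun x => ‖y' x‖ ^ 2 := by fun_prop
  have hc3 : Continuous fun x => (V x - E) * ‖y x‖ ^ 2 := by fun_prop
  -- The constant pays for `G a` and for the worst contribution `-K * B` of the potential term,
  -- leaving `G ≥ 1`.
  obtain ⟨b₀, hb₀, hI⟩ := hcon (K * B + (1 - G a) / 2)
  have hGlow : ∀ b, b₀ ≤ b → 1 ≤ G b := by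
    intro b hb
    have hab : a ≤ b := hb₀.trans hb
    have h1 : ∫ x in a..b, 2 * ((V x - E) * ‖y x‖ ^ 2 + ‖y' x‖ ^ 2) = G b - G a :=
      intervalIntegral.integral_eq_sub_of_hasDerivAt (fun x _ => hG x)
        (hGc.intervalIntegrable _ _)
    rw [intervalIntegral.integral_const_mul, intervalIntegral.integral_add
      (hc3.intervalIntegrable _ _) (hc2.intervalIntegrable _ _)] at h1
    have h2 : -(K * B) ≤ ∫ x in a..b, (V x - E) * ‖y x‖ ^ 2 := by
      have h3 : ∫ x in a..b, (-K) * ‖y x‖ ^ 2 ≤ ∫ x in a..b, (V x - E) * ‖y x‖ ^ 2 :=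
        intervalIntegral.integral_mono_on hab ((hc1.const_mul (-K)).intervalIntegrable _ _)
          (hc3.intervalIntegrable _ _) fun x hx =>
          mul_le_mul_of_nonneg_right (neg_le_of_abs_le (hK x hx.1)) (by positivity)
      rw [intervalIntegral.integral_const_mul] at h3
      nlinarith [hB b hab]
    have h4 : ∫ x in a..b₀, ‖y' x‖ ^ 2 ≤ ∫ x in a..b, ‖y' x‖ ^ 2 := by
      have h5 := intervalIntegral.integral_add_adjacent_intervals
        (hc2.intervalIntegrable a b₀) (hc2.intervalIntegrable b₀ b) (μ := volume)
      have : 0 ≤ ∫ x in b₀..b, ‖y' x‖ ^ 2 :=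
        intervalIntegral.integral_nonneg hb fun x _ => by positivity
      linarith
    linarith
  have hlow : ∀ b, b₀ ≤ b → b - b₀ ≤ ‖y b‖ ^ 2 := by
    intro b hb
    have hGcont : Continuous G := continuous_iff_continuousAt.2 fun x => (hG x).continuousAt
    have h1 : ∫ x in b₀..b, G x = ‖y b‖ ^ 2 - ‖y b₀‖ ^ 2 :=
      intervalIntegral.integral_eq_sub_of_hasDerivAt (fun x _ => hG0 x)
        (hGcont.intervalIntegrable _ _)
    have h2 : ∫ _x in b₀..b, (1 : ℝ) ≤ ∫ x in b₀..b, G x :=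
      intervalIntegral.integral_mono_on hb (continuous_const.intervalIntegrable _ _)
        (hGcont.intervalIntegrable _ _) fun x hx => hGlow x hx.1
    rw [intervalIntegral.integral_const, smul_eq_mul, mul_one] at h2
    nlinarith [sq_nonneg ‖y b₀‖]
  -- On `[b₀ + 1, b]` the integrand is at least `1`, and the length `|B| + 1` exceeds `B`.
  set b := b₀ + 1 + |B| + 1
  have hb1 : b₀ + 1 ≤ b := by simp only [b]; linarith [abs_nonneg B]
  have h1 : ∫ _x in (b₀ + 1)..b, (1 : ℝ) ≤ ∫ x in (b₀ + 1)..b, ‖y x‖ ^ 2 :=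
    intervalIntegral.integral_mono_on hb1 (continuous_const.intervalIntegrable _ _)
      (hc1.intervalIntegrable _ _) fun x hx => by linarith [hlow x (by linarith [hx.1]), hx.1]
  rw [intervalIntegral.integral_const, smul_eq_mul, mul_one] at h1
  have h2 := intervalIntegral.integral_add_adjacent_intervals
    (hc1.intervalIntegrable a (b₀ + 1)) (hc1.intervalIntegrable (b₀ + 1) b) (μ := volume)
  have h3 : 0 ≤ ∫ x in a..b₀ + 1, ‖y x‖ ^ 2 :=
    intervalIntegral.integral_nonneg (by linarith) fun x _ => by positivity
  have h4 := hB b (by linarith)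
  have : b - (b₀ + 1) = |B| + 1 := by simp only [b]; ring
  linarith [le_abs_self B]

/-- The Wronskian is constant and dominated by the sum of the four squares, whose integral over `[a,
∞)` is finite. -/
theorem wronsk_eq_zero_of_sqBdd {q y y' v v' : ℝ → ℂ} {a : ℝ} (hy : SolOn q y y' (Ici a))
    (hv : SolOn q v v' (Ici a)) (h1 : SqBdd y a) (h2 : SqBdd y' a) (h3 : SqBdd v a)
    (h4 : SqBdd v' a) : wronsk y y' v v' a = 0 := by
  obtain ⟨B1, hB1⟩ := h1
  obtain ⟨B2, hB2⟩ := h2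
  obtain ⟨B3, hB3⟩ := h3
  obtain ⟨B4, hB4⟩ := h4
  by_contra hne
  have hpos : 0 < ‖wronsk y y' v v' a‖ := norm_pos_iff.2 hne
  set w := ‖wronsk y y' v v' a‖
  set t := (|B1 + B2 + B3 + B4| + 1) / w
  have ht : 0 ≤ t := by positivity
  have hat : a ≤ a + t := by linarith
  have hsub : uIcc a (a + t) ⊆ Ici a := by rw [uIcc_of_le hat]; exact Icc_subset_Ici_self
  have hint : ∀ f : ℝ → ℂ, ContinuousOn f (Ici a) →
      IntervalIntegrable (fun x => ‖f x‖ ^ 2) volume a (a + t) := fun f hf =>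
    ((hf.mono hsub).norm.pow 2).intervalIntegrable
  have i1 := hint y hy.continuousOn
  have i2 := hint y' hy.continuousOn'
  have i3 := hint v hv.continuousOn
  have i4 := hint v' hv.continuousOn'
  have h : ∫ _x in a..a + t, w ≤ ∫ x in a..a + t, (‖y x‖ ^ 2 + ‖y' x‖ ^ 2 + ‖v x‖ ^ 2 + ‖v' x‖ ^ 2) :=
    intervalIntegral.integral_mono_on hat (continuous_const.intervalIntegrable _ _)
      (((i1.add i2).add i3).add i4) fun x hx => by
      have e : wronsk y y' v v' a = wronsk y y' v v' x :=
        wronsk_const ordConnected_Ici hy hv self_mem_Ici hx.1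
      calc w = ‖y x * v' x - y' x * v x‖ := by simp only [w, e]; rfl
        _ ≤ ‖y x‖ * ‖v' x‖ + ‖y' x‖ * ‖v x‖ := by
          rw [← norm_mul, ← norm_mul]; exact norm_sub_le _ _
        _ ≤ _ := by
          nlinarith [sq_nonneg (‖y x‖ - ‖v' x‖), sq_nonneg (‖y' x‖ - ‖v x‖),
            sq_nonneg (‖y x‖), sq_nonneg (‖v' x‖), sq_nonneg (‖y' x‖), sq_nonneg (‖v x‖)]
  rw [intervalIntegral.integral_add ((i1.add i2).add i3) i4,
    intervalIntegral.integral_add (i1.add i2) i3, intervalIntegral.integral_add i1 i2,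
    intervalIntegral.integral_const, smul_eq_mul, add_sub_cancel_left] at h
  have htw : t * w = |B1 + B2 + B3 + B4| + 1 := div_mul_cancel₀ _ hpos.ne'
  linarith [hB1 _ hat, hB2 _ hat, hB3 _ hat, hB4 _ hat, le_abs_self (B1 + B2 + B3 + B4)]

/-! ### Floquet theory on a half-line -/

theorem exists_smul_of_det_eq_zero {p p' r r' : ℂ} (h : p ≠ 0 ∨ p' ≠ 0)
    (hd : p * r' - p' * r = 0) : ∃ c, r = c * p ∧ r' = c * p' := by
  rcases h with h | h
  · refine ⟨r / p, by field_simp, ?_⟩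
    field_simp; linear_combination hd
  · refine ⟨r' / p', ?_, by field_simp⟩
    field_simp; linear_combination -hd

theorem SolOn.ne_zero_or {q y y' : ℝ → ℂ} (hq : Continuous q) (hy : SolOn q y y' univ)
    (h : ∃ x, y x ≠ 0) (x : ℝ) : y x ≠ 0 ∨ y' x ≠ 0 := by
  by_contra hcon
  push Not at hcon
  obtain ⟨t, ht⟩ := h
  exact ht (hy.eq_zero hq ordConnected_univ (mem_univ x) hcon.1 hcon.2 (mem_univ t)).1

/-- The bound on the compact interval `[0, ρ + 1]`, which contains a full period beyond `ρ`,
propagates to the right by unit shifts. -/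
theorem exists_bound_of_shift_le {g : ℝ → ℝ} (hg : Continuous g) {ρ : ℝ} (hρ : 0 ≤ ρ)
    (h : ∀ x, ρ ≤ x → g (x + 1) ≤ g x) : ∃ B, ∀ x, 0 ≤ x → g x ≤ B := by
  obtain ⟨B, hB⟩ := (isCompact_Icc (a := 0) (b := ρ + 1)).exists_bound_of_continuousOn
    hg.continuousOn
  have key : ∀ n : ℕ, ∀ x, 0 ≤ x → x ≤ ρ + 1 + n → g x ≤ B := by
    intro n
    induction n with
    | zero => exact fun x h0 h1 => (le_abs_self _).trans (hB x ⟨h0, by simpa using h1⟩)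
    | succ n ih =>
      intro x h0 h1
      push_cast at h1
      rcases le_total x (ρ + 1 + n) with hx | hx
      · exact ih x h0 hx
      · have h2 := h (x - 1) (by linarith [(n.cast_nonneg : (0 : ℝ) ≤ n)])
        rw [sub_add_cancel] at h2
        exact h2.trans (ih (x - 1) (by linarith [(n.cast_nonneg : (0 : ℝ) ≤ n)]) (by linarith))
  refine ⟨B, fun x hx => ?_⟩
  obtain ⟨n, hn⟩ := exists_nat_ge (x - (ρ + 1))
  exact key n x hx (by linarith)

theorem exists_bound_potential {V : ℝ → ℝ} (hV : Continuous V) (E : ℝ) {ρ : ℝ} (hρ : 0 ≤ ρ)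
    (hper : ∀ x, ρ ≤ x → V (x + 1) = V x) : ∃ K, ∀ x, ρ ≤ x → |V x - E| ≤ K := by
  obtain ⟨K, hK⟩ := exists_bound_of_shift_le (g := fun x => |V x - E|) (by fun_prop) hρ
    fun x hx => by simp [hper x hx]
  exact ⟨K, fun x hx => hK x (hρ.trans hx)⟩

theorem integral_sq_pos {q y y' : ℝ → ℂ} (hq : Continuous q) (hy : SolOn q y y' univ)
    (h : ∃ x, y x ≠ 0) {a b : ℝ} (hab : a < b) : 0 < ∫ x in a..b, ‖y x‖ ^ 2 := by
  have hc := hy.continuous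
  refine intervalIntegral.integral_pos hab (by fun_prop) (fun x _ => by positivity) ?_
  by_contra hcon
  push Not at hcon
  have h0 : ∀ x ∈ Icc a b, y x = 0 := fun x hx => by
    have := hcon x hx
    have h2 : ‖y x‖ ^ 2 = 0 := le_antisymm this (by positivity)
    simpa using h2
  set m := (a + b) / 2
  have hm : m ∈ Ioo a b := ⟨by simp only [m]; linarith, by simp only [m]; linarith⟩
  have h1 : HasDerivAt y 0 m := (hasDerivAt_const m (0 : ℂ)).congr_of_eventuallyEq <| by
    filter_upwards [Icc_mem_nhds hm.1 hm.2] with x hx using h0 x hx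
  rcases hy.ne_zero_or hq h m with h2 | h2
  · exact h2 (h0 m (Ioo_subset_Icc_self hm))
  · exact h2 ((hy.hasDerivAt m).unique h1)

/-- A square integrable solution on a half-line where the potential is periodic is a Floquet
solution. -/
theorem exists_floquet_multiplier {V : ℝ → ℝ} {E ρ : ℝ} (hV : Continuous V) (hρ : 0 ≤ ρ)
    (hper : ∀ x, ρ ≤ x → V (x + 1) = V x) {y y' : ℝ → ℂ} (hy : SolOn (pot V E) y y' univ)
    (h0 : ∃ x, y x ≠ 0) (hL2 : SqBdd y ρ) :
    ∃ μ : ℂ, μ ≠ 0 ∧ ‖μ‖ < 1 ∧ ∀ x, ρ ≤ x → y (x + 1) = μ * y x ∧ y' (x + 1) = μ * y' x := by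
  have hq := continuous_pot hV E
  obtain ⟨K, hK⟩ := exists_bound_potential hV E hρ hper
  have hL2' := sqBdd_deriv hV hK hy hL2
  -- The unit translate solves the same equation on `[ρ, ∞)` and is again square integrable, so its
  -- Wronskian with `y` vanishes and it is a multiple of `y`.
  have hT : SolOn (pot V E) (fun x => y (x + 1)) (fun x => y' (x + 1)) (Ici ρ) :=
    ((hy.comp_add_const 1).mono (subset_univ _)).congr_coeff fun x hx => by
      simp [pot, hper x hx]
  have hW := wronsk_eq_zero_of_sqBdd (hy.mono (subset_univ _)) hT hL2 hL2'
    (sqBdd_shift hy.continuous hL2) (sqBdd_shift hy.continuous' hL2')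
  obtain ⟨μ, hμ1, hμ2⟩ := exists_smul_of_det_eq_zero (hy.ne_zero_or hq h0 ρ) hW
  have hall : ∀ x, ρ ≤ x → y (x + 1) = μ * y x ∧ y' (x + 1) = μ * y' x := fun x hx => by
    have hy1 := hy.mono (subset_univ (Ici ρ))
    have := hT.unique_lin hq ordConnected_Ici hy1 hy1 (a := μ) (b := 0) self_mem_Ici
      (by simp [hμ1]) (by simp [hμ2]) hx
    simpa using this
  have hμ0 : μ ≠ 0 := by
    rintro rfl
    have := hall ρ le_rfl
    simp only [zero_mul] at this
    rcases hy.ne_zero_or hq h0 (ρ + 1) with h | h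
    · exact h this.1
    · exact h this.2
  refine ⟨μ, hμ0, ?_, hall⟩
  -- If `‖μ‖ ≥ 1`, each further period carries at least the mass `c` of the first one.
  by_contra hge
  push Not at hge
  have hc : Continuous fun x => ‖y x‖ ^ 2 := by have := hy.continuous; fun_prop
  set c := ∫ x in ρ..(ρ + 1), ‖y x‖ ^ 2
  have hcpos : 0 < c := integral_sq_pos hq hy h0 (by linarith)
  have hgrow : ∀ n : ℕ, n * c ≤ ∫ x in ρ..(ρ + n), ‖y x‖ ^ 2 := by
    intro n
    induction n with
    | zero => simp
    | succ n ih =>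
      have h1 := intervalIntegral.integral_add_adjacent_intervals
        (hc.intervalIntegrable ρ (ρ + 1)) (hc.intervalIntegrable (ρ + 1) (ρ + n + 1)) (μ := volume)
      have h2 : ∫ x in ρ..(ρ + n), ‖y x‖ ^ 2 ≤ ∫ x in ρ + 1..ρ + n + 1, ‖y x‖ ^ 2 := by
        rw [← intervalIntegral.integral_comp_add_right (fun x => ‖y x‖ ^ 2)]
        refine intervalIntegral.integral_mono_on (by simp) (hc.intervalIntegrable _ _)
          ((hc.comp (continuous_add_const 1)).intervalIntegrable _ _) fun x hx => ?_
        rw [(hall x hx.1).1, norm_mul, mul_pow]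
        nlinarith [sq_nonneg (‖y x‖), mul_self_nonneg (‖μ‖ - 1)]
      push_cast
      rw [← add_assoc]
      linarith
  obtain ⟨B, hB⟩ := hL2
  obtain ⟨n, hn⟩ := exists_nat_gt (B / c)
  rw [div_lt_iff₀ hcpos] at hn
  linarith [hB (ρ + n) (by simp), hgrow n]

/-- Exponential bounds for a decaying Floquet solution `u` and a second solution `v`. -/
theorem exists_exp_bounds {V : ℝ → ℝ} {E ρ κ : ℝ} (hV : Continuous V) (hρ : 0 ≤ ρ) (hκ : 0 < κ)
    (hper : ∀ x, ρ ≤ x → V (x + 1) = V x) {u u' v v' : ℝ → ℂ}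
    (hu : SolOn (pot V E) u u' univ) (hv : SolOn (pot V E) v v' univ)
    (hW : ∀ x, wronsk u u' v v' x = 1) {μ : ℂ} (hμ : ‖μ‖ = Real.exp (-κ))
    (hμu : ∀ x, ρ ≤ x → u (x + 1) = μ * u x ∧ u' (x + 1) = μ * u' x) :
    ∃ C, 0 < C ∧ ∀ x, 0 ≤ x → ‖u x‖ ≤ C * Real.exp (-κ * x) ∧ ‖u' x‖ ≤ C * Real.exp (-κ * x) ∧
      ‖v x‖ ≤ C * Real.exp (κ * x) ∧ ‖v' x‖ ≤ C * Real.exp (κ * x) := by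
  have hq := continuous_pot hV E
  have huc := hu.continuous
  have huc' := hu.continuous'
  have hvc := hv.continuous
  have hvc' := hv.continuous'
  have hdec : ∀ f : ℝ → ℂ, Continuous f → (∀ x, ρ ≤ x → f (x + 1) = μ * f x) →
      ∃ B, ∀ x, 0 ≤ x → ‖f x‖ ≤ B * Real.exp (-κ * x) := by
    intro f hf hsh
    obtain ⟨B, hB⟩ := exists_bound_of_shift_le (g := fun x => ‖f x‖ * Real.exp (κ * x))
      (by fun_prop) hρ fun x hx => by
        rw [hsh x hx, norm_mul, hμ, mul_add, Real.exp_add, mul_one]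
        have : Real.exp (-κ) * Real.exp κ = 1 := by rw [← Real.exp_add]; simp
        apply le_of_eq
        linear_combination ‖f x‖ * Real.exp (κ * x) * this
    refine ⟨B, fun x hx => ?_⟩
    rw [neg_mul, Real.exp_neg, ← div_eq_mul_inv, le_div_iff₀ (Real.exp_pos _)]
    exact hB x hx
  obtain ⟨B1, hB1⟩ := hdec u huc fun x hx => (hμu x hx).1
  obtain ⟨B2, hB2⟩ := hdec u' huc' fun x hx => (hμu x hx).2
  have hμ0 : μ ≠ 0 := norm_pos_iff.1 (hμ ▸ Real.exp_pos _)
  -- `v (x + 1) - μ⁻¹ v x` is a multiple of `u`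
  have hT : SolOn (pot V E) (fun x => v (x + 1)) (fun x => v' (x + 1)) (Ici ρ) :=
    ((hv.comp_add_const 1).mono (subset_univ _)).congr_coeff fun x hx => by
      simp [pot, hper x hx]
  have hu0 : u ρ ≠ 0 ∨ u' ρ ≠ 0 := by
    by_contra hcon
    push Not at hcon
    simpa [wronsk, hcon.1, hcon.2] using hW ρ
  -- The Wronskian with `u` is `1` at both `ρ` and `ρ + 1`, while `u` is multiplied by `μ`. So the
  -- Wronskian of `u` with this difference is zero at `ρ`.
  obtain ⟨c, hc1, hc2⟩ := exists_smul_of_det_eq_zero (r := v (ρ + 1) - μ⁻¹ * v ρ)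
    (r' := v' (ρ + 1) - μ⁻¹ * v' ρ) hu0 <| by
      have h1 := hW ρ
      have h2 := hW (ρ + 1)
      simp only [wronsk, (hμu ρ le_rfl).1, (hμu ρ le_rfl).2] at h1 h2
      field_simp
      linear_combination h2 - h1
  have hvsh : ∀ x, ρ ≤ x → v (x + 1) = μ⁻¹ * v x + c * u x ∧ v' (x + 1) = μ⁻¹ * v' x + c * u' x :=
    fun x hx => hT.unique_lin hq ordConnected_Ici (hv.mono (subset_univ _))
      (hu.mono (subset_univ _)) self_mem_Ici (by linear_combination hc1)
      (by linear_combination hc2) hx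
  have hgrow : ∀ (f g : ℝ → ℂ) (B : ℝ), Continuous f →
      (∀ x, 0 ≤ x → ‖g x‖ ≤ B * Real.exp (-κ * x)) →
      (∀ x, ρ ≤ x → f (x + 1) = μ⁻¹ * f x + c * g x) →
      ∃ B, ∀ x, 0 ≤ x → ‖f x‖ ≤ B * Real.exp (κ * x) := by
    intro f g B hf hg hsh
    have hB0 : 0 ≤ B := by
      have := (norm_nonneg _).trans (hg 0 le_rfl)
      simpa using this
    have hlt : Real.exp (-κ) * Real.exp (-κ) < 1 := by
      rw [← Real.exp_add]; simpa using hκ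
    -- `D` is chosen so that the correction `D e^{-2κx}` decreases over one period by exactly the
    -- inhomogeneous term, making `‖f‖ e^{-κx} + D e^{-2κx}` nonincreasing under unit shifts.
    set D := ‖c‖ * B * Real.exp (-κ) / (1 - Real.exp (-κ) * Real.exp (-κ)) with hD
    have hD0 : 0 ≤ D := div_nonneg (by positivity) (by linarith)
    have hD1 : D * (1 - Real.exp (-κ) * Real.exp (-κ)) = ‖c‖ * B * Real.exp (-κ) :=
      div_mul_cancel₀ _ (by linarith)
    obtain ⟨B', hB'⟩ := exists_bound_of_shift_le (g := fun x => ‖f x‖ * Real.exp (-κ * x) +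
        D * (Real.exp (-κ * x) * Real.exp (-κ * x))) (by fun_prop) hρ fun x hx => by
      have h1 : ‖f (x + 1)‖ ≤ Real.exp κ * ‖f x‖ + ‖c‖ * (B * Real.exp (-κ * x)) := by
        rw [hsh x hx]
        refine (norm_add_le _ _).trans ?_
        rw [norm_mul, norm_mul, norm_inv, hμ, Real.exp_neg, inv_inv]
        gcongr
        exact hg x (hρ.trans hx)
      have h2 : Real.exp (-κ * (x + 1)) = Real.exp (-κ * x) * Real.exp (-κ) := by
        rw [← Real.exp_add]; ring_nf
      have h3 : Real.exp κ * Real.exp (-κ) = 1 := by rw [← Real.exp_add]; simp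
      rw [h2]
      set e := Real.exp (-κ * x)
      have he : 0 < e := Real.exp_pos _
      have he' : 0 < Real.exp (-κ) := Real.exp_pos _
      calc ‖f (x + 1)‖ * (e * Real.exp (-κ)) + D * (e * Real.exp (-κ) * (e * Real.exp (-κ)))
          ≤ (Real.exp κ * ‖f x‖ + ‖c‖ * (B * e)) * (e * Real.exp (-κ))
            + D * (e * Real.exp (-κ) * (e * Real.exp (-κ))) := by gcongr
        _ = ‖f x‖ * e + D * (e * e) := by
          linear_combination (‖f x‖ * e) * h3 - e * e * hD1
    refine ⟨B', fun x hx => ?_⟩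
    have h1 := hB' x hx
    have h2 : 0 ≤ D * (Real.exp (-κ * x) * Real.exp (-κ * x)) := by positivity
    rw [neg_mul, Real.exp_neg] at h1 h2
    rw [← div_le_iff₀ (Real.exp_pos _), div_eq_mul_inv]
    linarith
  obtain ⟨B3, hB3⟩ := hgrow v u B1 hvc hB1 fun x hx => (hvsh x hx).1
  obtain ⟨B4, hB4⟩ := hgrow v' u' B2 hvc' hB2 fun x hx => (hvsh x hx).2
  refine ⟨max 1 (max (max B1 B2) (max B3 B4)), by positivity, fun x hx =>
    ⟨(hB1 x hx).trans ?_, (hB2 x hx).trans ?_, (hB3 x hx).trans ?_, (hB4 x hx).trans ?_⟩⟩ <;>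
  · gcongr
    simp

/-- The decomposition of `V` gives periodicity only strictly beyond `ρ`; continuity adds the
endpoint. -/
theorem continuousOn_extend_shift {V : ℝ → ℝ} (hV : Continuous V) {ρ : ℝ}
    (h : ∀ x, ρ < x → V (x + 1) = V x) : ∀ x, ρ ≤ x → V (x + 1) = V x := by
  have hcl : IsClosed {x | V (x + 1) = V x} := isClosed_eq (by fun_prop) hV
  have := hcl.closure_subset_iff.2 (fun x (hx : x ∈ Ioi ρ) => h x hx)
  rw [closure_Ioi] at this
  exact fun x hx => this hx

/-- The Floquet multipliers of a bound state at both ends agree. -/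
theorem floquet_multipliers_eq {V : ℝ → ℝ} {E ρ : ℝ} (hV : Continuous V)
    (hlink : ∃ n : ℕ, 2 * ρ + 2 < n ∧ ∀ x, ρ < x → x - n < -ρ → V (x - n) = V x) {y y' : ℝ → ℂ}
    (hy : SolOn (pot V E) y y' univ) (h0 : ∃ x, y x ≠ 0) {μ ν : ℂ} (hμ1 : ‖μ‖ < 1)
    (hν1 : ‖ν‖ < 1)
    (hμ : ∀ x, ρ ≤ x → y (x + 1) = μ * y x ∧ y' (x + 1) = μ * y' x)
    (hν : ∀ x, ρ ≤ x → y (-(x + 1)) = ν * y (-x) ∧ y' (-(x + 1)) = ν * y' (-x)) : μ = ν := by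
  have hq := continuous_pot hV E
  obtain ⟨n, hn, hVn⟩ := hlink
  -- an interval `[a, a + 1]` to the right of `ρ` whose translate lies to the left of `-ρ`
  set a := (n : ℝ) / 2 - 1 / 2
  have ha : ρ < a := by simp only [a]; linarith
  have hb : a + 1 - n < -ρ := by simp only [a]; linarith
  have hT : SolOn (pot V E) (fun x => y (x - n)) (fun x => y' (x - n)) (Icc a (a + 1)) :=
    ((hy.comp_add_const (-(n : ℝ))).mono (subset_univ _)).congr_coeff fun x hx => by
      have := hVn x (by linarith [hx.1]) (by linarith [hx.2])
      simp only [pot, ← sub_eq_add_neg, this]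
  have hy1 := hy.mono (subset_univ (Icc a (a + 1)))
  have hma : a ∈ Icc a (a + 1) := ⟨le_rfl, by linarith⟩
  have hmb : a + 1 ∈ Icc a (a + 1) := ⟨by linarith, le_rfl⟩
  have hW := wronsk_const ordConnected_Icc hy1 hT hma hmb
  have h1 := hμ a ha.le
  have h2 := hν (n - (a + 1)) (by linarith)
  have e1 : -((n : ℝ) - (a + 1) + 1) = a - n := by ring
  have e2 : -((n : ℝ) - (a + 1)) = a + 1 - n := by ring
  rw [e1, e2] at h2
  -- Crossing the period multiplies `y` by `μ` and its translate from the left end by `ν⁻¹`. If the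
  -- two are dependent, then `μ ν = 1`, impossible for decaying solutions. If they are independent,
  -- constancy of their Wronskian gives `μ = ν`.
  by_cases hz : wronsk y y' (fun x => y (x - n)) (fun x => y' (x - n)) a = 0
  · exfalso
    obtain ⟨k, hk1, hk2⟩ := exists_smul_of_det_eq_zero (hy.ne_zero_or hq h0 a) hz
    have h3 := hT.unique_lin hq ordConnected_Icc hy1 hy1 (a := k) (b := 0) hma
      (by simpa using hk1) (by simpa using hk2) hmb
    simp only [zero_mul, add_zero] at h3
    have h4 : (1 - μ * ν) * y (a + 1 - n) = 0 ∧ (1 - μ * ν) * y' (a + 1 - n) = 0 := by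
      constructor
      · linear_combination h3.1 + k * h1.1 - μ * hk1 + μ * h2.1
      · linear_combination h3.2 + k * h1.2 - μ * hk2 + μ * h2.2
    have hne : 1 - μ * ν ≠ 0 := by
      intro h
      have : ‖μ * ν‖ = 1 := by rw [show μ * ν = 1 by linear_combination -h]; simp
      rw [norm_mul] at this
      nlinarith [norm_nonneg μ, norm_nonneg ν]
    rcases hy.ne_zero_or hq h0 (a + 1 - n) with h | h
    · exact h ((mul_eq_zero.1 h4.1).resolve_left hne)
    · exact h ((mul_eq_zero.1 h4.2).resolve_left hne)
  · simp only [wronsk] at hW hz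
    have : (μ - ν) * (y a * y' (a - n) - y' a * y (a - n)) = 0 := by
      rw [h1.1, h1.2] at hW
      rw [h2.1, h2.2] at hW ⊢
      linear_combination -ν * hW
    exact sub_eq_zero.1 ((mul_eq_zero.1 this).resolve_right hz)

/-! ### Perturbation of the spectral parameter on a half-line -/

/-- `u`, `v` are solutions for the energy `E` with Wronskian `1`; on `[0, ∞)`, `u` decays and `v`
grows at the rate `κ`, and `v' - i √E v` is bounded from below. -/
structure DecayPair (V : ℝ → ℝ) (E κ C c : ℝ) (u u' v v' : ℝ → ℂ) : Prop where
  solu : SolOn (pot V E) u u' univ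
  solv : SolOn (pot V E) v v' univ
  wronsk_eq : ∀ x, wronsk u u' v v' x = 1
  norm_u : ∀ x, 0 ≤ x → ‖u x‖ ≤ C * Real.exp (-κ * x)
  norm_u' : ∀ x, 0 ≤ x → ‖u' x‖ ≤ C * Real.exp (-κ * x)
  norm_v : ∀ x, 0 ≤ x → ‖v x‖ ≤ C * Real.exp (κ * x)
  norm_v' : ∀ x, 0 ≤ x → ‖v' x‖ ≤ C * Real.exp (κ * x)
  lower : ∀ x, 0 ≤ x → c * Real.exp (κ * x) ≤ ‖v' x - Complex.I * (Real.sqrt E : ℂ) * v x‖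

theorem integral_exp_mul_eq {k : ℝ} (hk : k ≠ 0) (x : ℝ) :
    ∫ t in (0 : ℝ)..x, Real.exp (k * t) = Real.exp (k * x) / k - 1 / k := by
  have hd : ∀ t, HasDerivAt (fun t => Real.exp (k * t) / k) (Real.exp (k * t)) t := fun t => by
    refine ((((hasDerivAt_id t).const_mul k).exp).div_const k).congr_deriv ?_
    simp only [id, mul_one]
    field_simp
  rw [intervalIntegral.integral_eq_sub_of_hasDerivAt (fun t _ => hd t)
    ((by fun_prop : Continuous fun t => Real.exp (k * t)).intervalIntegrable _ _)]
  simp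

theorem integral_exp_mul_le {k x : ℝ} (hk : 0 < k) :
    ∫ t in (0 : ℝ)..x, Real.exp (k * t) ≤ Real.exp (k * x) / k := by
  rw [integral_exp_mul_eq hk.ne']
  have : 0 ≤ 1 / k := by positivity
  linarith

theorem integral_exp_neg_mul_le {k x : ℝ} (hk : 0 < k) :
    ∫ t in (0 : ℝ)..x, Real.exp (-k * t) ≤ 1 / k := by
  rw [integral_exp_mul_eq (neg_ne_zero.2 hk.ne'), div_neg, div_neg]
  have : 0 ≤ Real.exp (-k * x) / k := by positivity
  linarith

theorem norm_integral_mul_mul_le {f g h : ℝ → ℂ} {p : ℝ → ℝ} {a x : ℝ} (hx : 0 ≤ x)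
    (hp : Continuous p) (hf : ∀ t ∈ Icc 0 x, ‖f t * g t‖ ≤ p t) (hh : ∀ t ∈ Icc 0 x, ‖h t‖ ≤ a) :
    ‖∫ t in (0 : ℝ)..x, f t * g t * h t‖ ≤ (∫ t in (0 : ℝ)..x, p t) * a := by
  rw [← intervalIntegral.integral_mul_const]
  refine intervalIntegral.norm_integral_le_of_norm_le hx (Filter.Eventually.of_forall
    fun t ht => ?_) ((hp.mul continuous_const).intervalIntegrable _ _)
  have ht' : t ∈ Icc 0 x := Ioc_subset_Icc_self ht
  rw [norm_mul]
  exact mul_le_mul (hf t ht') (hh t ht') (norm_nonneg _) ((norm_nonneg _).trans (hf t ht'))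

theorem exp_mul_exp_neg_self (κ t : ℝ) : Real.exp (-κ * t) * Real.exp (κ * t) = 1 := by
  rw [← Real.exp_add]; simp

/-- The integrals which govern the variation of the coefficients of `u` and `v`. -/
theorem DecayPair.norm_integrals_le {V : ℝ → ℝ} {E κ C c : ℝ} {u u' v v' : ℝ → ℂ}
    (h : DecayPair V E κ C c u u' v v') (hκ : 0 < κ) {M K : ℝ} (hM : 1 ≤ M) {l : ℂ}
    (hl : ‖l‖ ≤ K * Real.exp (-(2 * κ) * M)) {A B : ℝ → ℂ} {a b : ℝ} (hA : Continuous A)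
    (hB : Continuous B) (hAa : ∀ t ∈ Icc 0 M, ‖A t‖ ≤ a) (hBb : ∀ t ∈ Icc 0 M, ‖B t‖ ≤ b)
    {x : ℝ} (hx : x ∈ Icc 0 M) :
    ‖l * ∫ t in (0 : ℝ)..x, (A t * u t + B t * v t) * v t‖
        ≤ C ^ 2 * (1 + 1 / (2 * κ)) * (K * Real.exp (-(2 * κ) * M) * M * a + K * b) ∧
      ‖l * ∫ t in (0 : ℝ)..x, u t * (A t * u t + B t * v t)‖
        ≤ C ^ 2 * (1 + 1 / (2 * κ)) * (K * Real.exp (-(2 * κ) * M) * a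
          + K * Real.exp (-(2 * κ) * M) * M * b) := by
  have huc := h.solu.continuous
  have hvc := h.solv.continuous
  have hK0 : 0 ≤ K := by
    have := (norm_nonneg l).trans hl
    exact nonneg_of_mul_nonneg_left this (Real.exp_pos _)
  have hsub : Icc 0 x ⊆ Icc 0 M := Icc_subset_Icc_right hx.2
  have hAa' : ∀ t ∈ Icc 0 x, ‖A t‖ ≤ a := fun t ht => hAa t (hsub ht)
  have hBb' : ∀ t ∈ Icc 0 x, ‖B t‖ ≤ b := fun t ht => hBb t (hsub ht)
  have ha0 : 0 ≤ a := (norm_nonneg _).trans (hAa x hx)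
  have hb0 : 0 ≤ b := (norm_nonneg _).trans (hBb x hx)
  have huv : ∀ t ∈ Icc 0 x, ‖u t * v t‖ ≤ C ^ 2 := fun t ht => by
    rw [norm_mul]
    calc _ ≤ (C * Real.exp (-κ * t)) * (C * Real.exp (κ * t)) :=
          mul_le_mul (h.norm_u t ht.1) (h.norm_v t ht.1) (norm_nonneg _)
            ((norm_nonneg _).trans (h.norm_u t ht.1))
      _ = _ := by linear_combination C ^ 2 * exp_mul_exp_neg_self κ t
  have huu : ∀ t ∈ Icc 0 x, ‖u t * u t‖ ≤ C ^ 2 * Real.exp (-(2 * κ) * t) := fun t ht => by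
    rw [norm_mul]
    calc _ ≤ (C * Real.exp (-κ * t)) * (C * Real.exp (-κ * t)) :=
          mul_le_mul (h.norm_u t ht.1) (h.norm_u t ht.1) (norm_nonneg _)
            ((norm_nonneg _).trans (h.norm_u t ht.1))
      _ = _ := by
        rw [show -(2 * κ) * t = -κ * t + -κ * t by ring, Real.exp_add]; ring
  have hvv : ∀ t ∈ Icc 0 x, ‖v t * v t‖ ≤ C ^ 2 * Real.exp (2 * κ * t) := fun t ht => by
    rw [norm_mul]
    calc _ ≤ (C * Real.exp (κ * t)) * (C * Real.exp (κ * t)) :=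
          mul_le_mul (h.norm_v t ht.1) (h.norm_v t ht.1) (norm_nonneg _)
            ((norm_nonneg _).trans (h.norm_v t ht.1))
      _ = _ := by
        rw [show 2 * κ * t = κ * t + κ * t by ring, Real.exp_add]; ring
  -- Three sizes occur: `u v` is bounded and costs the length `M`, the integral of `u²` is bounded,
  -- and that of `v²` is of order `e^{2κM}`, which the bound on `l` exactly compensates.
  have i1 : ∀ (f : ℝ → ℂ) (d : ℝ), 0 ≤ d → (∀ t ∈ Icc 0 x, ‖f t‖ ≤ d) →
      ‖∫ t in (0 : ℝ)..x, u t * v t * f t‖ ≤ C ^ 2 * M * d := fun f d hd hf => by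
    refine (norm_integral_mul_mul_le hx.1 continuous_const huv hf).trans ?_
    rw [intervalIntegral.integral_const, smul_eq_mul, sub_zero]
    have := hx.2
    have h2 : x * C ^ 2 ≤ C ^ 2 * M := by nlinarith [sq_nonneg C]
    gcongr
  have i2 : ‖∫ t in (0 : ℝ)..x, u t * u t * A t‖ ≤ C ^ 2 * (1 / (2 * κ)) * a := by
    refine (norm_integral_mul_mul_le hx.1 (by fun_prop) huu hAa').trans ?_
    rw [intervalIntegral.integral_const_mul]
    gcongr
    exact integral_exp_neg_mul_le (by linarith)
  have i3 : ‖∫ t in (0 : ℝ)..x, v t * v t * B t‖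
      ≤ C ^ 2 * (Real.exp (2 * κ * M) / (2 * κ)) * b := by
    refine (norm_integral_mul_mul_le hx.1 (by fun_prop) hvv hBb').trans ?_
    rw [intervalIntegral.integral_const_mul]
    gcongr
    refine (integral_exp_mul_le (by linarith)).trans ?_
    have := hx.2
    gcongr
  have i4 := i1 A a ha0 hAa'
  have i5 := i1 B b hb0 hBb'
  have e1 : ∫ t in (0 : ℝ)..x, (A t * u t + B t * v t) * v t
      = (∫ t in (0 : ℝ)..x, u t * v t * A t) + ∫ t in (0 : ℝ)..x, v t * v t * B t := by
    rw [← intervalIntegral.integral_add (Continuous.intervalIntegrable (by fun_prop) _ _)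
      (Continuous.intervalIntegrable (by fun_prop) _ _)]
    congr 1; ext t; ring
  have e2 : ∫ t in (0 : ℝ)..x, u t * (A t * u t + B t * v t)
      = (∫ t in (0 : ℝ)..x, u t * u t * A t) + ∫ t in (0 : ℝ)..x, u t * v t * B t := by
    rw [← intervalIntegral.integral_add (Continuous.intervalIntegrable (by fun_prop) _ _)
      (Continuous.intervalIntegrable (by fun_prop) _ _)]
    congr 1; ext t; ring
  set r := K * Real.exp (-(2 * κ) * M) with hr
  have hr0 : 0 ≤ r := by positivity
  have hrK : r * Real.exp (2 * κ * M) = K := by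
    rw [hr, mul_assoc, exp_mul_exp_neg_self, mul_one]
  have hkk : 0 ≤ 1 / (2 * κ) := by positivity
  have hC2 := sq_nonneg C
  have q1 : C ^ 2 ≤ C ^ 2 * (1 + 1 / (2 * κ)) := by nlinarith
  have q2 : C ^ 2 * (1 / (2 * κ)) ≤ C ^ 2 * (1 + 1 / (2 * κ)) := by nlinarith
  rw [e1, e2, norm_mul, norm_mul]
  constructor
  · calc _ ≤ r * (C ^ 2 * M * a + C ^ 2 * (Real.exp (2 * κ * M) / (2 * κ)) * b) := by
          gcongr
          exact (norm_add_le _ _).trans (add_le_add i4 i3)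
      _ = C ^ 2 * (r * M * a) + C ^ 2 * (1 / (2 * κ)) * (K * b) := by rw [← hrK]; ring
      _ ≤ C ^ 2 * (1 + 1 / (2 * κ)) * (r * M * a) + C ^ 2 * (1 + 1 / (2 * κ)) * (K * b) := by
          exact add_le_add (mul_le_mul_of_nonneg_right q1 (by positivity))
            (mul_le_mul_of_nonneg_right q2 (by positivity))
      _ = _ := by ring
  · calc _ ≤ r * (C ^ 2 * (1 / (2 * κ)) * a + C ^ 2 * M * b) := by
          gcongr
          exact (norm_add_le _ _).trans (add_le_add i2 i5)
      _ = C ^ 2 * (1 / (2 * κ)) * (r * a) + C ^ 2 * (r * M * b) := by ring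
      _ ≤ C ^ 2 * (1 + 1 / (2 * κ)) * (r * a) + C ^ 2 * (1 + 1 / (2 * κ)) * (r * M * b) := by
          exact add_le_add (mul_le_mul_of_nonneg_right q2 (by positivity))
            (mul_le_mul_of_nonneg_right q1 (by positivity))
      _ = _ := by ring

theorem exists_mul_exp_le {k ε : ℝ} (hk : 0 < k) (hε : 0 < ε) :
    ∃ M₁ : ℝ, 1 ≤ M₁ ∧ ∀ M, M₁ ≤ M → M * Real.exp (-k * M) ≤ ε := by
  have h := Real.tendsto_pow_mul_exp_neg_atTop_nhds_zero 1
  have h2 : Filter.Tendsto (fun M : ℝ => k * M) Filter.atTop Filter.atTop :=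
    Filter.tendsto_id.const_mul_atTop hk
  have h3 := (h.comp h2).eventually (gt_mem_nhds (show (0 : ℝ) < k * ε by positivity))
  obtain ⟨M₁, hM₁⟩ := Filter.eventually_atTop.1 h3
  refine ⟨max 1 M₁, le_max_left _ _, fun M hM => ?_⟩
  have := hM₁ M ((le_max_right _ _).trans hM)
  simp only [Function.comp, pow_one] at this
  rw [neg_mul]
  nlinarith

/-- The coefficients of a solution for the energy `E + l` with respect to `u`, `v`. -/
theorem DecayPair.coeff_sub {V : ℝ → ℝ} {E κ C c : ℝ} {u u' v v' : ℝ → ℂ}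
    (h : DecayPair V E κ C c u u' v v') {l : ℂ} {y y' : ℝ → ℂ}
    (hy : SolOn (pot V (E + l)) y y' univ) (x : ℝ) :
    wronsk y y' v v' x - wronsk y y' v v' 0 = l * ∫ t in (0 : ℝ)..x,
      (wronsk y y' v v' t * u t + wronsk u u' y y' t * v t) * v t ∧
    wronsk u u' y y' x - wronsk u u' y y' 0 = -(l * ∫ t in (0 : ℝ)..x,
      u t * (wronsk y y' v v' t * u t + wronsk u u' y y' t * v t)) := by
  have e : ∀ t, wronsk y y' v v' t * u t + wronsk u u' y y' t * v t = y t := fun t =>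
    (eq_wronsk_combination (h.wronsk_eq t)).1.symm
  simp_rw [e]
  constructor
  · rw [wronsk_sub_eq_integral ordConnected_univ hy h.solv (mem_univ 0) (mem_univ x)]; ring
  · rw [wronsk_sub_eq_integral ordConnected_univ h.solu hy (mem_univ 0) (mem_univ x)]; ring

theorem SolOn.continuous_wronsk {q p y y' v v' : ℝ → ℂ} (hy : SolOn q y y' univ)
    (hv : SolOn p v v' univ) : Continuous (wronsk y y' v v') :=
  (hy.continuous.mul hv.continuous').sub (hy.continuous'.mul hv.continuous)

theorem exists_sup_bound {f : ℝ → ℂ} (hf : Continuous f) {M : ℝ} (hM : 0 ≤ M) :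
    ∃ t₀ ∈ Icc 0 M, ∀ t ∈ Icc 0 M, ‖f t‖ ≤ ‖f t₀‖ := by
  obtain ⟨t₀, ht₀, hmax⟩ := isCompact_Icc.exists_isMaxOn (s := Icc 0 M) ⟨0, ⟨le_rfl, hM⟩⟩
    hf.norm.continuousOn
  exact ⟨t₀, ht₀, fun t ht => hmax ht⟩

/-- The solutions for the energy `E + l` with the initial data of `u` and `v`. -/
theorem exists_coeff_bounds {κ C K : ℝ} (hκ : 0 < κ) (hK : 0 < K) :
    ∃ M₁ D : ℝ, 1 ≤ M₁ ∧ 0 ≤ D ∧ ∀ (V : ℝ → ℝ) (E c : ℝ) (u u' v v' : ℝ → ℂ),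
      DecayPair V E κ C c u u' v v' → ∀ M, M₁ ≤ M → ∀ l : ℂ,
      ‖l‖ ≤ K * Real.exp (-(2 * κ) * M) → ∀ y y' : ℝ → ℂ, SolOn (pot V (E + l)) y y' univ →
      (y 0 = u 0 → y' 0 = u' 0 →
        ‖wronsk y y' v v' M - 1‖ ≤ D * (M * Real.exp (-(2 * κ) * M)) ∧
        ‖wronsk u u' y y' M + l * ∫ t in (0 : ℝ)..M, u t ^ 2‖
          ≤ D * (M * Real.exp (-(2 * κ) * M) * Real.exp (-(2 * κ) * M))) ∧
      (y 0 = v 0 → y' 0 = v' 0 →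
        ‖wronsk y y' v v' M‖ ≤ D ∧
        ‖wronsk u u' y y' M - 1‖ ≤ D * (M * Real.exp (-(2 * κ) * M))) := by
  set D₀ := C ^ 2 * (1 + 1 / (2 * κ)) with hD₀
  have hD₀0 : 0 ≤ D₀ := by positivity
  -- The threshold makes `(D₀ K + 2 D₀² K²) M e^{-2κM} ≤ 1 / 2`, so that the suprema `a`, `b` of the
  -- coefficients can be absorbed.
  obtain ⟨M₁, hM₁1, hM₁⟩ := exists_mul_exp_le (k := 2 * κ)
    (ε := 1 / (2 * (1 + D₀ * K + 2 * D₀ ^ 2 * K ^ 2))) (by positivity) (by positivity)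
  set D₁ := 2 * D₀ * K + 4 * D₀ ^ 2 * K ^ 2
  refine ⟨M₁, D₁ + D₀ * K * D₁ + 4 * D₀ ^ 2 * K ^ 2 + 4 * D₀ * K + 4 * D₀ ^ 2 * K ^ 2, hM₁1,
    by positivity, ?_⟩
  intro V E c u u' v v' h M hM l hl y y' hy
  have hM1 : 1 ≤ M := hM₁1.trans hM
  have hM0 : 0 ≤ M := by linarith
  set e := Real.exp (-(2 * κ) * M) with he
  have he0 : 0 < e := Real.exp_pos _
  have hXe : e ≤ M * e := by nlinarith
  set X := M * e with hX
  have hX0 : 0 < X := by positivity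
  have hsmall : (D₀ * K + 2 * D₀ ^ 2 * K ^ 2) * X ≤ 1 / 2 := by
    have := hM₁ M hM
    rw [le_div_iff₀ (by positivity)] at this
    nlinarith
  have hp1 : 0 ≤ D₀ * K * X := by positivity
  have hp2 : 0 ≤ D₀ ^ 2 * K ^ 2 * X := by positivity
  set A := wronsk y y' v v' with hAdef
  set B := wronsk u u' y y' with hBdef
  have hAc : Continuous A := hy.continuous_wronsk h.solv
  have hBc : Continuous B := h.solu.continuous_wronsk hy
  obtain ⟨s, hs, hsA⟩ := exists_sup_bound hAc hM0
  obtain ⟨t, ht, htB⟩ := exists_sup_bound hBc hM0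
  set a := ‖A s‖
  set b := ‖B t‖
  have ha0 : 0 ≤ a := norm_nonneg _
  have hb0 : 0 ≤ b := norm_nonneg _
  have hAB : ∀ x ∈ Icc 0 M, ‖A x - A 0‖ ≤ D₀ * (K * e * M * a + K * b) ∧
      ‖B x - B 0‖ ≤ D₀ * (K * e * a + K * e * M * b) := fun x hx => by
    have h1 := h.norm_integrals_le hκ hM1 hl hAc hBc hsA htB hx
    have h2 := h.coeff_sub hy x
    rw [← hAdef, ← hBdef] at h2
    rw [h2.1, h2.2, norm_neg]
    exact h1
  have hMM : M ∈ Icc 0 M := ⟨hM0, le_rfl⟩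
  constructor
  · intro h0 h0'
    have hA0 : A 0 = 1 := by
      rw [← h.wronsk_eq 0, hAdef]; simp [wronsk, h0, h0']
    have hB0 : B 0 = 0 := by rw [hBdef]; simp [wronsk, h0, h0']; ring
    have h1 : a ≤ 1 + D₀ * (K * e * M * a + K * b) := by
      have h2 := (hAB s hs).1
      have h3 := norm_sub_norm_le (A s) (A 0)
      rw [hA0, norm_one] at h3
      rw [hA0] at h2
      linarith
    have h2 : b ≤ D₀ * (K * e * a + K * e * M * b) := by
      have h2 := (hAB t ht).2
      rwa [hB0, sub_zero] at h2
    -- The term `D₀ * K * b` in `h1` has no small factor of its own. It becomes harmless because `b`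
    -- is smaller than `a` by a factor `e`, so `b` is eliminated first.
    have h3 : b ≤ 2 * D₀ * K * e * a := by
      have e1 : D₀ * (K * e * a + K * e * M * b) = D₀ * K * e * a + D₀ * K * X * b := by
        rw [hX]; ring
      have e2 : D₀ * K * X * b ≤ 1 / 2 * b := by gcongr; linarith
      linarith
    have h4 : a ≤ 2 := by
      have e1 : D₀ * (K * e * M * a + K * b) = D₀ * K * X * a + D₀ * K * b := by rw [hX]; ring
      have e2 : D₀ * K * b ≤ D₀ * K * (2 * D₀ * K * e * a) := by gcongr
      have e3 : D₀ * K * (2 * D₀ * K * e * a) ≤ 2 * D₀ ^ 2 * K ^ 2 * X * a := by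
        calc _ = 2 * D₀ ^ 2 * K ^ 2 * e * a := by ring
          _ ≤ _ := by gcongr
      have e4 : (D₀ * K + 2 * D₀ ^ 2 * K ^ 2) * X * a ≤ 1 / 2 * a := by gcongr
      linarith
    have h5 : b ≤ 4 * D₀ * K * e := by
      calc b ≤ 2 * D₀ * K * e * a := h3
        _ ≤ 2 * D₀ * K * e * 2 := by gcongr
        _ = _ := by ring
    have h6 : ∀ x ∈ Icc 0 M, ‖A x - 1‖ ≤ D₁ * X := fun x hx => by
      have h7 := (hAB x hx).1
      rw [hA0] at h7
      calc _ ≤ D₀ * (K * e * M * a + K * b) := h7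
        _ ≤ D₀ * (K * e * M * 2 + K * (4 * D₀ * K * e)) := by gcongr
        _ = 2 * D₀ * K * X + 4 * D₀ ^ 2 * K ^ 2 * e := by rw [hX]; ring
        _ ≤ 2 * D₀ * K * X + 4 * D₀ ^ 2 * K ^ 2 * X := by gcongr
        _ = _ := by simp only [D₁]; ring
    refine ⟨(h6 M hMM).trans ?_, ?_⟩
    · have : 0 ≤ (D₀ * K * D₁ + 4 * D₀ ^ 2 * K ^ 2 + 4 * D₀ * K + 4 * D₀ ^ 2 * K ^ 2) * X := by
        positivity
      linarith
    · have h8 := (h.norm_integrals_le hκ hM1 hl (hAc.sub continuous_const) hBc h6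
        (fun x hx => (htB x hx).trans h5) hMM).2
      have huc := h.solu.continuous
      have hvc := h.solv.continuous
      -- Second iteration: the contribution of `A = 1` is the main term `-l ∫ u²`, and the remainder
      -- contains only the small quantities `A - 1` and `B`.
      have e1 : B M + l * ∫ t in (0 : ℝ)..M, u t ^ 2 =
          -(l * ∫ t in (0 : ℝ)..M, u t * ((A t - 1) * u t + B t * v t)) := by
        have h9 := (h.coeff_sub hy M).2
        rw [← hAdef, ← hBdef, hB0, sub_zero] at h9
        rw [h9]
        have : ∫ t in (0 : ℝ)..M, u t * (A t * u t + B t * v t) =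
            (∫ t in (0 : ℝ)..M, u t ^ 2) +
              ∫ t in (0 : ℝ)..M, u t * ((A t - 1) * u t + B t * v t) := by
          rw [← intervalIntegral.integral_add (Continuous.intervalIntegrable (by fun_prop) _ _)
            (Continuous.intervalIntegrable (by fun_prop) _ _)]
          congr 1; ext t; ring
        rw [this]; ring
      rw [e1, norm_neg]
      refine h8.trans ?_
      calc D₀ * (K * e * (D₁ * X) + K * e * M * (4 * D₀ * K * e))
          = (D₀ * K * D₁ + 4 * D₀ ^ 2 * K ^ 2) * (X * e) := by rw [hX]; ring
        _ ≤ _ := by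
          gcongr
          have : 0 ≤ D₁ + 4 * D₀ * K + 4 * D₀ ^ 2 * K ^ 2 := by positivity
          linarith
  · intro h0 h0'
    have hA0 : A 0 = 0 := by rw [hAdef]; simp [wronsk, h0, h0']; ring
    have hB0 : B 0 = 1 := by
      rw [← h.wronsk_eq 0, hBdef]; simp [wronsk, h0, h0']
    have h1 : a ≤ D₀ * (K * e * M * a + K * b) := by
      have h2 := (hAB s hs).1
      rwa [hA0, sub_zero] at h2
    have h2 : b ≤ 1 + D₀ * (K * e * a + K * e * M * b) := by
      have h2 := (hAB t ht).2
      have h3 := norm_sub_norm_le (B t) (B 0)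
      rw [hB0, norm_one] at h3
      rw [hB0] at h2
      linarith
    -- With the data of `v` the coefficient of `u` is merely bounded, since `l ∫ v²` can be of order
    -- one. This suffices because it will multiply the small ratio of the boundary values of `u` and
    -- `v`.
    have h3 : a ≤ 2 * D₀ * K * b := by
      have e1 : D₀ * (K * e * M * a + K * b) = D₀ * K * X * a + D₀ * K * b := by rw [hX]; ring
      have e2 : D₀ * K * X * a ≤ 1 / 2 * a := by gcongr; linarith
      linarith
    have h4 : b ≤ 2 := by
      have e1 : D₀ * (K * e * a + K * e * M * b) = D₀ * K * e * a + D₀ * K * X * b := by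
        rw [hX]; ring
      have e2 : D₀ * K * e * a ≤ D₀ * K * e * (2 * D₀ * K * b) := by gcongr
      have e3 : D₀ * K * e * (2 * D₀ * K * b) ≤ 2 * D₀ ^ 2 * K ^ 2 * X * b := by
        calc _ = 2 * D₀ ^ 2 * K ^ 2 * e * b := by ring
          _ ≤ _ := by gcongr
      have e4 : (D₀ * K + 2 * D₀ ^ 2 * K ^ 2) * X * b ≤ 1 / 2 * b := by gcongr
      linarith
    have h5 : a ≤ 4 * D₀ * K := by
      calc a ≤ 2 * D₀ * K * b := h3
        _ ≤ 2 * D₀ * K * 2 := by gcongr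
        _ = _ := by ring
    constructor
    · refine (hsA M hMM).trans (h5.trans ?_)
      have : 0 ≤ D₁ + D₀ * K * D₁ + 4 * D₀ ^ 2 * K ^ 2 + 4 * D₀ ^ 2 * K ^ 2 := by positivity
      linarith
    · have h7 := (hAB M hMM).2
      rw [hB0] at h7
      calc _ ≤ D₀ * (K * e * a + K * e * M * b) := h7
        _ ≤ D₀ * (K * e * (4 * D₀ * K) + K * e * M * 2) := by gcongr
        _ = 4 * D₀ ^ 2 * K ^ 2 * e + 2 * D₀ * K * X := by rw [hX]; ring
        _ ≤ 4 * D₀ ^ 2 * K ^ 2 * X + 2 * D₀ * K * X := by gcongr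
        _ = (4 * D₀ ^ 2 * K ^ 2 + 2 * D₀ * K) * X := by ring
        _ ≤ _ := by
          refine mul_le_mul_of_nonneg_right ?_ hX0.le
          have h8 : 0 ≤ D₁ + D₀ * K * D₁ + 4 * D₀ ^ 2 * K ^ 2 := by positivity
          have h9 : 0 ≤ D₀ * K := by positivity
          linarith

/-! ### The principal square root -/

theorem csqrt_sq (z : ℂ) : Complex.sqrt z ^ 2 = z := by
  simp [Complex.sqrt]

theorem csqrt_re_pos {z : ℂ} (hz : 0 < z.re) : 0 < (Complex.sqrt z).re := by
  rw [Complex.sqrt, Complex.cpow_inv_two_re]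
  positivity

theorem differentiableAt_csqrt {z : ℂ} (hz : 0 < z.re) : DifferentiableAt ℂ Complex.sqrt z := by
  have : Complex.sqrt = fun a : ℂ => a ^ (2⁻¹ : ℂ) := rfl
  rw [this]
  exact differentiableAt_id.cpow_const (Or.inl hz)

theorem norm_csqrt_sub_le {E : ℝ} (hE : 0 < E) {l : ℂ} (hl : 0 < ((E : ℂ) + l).re) :
    ‖Complex.sqrt (E + l) - (Real.sqrt E : ℂ)‖ ≤ ‖l‖ / Real.sqrt E := by
  have hs := csqrt_sq ((E : ℂ) + l)
  have hre := csqrt_re_pos hl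
  set s := Complex.sqrt (E + l)
  have hE2 : ((Real.sqrt E : ℝ) : ℂ) ^ 2 = E := by
    rw [← Complex.ofReal_pow, Real.sq_sqrt hE.le]
  have h1 : (s - (Real.sqrt E : ℂ)) * (s + (Real.sqrt E : ℂ)) = l := by
    linear_combination hs - hE2
  have h2 : Real.sqrt E ≤ ‖s + (Real.sqrt E : ℂ)‖ := by
    refine le_trans ?_ (Complex.re_le_norm _)
    simp [hre.le]
  rw [le_div_iff₀ (Real.sqrt_pos.2 hE)]
  calc _ ≤ ‖s - (Real.sqrt E : ℂ)‖ * ‖s + (Real.sqrt E : ℂ)‖ := by gcongr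
    _ = ‖l‖ := by rw [← norm_mul, h1]

/-! ### The outgoing boundary value -/

/-- `y' M - i s y M` -/
def outVal (s : ℂ) (M : ℝ) (y y' : ℝ → ℂ) : ℂ := y' M - Complex.I * s * y M

theorem DecayPair.outVal_eq {V : ℝ → ℝ} {E κ C c : ℝ} {u u' v v' : ℝ → ℂ}
    (h : DecayPair V E κ C c u u' v v') (s : ℂ) (M : ℝ) (y y' : ℝ → ℂ) :
    outVal s M y y' = wronsk y y' v v' M * outVal s M u u' +
      wronsk u u' y y' M * outVal s M v v' := by
  obtain ⟨h1, h2⟩ := eq_wronsk_combination (y := y) (y' := y') (h.wronsk_eq M)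
  simp only [outVal]
  linear_combination h2 - Complex.I * s * h1

theorem DecayPair.norm_outVal_u_le {V : ℝ → ℝ} {E κ C c : ℝ} {u u' v v' : ℝ → ℂ}
    (h : DecayPair V E κ C c u u' v v') {s : ℂ} {M S : ℝ} (hM : 0 ≤ M) (hS : ‖s‖ ≤ S) :
    ‖outVal s M u u'‖ ≤ C * (1 + S) * Real.exp (-κ * M) := by
  have h1 := h.norm_u M hM
  have h2 := h.norm_u' M hM
  have hS0 : 0 ≤ S := (norm_nonneg _).trans hS
  calc ‖outVal s M u u'‖ ≤ ‖u' M‖ + ‖Complex.I * s * u M‖ := norm_sub_le _ _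
    _ = ‖u' M‖ + ‖s‖ * ‖u M‖ := by rw [norm_mul, norm_mul, Complex.norm_I, one_mul]
    _ ≤ C * Real.exp (-κ * M) + S * (C * Real.exp (-κ * M)) := by gcongr
    _ = _ := by ring

theorem exp_sq_mul (κ M : ℝ) :
    Real.exp (-κ * M) = Real.exp (-(2 * κ) * M) * Real.exp (κ * M) := by
  rw [← Real.exp_add]; ring_nf

theorem DecayPair.norm_ratio_le {V : ℝ → ℝ} {E κ C c : ℝ} {u u' v v' : ℝ → ℂ}
    (h : DecayPair V E κ C c u u' v v') {s : ℂ} {M S b : ℝ} (hM : 0 ≤ M) (hS : ‖s‖ ≤ S)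
    (hb : 0 < b) (hv : b * Real.exp (κ * M) ≤ ‖outVal s M v v'‖) :
    ‖outVal s M u u' / outVal s M v v'‖ ≤ C * (1 + S) / b * Real.exp (-(2 * κ) * M) := by
  have hpos : 0 < b * Real.exp (κ * M) := by positivity
  have h1 := h.norm_outVal_u_le hM hS
  rw [norm_div, div_le_iff₀ (hpos.trans_le hv)]
  have h0 : 0 ≤ C * (1 + S) := by
    exact nonneg_of_mul_nonneg_left ((norm_nonneg _).trans h1) (Real.exp_pos _)
  calc _ ≤ _ := h1
    _ = C * (1 + S) / b * Real.exp (-(2 * κ) * M) * (b * Real.exp (κ * M)) := by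
      rw [exp_sq_mul κ M]; field_simp
    _ ≤ _ := by gcongr

/-- Normalised outgoing boundary values at the energy `E + l`. -/
theorem exists_scaled_bounds {E κ C c K : ℝ} (hE : 0 < E) (hκ : 0 < κ) (hC : 0 < C) (hc : 0 < c)
    (hK : 0 < K) :
    ∃ M₁ D : ℝ, 1 ≤ M₁ ∧ 0 ≤ D ∧ ∀ (V : ℝ → ℝ) (u u' v v' : ℝ → ℂ),
      DecayPair V E κ C c u u' v v' → ∀ M, M₁ ≤ M → ∀ l : ℂ,
      ‖l‖ ≤ K * Real.exp (-(2 * κ) * M) →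
      0 < ((E : ℂ) + l).re ∧ outVal (Complex.sqrt (E + l)) M v v' ≠ 0 ∧
      ∀ y y' : ℝ → ℂ, SolOn (pot V (E + l)) y y' univ →
      (y 0 = u 0 → y' 0 = u' 0 →
        ‖outVal (Complex.sqrt (E + l)) M y y' / outVal (Complex.sqrt (E + l)) M v v' -
          (outVal (Real.sqrt E) M u u' / outVal (Real.sqrt E) M v v'
            - l * ∫ t in (0 : ℝ)..M, u t ^ 2)‖
          ≤ D * (M * Real.exp (-(2 * κ) * M) * Real.exp (-(2 * κ) * M))) ∧
      (y 0 = v 0 → y' 0 = v' 0 →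
        ‖outVal (Complex.sqrt (E + l)) M y y' / outVal (Complex.sqrt (E + l)) M v v' - 1‖
          ≤ D * (M * Real.exp (-(2 * κ) * M))) := by
  obtain ⟨M₁, D, hM₁1, hD0, hcoeff⟩ := exists_coeff_bounds (C := C) hκ hK
  set σ := Real.sqrt E with hσ
  have hσ0 : 0 < σ := Real.sqrt_pos.2 hE
  -- `‖l‖ ≤ E / 2` keeps `E + l` in the right half-plane and `‖s‖ ≤ 2 σ`. The other bound keeps half
  -- of the lower bound on the boundary value of `v` when `σ` is replaced by `s`.
  obtain ⟨M₂, hM₂1, hM₂⟩ := exists_mul_exp_le (k := 2 * κ)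
    (ε := min (E / 2) (c * σ / (2 * C)) / K) (by positivity)
    (div_pos (lt_min (by positivity) (by positivity)) hK)
  set Dm := C * (1 + 2 * σ) / (c / 2)
  have hDm0 : 0 ≤ Dm := by positivity
  refine ⟨max M₁ M₂, D + D * Dm + 2 * K / (c ^ 2 * σ), hM₁1.trans (le_max_left _ _),
    by positivity, ?_⟩
  intro V u u' v v' h M hM l hl
  have hMM₁ : M₁ ≤ M := (le_max_left _ _).trans hM
  have hM1 : 1 ≤ M := hM₁1.trans hMM₁
  have hM0 : 0 ≤ M := by linarith
  have hl2 : ‖l‖ ≤ min (E / 2) (c * σ / (2 * C)) := by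
    have h1 := hM₂ M ((le_max_right _ _).trans hM)
    rw [le_div_iff₀ hK] at h1
    have h2 : K * Real.exp (-(2 * κ) * M) ≤ M * Real.exp (-(2 * κ) * M) * K := by
      have : 0 < K * Real.exp (-(2 * κ) * M) := by positivity
      nlinarith
    linarith
  have hlE : ‖l‖ ≤ E / 2 := hl2.trans (min_le_left _ _)
  have hlc : ‖l‖ ≤ c * σ / (2 * C) := hl2.trans (min_le_right _ _)
  have hre : 0 < ((E : ℂ) + l).re := by
    have := (abs_le.1 ((Complex.abs_re_le_norm l).trans hlE)).1
    simp only [Complex.add_re, Complex.ofReal_re]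
    linarith
  have hds := norm_csqrt_sub_le hE hre
  rw [← hσ] at hds
  set s := Complex.sqrt (E + l)
  have hs2 : ‖s‖ ≤ 2 * σ := by
    have h1 : ‖s‖ ≤ ‖s - (σ : ℂ)‖ + ‖(σ : ℂ)‖ := by
      simpa using norm_add_le (s - (σ : ℂ)) (σ : ℂ)
    have h2 : ‖l‖ / σ ≤ σ := by
      rw [div_le_iff₀ hσ0, hσ, Real.mul_self_sqrt hE.le]; linarith
    rw [Complex.norm_real, Real.norm_of_nonneg hσ0.le] at h1
    linarith
  set e := Real.exp (-(2 * κ) * M) with he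
  have he0 : 0 < e := Real.exp_pos _
  have hexp : 0 < Real.exp (κ * M) := Real.exp_pos _
  have hb0 : c * Real.exp (κ * M) ≤ ‖outVal σ M v v'‖ := h.lower M hM0
  have hb : c / 2 * Real.exp (κ * M) ≤ ‖outVal s M v v'‖ := by
    have h1 : outVal σ M v v' = outVal s M v v' + Complex.I * (s - σ) * v M := by
      simp only [outVal]; ring
    have h2 : ‖Complex.I * (s - σ) * v M‖ ≤ c / 2 * Real.exp (κ * M) := by
      rw [norm_mul, norm_mul, Complex.norm_I, one_mul]
      calc _ ≤ ‖l‖ / σ * (C * Real.exp (κ * M)) := by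
            gcongr
            exact h.norm_v M hM0
        _ ≤ c * σ / (2 * C) / σ * (C * Real.exp (κ * M)) := by gcongr
        _ = _ := by field_simp
    have h3 := norm_add_le (outVal s M v v') (Complex.I * (s - σ) * v M)
    rw [← h1] at h3
    linarith
  have hbne : outVal s M v v' ≠ 0 := norm_pos_iff.1 (lt_of_lt_of_le (by positivity) hb)
  have hbne0 : outVal σ M v v' ≠ 0 := norm_pos_iff.1 (lt_of_lt_of_le (by positivity) hb0)
  have hm := h.norm_ratio_le hM0 hs2 (by positivity) hb
  rw [← he] at hm
  set m := outVal s M u u' / outVal s M v v'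
  set m₀ := outVal σ M u u' / outVal σ M v v'
  have hmm : ‖m - m₀‖ ≤ 2 * K / (c ^ 2 * σ) * (e * e) := by
    -- As a function of `s`, `m` is a Möbius map whose determinant is a multiple of the Wronskian.
    -- The numerator of the difference thus carries no growing factor, `s - σ` contributes one `e`,
    -- and the two denominators another.
    have h1 : m - m₀ = -(Complex.I * (s - σ)) / (outVal s M v v' * outVal σ M v v') := by
      rw [div_sub_div _ _ hbne hbne0]
      congr 1
      have := h.wronsk_eq M
      simp only [wronsk] at this
      simp only [outVal]
      linear_combination (-Complex.I * (s - σ)) * this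
    have hden : c / 2 * Real.exp (κ * M) * (c * Real.exp (κ * M)) ≤
        ‖outVal s M v v'‖ * ‖outVal σ M v v'‖ := by gcongr
    rw [h1, norm_div, norm_neg, norm_mul, norm_mul, Complex.norm_I, one_mul,
      div_le_iff₀ (lt_of_lt_of_le (by positivity) hden)]
    have h2 : e * (Real.exp (κ * M) * Real.exp (κ * M)) = 1 := by
      rw [he, ← Real.exp_add, ← Real.exp_add, ← Real.exp_zero]; ring_nf
    calc ‖s - σ‖ ≤ ‖l‖ / σ := hds
      _ ≤ K * e / σ := by gcongr
      _ = 2 * K / (c ^ 2 * σ) * (e * e) * (c / 2 * Real.exp (κ * M) * (c * Real.exp (κ * M))) := by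
        field_simp
        linear_combination -h2
      _ ≤ _ := by gcongr
  refine ⟨hre, hbne, fun y y' hy => ?_⟩
  have hS : outVal s M y y' / outVal s M v v' = wronsk y y' v v' M * m + wronsk u u' y y' M := by
    rw [h.outVal_eq s M y y', add_div, mul_div_assoc, mul_div_assoc, div_self hbne, mul_one]
  rw [hS]
  have hX : e ≤ M * e := by nlinarith
  obtain ⟨hc1, hc2⟩ := hcoeff V E c u u' v v' h M hMM₁ l hl y y' hy
  rw [← he] at hc1 hc2
  constructor
  · intro h0 h0'
    obtain ⟨h1, h2⟩ := hc1 h0 h0'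
    have e1 : wronsk y y' v v' M * m + wronsk u u' y y' M - (m₀ - l * ∫ t in (0 : ℝ)..M, u t ^ 2)
        = (wronsk u u' y y' M + l * ∫ t in (0 : ℝ)..M, u t ^ 2) + (wronsk y y' v v' M - 1) * m
          + (m - m₀) := by ring
    rw [e1]
    refine (norm_add_le _ _).trans ((add_le_add ((norm_add_le _ _).trans (add_le_add h2 ?_))
      hmm).trans (b := D * (M * e * e) + D * Dm * (M * e * e) + _) ?_)
    · rw [norm_mul]
      calc _ ≤ D * (M * e) * (Dm * e) := by gcongr
        _ = _ := by ring
    · have : 2 * K / (c ^ 2 * σ) * (e * e) ≤ 2 * K / (c ^ 2 * σ) * (M * e * e) := by gcongr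
      linarith
  · intro h0 h0'
    obtain ⟨h1, h2⟩ := hc2 h0 h0'
    rw [add_sub_assoc]
    refine (norm_add_le _ _).trans ?_
    rw [norm_mul]
    have h3 : ‖wronsk y y' v v' M‖ * ‖m‖ ≤ D * Dm * (M * e) := by
      calc _ ≤ D * (Dm * e) := by gcongr
        _ = D * Dm * e := by ring
        _ ≤ _ := by gcongr
    have h4 : 0 ≤ 2 * K / (c ^ 2 * σ) * (M * e) := by positivity
    linarith

/-! ### A quantitative zero of a perturbed affine function -/

/-- Zeros of `f` are fixed points of `g l = l + f l / I`, which is uniformly close to the constant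
`m / I`. Cauchy's estimate on circles of radius `r`, for which the radius `3 r` leaves room, bounds
`g'` by `1 / 4`, so `g` contracts the closed ball of radius `r`. -/
theorem exists_zero_near_affine {f : ℂ → ℂ} {m I : ℂ} {r ε : ℝ} (hr : 0 < r) (hI : I ≠ 0)
    (hd : DifferentiableOn ℂ f (Metric.ball 0 (3 * r)))
    (hf : ∀ l ∈ Metric.ball (0 : ℂ) (3 * r), ‖f l - (m - l * I)‖ ≤ ε)
    (hm : ‖m / I‖ ≤ r / 2) (hε : ε / ‖I‖ ≤ r / 4) :
    ∃ l : ℂ, ‖l‖ ≤ r ∧ f l = 0 ∧ ‖l - m / I‖ ≤ ε / ‖I‖ := by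
  set δ := ε / ‖I‖
  let g : ℂ → ℂ := fun l => l + f l / I
  have hg : ∀ l ∈ Metric.ball (0 : ℂ) (3 * r), ‖g l - m / I‖ ≤ δ := fun l hl => by
    have : g l - m / I = (f l - (m - l * I)) / I := by simp only [g]; field_simp; ring
    rw [this, norm_div]
    exact div_le_div_of_nonneg_right (hf l hl) (norm_nonneg _)
  have hgd : DifferentiableOn ℂ g (Metric.ball 0 (3 * r)) :=
    differentiableOn_id.add (hd.div_const I)
  have hsub : ∀ l ∈ Metric.closedBall (0 : ℂ) r, Metric.closedBall l r ⊆ Metric.ball 0 (3 * r) :=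
    fun l hl => (Metric.closedBall_subset_closedBall' (by
      rw [Metric.mem_closedBall] at hl; linarith : r + dist l 0 ≤ 2 * r)).trans
        (Metric.closedBall_subset_ball (by linarith))
  have hderiv : ∀ l ∈ Metric.closedBall (0 : ℂ) r, ‖deriv g l‖ ≤ 1 / 4 := fun l hl => by
    have hdc : DiffContOnCl ℂ (fun w => g w - m / I) (Metric.ball l r) := by
      refine DifferentiableOn.diffContOnCl ?_
      rw [closure_ball l hr.ne']
      exact (hgd.mono (hsub l hl)).sub (differentiableOn_const _)
    have := Complex.norm_deriv_le_of_forall_mem_sphere_norm_le hr hdc fun w hw =>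
      hg w (hsub l hl (Metric.sphere_subset_closedBall hw))
    rw [deriv_sub_const] at this
    refine this.trans ?_
    rw [div_le_iff₀ hr]; linarith
  have hball : Metric.closedBall (0 : ℂ) r ⊆ Metric.ball 0 (3 * r) :=
    Metric.closedBall_subset_ball (by linarith)
  have hlip : LipschitzOnWith (1 / 4) g (Metric.closedBall 0 r) :=
    (convex_closedBall (0 : ℂ) r).lipschitzOnWith_of_nnnorm_deriv_le
      (fun l hl => (hgd l (hball hl)).differentiableAt (Metric.isOpen_ball.mem_nhds (hball hl)))
      fun l hl => by
        rw [← NNReal.coe_le_coe]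
        simpa using hderiv l hl
  have hmaps : MapsTo g (Metric.closedBall 0 r) (Metric.closedBall 0 r) := fun l hl => by
    rw [mem_closedBall_zero_iff]
    have h1 := hg l (hball hl)
    have h2 := norm_add_le (g l - m / I) (m / I)
    rw [sub_add_cancel] at h2
    linarith
  have hcontr : ContractingWith (1 / 4) (hmaps.restrict g _ _) :=
    ⟨by rw [← NNReal.coe_lt_coe]; norm_num, (hlip.mapsToRestrict hmaps)⟩
  obtain ⟨l, hl, hfix, -⟩ := hcontr.exists_fixedPoint' Metric.isClosed_closedBall.isComplete hmaps
    (x := 0) (by simp [hr.le]) (edist_ne_top _ _)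
  refine ⟨l, by simpa using hl, ?_, ?_⟩
  · have : l + f l / I = l := hfix
    have h2 : f l / I = 0 := by linear_combination this
    exact (div_eq_zero_iff.1 h2).resolve_right hI
  · have := hg l (hball hl)
    rwa [hfix] at this

/-! ### Bound states of perturbed periodic operators -/

theorem SolOn.smul {q y y' : ℝ → ℂ} {s : Set ℝ} (hy : SolOn q y y' s) (a : ℂ) :
    SolOn q (fun x => a * y x) (fun x => a * y' x) s := by
  simpa using hy.lin hy a 0

theorem SolOn.neg_reflect {q y y' : ℝ → ℂ} (hy : SolOn q y y' univ) :
    SolOn (fun x => q (-x)) (fun x => -y (-x)) (fun x => y' (-x)) univ := by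
  simpa using hy.reflect.smul (-1)

theorem SolOn.im_eq_zero {V : ℝ → ℝ} {E : ℝ} (hV : Continuous V) {y y' : ℝ → ℂ}
    (hy : SolOn (pot V E) y y' univ) (h0 : starRingEnd ℂ (y 0) = y 0)
    (h0' : starRingEnd ℂ (y' 0) = y' 0) (x : ℝ) : (y x).im = 0 ∧ (y' x).im = 0 := by
  have hc := hy.conj
  rw [Complex.conj_ofReal] at hc
  have := hc.unique (continuous_pot hV E) ordConnected_univ hy (mem_univ 0) h0 h0' (mem_univ x)
  exact ⟨Complex.conj_eq_iff_im.1 this.1, Complex.conj_eq_iff_im.1 this.2⟩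

theorem uSol_spec {V : ℝ → ℝ} (hV : Continuous V) (Φ : ℝ → ℂ) (w z : ℂ) :
    SolOn (pot V z) (uSol V Φ w z) (deriv (uSol V Φ w z)) univ ∧
      (Φ 0 = 0 → uSol V Φ w z 0 = -w ∧ deriv (uSol V Φ w z) 0 = 1) ∧
      (Φ 0 ≠ 0 → uSol V Φ w z 0 = 1 ∧ deriv (uSol V Φ w z) 0 = w) := by
  unfold uSol
  split_ifs with h
  · obtain ⟨h1, h2⟩ := schrodingerSol_spec hV z (-w) 1
    exact ⟨h1, fun _ => h2, fun h' => absurd h h'⟩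
  · obtain ⟨h1, h2⟩ := schrodingerSol_spec hV z 1 w
    exact ⟨h1, fun h' => absurd h' h, fun _ => h2⟩

theorem vSol_spec {V : ℝ → ℝ} (hV : Continuous V) (Φ : ℝ → ℂ) (w z : ℂ) :
    SolOn (pot V z) (vSol V Φ w z) (deriv (vSol V Φ w z)) univ ∧
      (Φ 0 = 0 → vSol V Φ w z 0 = -1 / (1 + w ^ 2) ∧
        deriv (vSol V Φ w z) 0 = -w / (1 + w ^ 2)) ∧
      (Φ 0 ≠ 0 → vSol V Φ w z 0 = -w / (1 + w ^ 2) ∧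
        deriv (vSol V Φ w z) 0 = 1 / (1 + w ^ 2)) := by
  unfold vSol
  split_ifs with h
  · obtain ⟨h1, h2⟩ := schrodingerSol_spec hV z (-1 / (1 + w ^ 2)) (-w / (1 + w ^ 2))
    exact ⟨h1, fun _ => h2, fun h' => absurd h h'⟩
  · obtain ⟨h1, h2⟩ := schrodingerSol_spec hV z (-w / (1 + w ^ 2)) (1 / (1 + w ^ 2))
    exact ⟨h1, fun h' => absurd h' h, fun _ => h2⟩

theorem one_add_sq_ne_zero {w : ℂ} (hw : starRingEnd ℂ w = w) : 1 + w ^ 2 ≠ 0 := by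
  obtain ⟨r, rfl⟩ := Complex.conj_eq_iff_real.1 hw
  have : (1 : ℝ) + r ^ 2 ≠ 0 := by positivity
  exact_mod_cast this

theorem wronsk_uSol_vSol {V : ℝ → ℝ} (hV : Continuous V) (Φ : ℝ → ℂ) {w : ℂ}
    (hw : 1 + w ^ 2 ≠ 0) (z : ℂ) (x : ℝ) :
    wronsk (uSol V Φ w z) (deriv (uSol V Φ w z)) (vSol V Φ w z) (deriv (vSol V Φ w z)) x = 1 := by
  obtain ⟨hu, hu1, hu2⟩ := uSol_spec hV Φ w z
  obtain ⟨hv, hv1, hv2⟩ := vSol_spec hV Φ w z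
  rw [wronsk_const ordConnected_univ hu hv (mem_univ x) (mem_univ 0)]
  by_cases h : Φ 0 = 0
  · simp only [wronsk, hu1 h, hv1 h]; field_simp; ring
  · simp only [wronsk, hu2 h, hv2 h]; field_simp; ring

/-- The initial data of `u_ζ` in terms of those of `u_η` and `v_η`. -/
theorem uSol_data {V : ℝ → ℝ} (hV : Continuous V) (Φ : ℝ → ℂ) (hw : 1 + wZero Φ ^ 2 ≠ 0)
    (d z z₀ : ℂ) :
    uSol V Φ (wZero Φ + d) z 0 = (1 + wZero Φ / (1 + wZero Φ ^ 2) * d) * uSol V Φ (wZero Φ) z₀ 0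
      + d * vSol V Φ (wZero Φ) z₀ 0 ∧
    deriv (uSol V Φ (wZero Φ + d) z) 0 =
      (1 + wZero Φ / (1 + wZero Φ ^ 2) * d) * deriv (uSol V Φ (wZero Φ) z₀) 0
      + d * deriv (vSol V Φ (wZero Φ) z₀) 0 := by
  obtain ⟨-, hu1, hu2⟩ := uSol_spec hV Φ (wZero Φ + d) z
  obtain ⟨-, hu3, hu4⟩ := uSol_spec hV Φ (wZero Φ) z₀
  obtain ⟨-, hv1, hv2⟩ := vSol_spec hV Φ (wZero Φ) z₀
  by_cases h : Φ 0 = 0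
  · have h0 : wZero Φ = 0 := by simp [wZero, h]
    rw [(hu1 h).1, (hu1 h).2, (hu3 h).1, (hu3 h).2, (hv1 h).1, (hv1 h).2, h0]
    constructor <;> simp
  · rw [(hu2 h).1, (hu2 h).2, (hu4 h).1, (hu4 h).2, (hv2 h).1, (hv2 h).2]
    constructor
    · field_simp; ring
    · field_simp; ring

theorem uSol_ne_zero {V : ℝ → ℝ} (hV : Continuous V) (Φ : ℝ → ℂ) (w z : ℂ) (x : ℝ) :
    uSol V Φ w z x ≠ 0 ∨ deriv (uSol V Φ w z) x ≠ 0 := by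
  obtain ⟨hu, hu1, hu2⟩ := uSol_spec hV Φ w z
  by_contra hcon
  push Not at hcon
  have h0 := hu.eq_zero (continuous_pot hV z) ordConnected_univ (mem_univ x) hcon.1 hcon.2
    (mem_univ 0)
  by_cases h : Φ 0 = 0
  · rw [(hu1 h).2] at h0; exact one_ne_zero h0.2
  · rw [(hu2 h).1] at h0; exact one_ne_zero h0.1

theorem exists_smul_eq_uSol {V : ℝ → ℝ} (hV : Continuous V) {Φ : ℝ → ℂ} {z : ℂ}
    (hΦ : SolOn (pot V z) Φ (deriv Φ) univ) (h0 : ∃ x, Φ x ≠ 0) :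
    ∃ k : ℂ, ∀ x, uSol V Φ (wZero Φ) z x = k * Φ x ∧
      deriv (uSol V Φ (wZero Φ) z) x = k * deriv Φ x := by
  obtain ⟨hu, hu1, hu2⟩ := uSol_spec hV Φ (wZero Φ) z
  have hq := continuous_pot hV z
  by_cases h : Φ 0 = 0
  · have hne : deriv Φ 0 ≠ 0 := (hΦ.ne_zero_or hq h0 0).resolve_left (by simp [h])
    refine ⟨(deriv Φ 0)⁻¹, fun x => hu.unique hq ordConnected_univ (hΦ.smul _) (mem_univ 0) ?_ ?_
      (mem_univ x)⟩
    · rw [(hu1 h).1]; simp [wZero, h]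
    · rw [(hu1 h).2]; simp [hne]
  · refine ⟨(Φ 0)⁻¹, fun x => hu.unique hq ordConnected_univ (hΦ.smul _) (mem_univ 0) ?_ ?_
      (mem_univ x)⟩
    · rw [(hu2 h).1]; simp [h]
    · rw [(hu2 h).2, wZero, if_neg h]; ring

/-- As `E` is real, the conjugate of `Φ` is another square integrable solution, so its Wronskian
with `Φ` vanishes. Reality of `w₀` is what makes `1 + w₀²` nonzero and `u`, `v` real. -/
theorem conj_wZero {V : ℝ → ℝ} {E ρ : ℝ} (hV : Continuous V) (hρ : 0 ≤ ρ)
    (hper : ∀ x, ρ ≤ x → V (x + 1) = V x) {Φ : ℝ → ℂ}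
    (hΦ : SolOn (pot V E) Φ (deriv Φ) univ) (hL2 : SqBdd Φ ρ) :
    starRingEnd ℂ (wZero Φ) = wZero Φ := by
  obtain ⟨K, hK⟩ := exists_bound_potential hV E hρ hper
  have hL2' := sqBdd_deriv hV hK hΦ hL2
  have hc := hΦ.conj
  rw [Complex.conj_ofReal] at hc
  have hcb : ∀ f : ℝ → ℂ, SqBdd f ρ → SqBdd (fun x => starRingEnd ℂ (f x)) ρ := fun f hf => by
    simpa [SqBdd] using hf
  have hW := wronsk_eq_zero_of_sqBdd (hΦ.mono (subset_univ _)) (hc.mono (subset_univ _)) hL2 hL2'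
    (hcb _ hL2) (hcb _ hL2')
  rw [wronsk_const ordConnected_univ hΦ hc (mem_univ ρ) (mem_univ 0)] at hW
  unfold wZero
  split_ifs with h
  · simp
  · have h2 : starRingEnd ℂ (Φ 0) ≠ 0 := by simpa using h
    rw [map_div₀]
    field_simp
    simp only [wronsk] at hW
    linear_combination hW

theorem DecayPair.mono {V : ℝ → ℝ} {E κ C c C' c' : ℝ} {u u' v v' : ℝ → ℂ}
    (h : DecayPair V E κ C c u u' v v') (hC : C ≤ C') (hc : c' ≤ c) :
    DecayPair V E κ C' c' u u' v v' where
  solu := h.solu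
  solv := h.solv
  wronsk_eq := h.wronsk_eq
  norm_u x hx := (h.norm_u x hx).trans (by gcongr)
  norm_u' x hx := (h.norm_u' x hx).trans (by gcongr)
  norm_v x hx := (h.norm_v x hx).trans (by gcongr)
  norm_v' x hx := (h.norm_v' x hx).trans (by gcongr)
  lower x hx := le_trans (by gcongr) (h.lower x hx)

/-- For real `v`, the modulus of `v' - i √E v` controls both `‖v'‖` and `√E ‖v‖`. Since `u`, `u'`
are `O(e^{-κx})` and the Wronskian is `1`, it cannot be smaller than a multiple of `e^{κx}`. -/
theorem exists_decayPair {V : ℝ → ℝ} {E ρ κ : ℝ} (hV : Continuous V) (hE : 0 < E) (hρ : 0 ≤ ρ)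
    (hκ : 0 < κ) (hper : ∀ x, ρ ≤ x → V (x + 1) = V x) {u u' v v' : ℝ → ℂ}
    (hu : SolOn (pot V E) u u' univ) (hv : SolOn (pot V E) v v' univ)
    (hW : ∀ x, wronsk u u' v v' x = 1) {μ : ℂ} (hμ : ‖μ‖ = Real.exp (-κ))
    (hμu : ∀ x, ρ ≤ x → u (x + 1) = μ * u x ∧ u' (x + 1) = μ * u' x)
    (hvr : ∀ x, (v x).im = 0 ∧ (v' x).im = 0) :
    ∃ C c : ℝ, 0 < C ∧ 0 < c ∧ DecayPair V E κ C c u u' v v' := by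
  obtain ⟨C, hC, hb⟩ := exists_exp_bounds hV hρ hκ hper hu hv hW hμ hμu
  set σ := Real.sqrt E
  have hσ : 0 < σ := Real.sqrt_pos.2 hE
  refine ⟨C, 1 / (C * (1 + 1 / σ)), hC, by positivity, hu, hv, hW, fun x hx => (hb x hx).1,
    fun x hx => (hb x hx).2.1, fun x hx => (hb x hx).2.2.1, fun x hx => (hb x hx).2.2.2,
    fun x hx => ?_⟩
  obtain ⟨h1, h2, -, -⟩ := hb x hx
  set n := ‖v' x - Complex.I * (σ : ℂ) * v x‖ with hn
  have hv1 : ‖v' x‖ ≤ n := by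
    have := Complex.abs_re_le_norm (v' x - Complex.I * (σ : ℂ) * v x)
    have e : (v' x - Complex.I * (σ : ℂ) * v x).re = (v' x).re := by simp [(hvr x).1]
    rw [e] at this
    rwa [← Complex.re_add_im (v' x), (hvr x).2, Complex.ofReal_zero, zero_mul, add_zero,
      Complex.norm_real, Real.norm_eq_abs]
  have hv2 : σ * ‖v x‖ ≤ n := by
    have := Complex.abs_im_le_norm (v' x - Complex.I * (σ : ℂ) * v x)
    have e : (v' x - Complex.I * (σ : ℂ) * v x).im = -(σ * (v x).re) := by
      simp [(hvr x).1, (hvr x).2]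
    rw [e, abs_neg, abs_mul, abs_of_pos hσ] at this
    rwa [← Complex.re_add_im (v x), (hvr x).1, Complex.ofReal_zero, zero_mul, add_zero,
      Complex.norm_real, Real.norm_eq_abs]
  have hv3 : ‖v x‖ ≤ 1 / σ * n := by
    rw [one_div, ← div_eq_inv_mul, le_div_iff₀ hσ]; linarith
  have hone : (1 : ℝ) ≤ C * Real.exp (-κ * x) * ((1 + 1 / σ) * n) := by
    calc (1 : ℝ) = ‖wronsk u u' v v' x‖ := by rw [hW]; simp
      _ ≤ ‖u x‖ * ‖v' x‖ + ‖u' x‖ * ‖v x‖ := by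
        rw [← norm_mul, ← norm_mul]; exact norm_sub_le _ _
      _ ≤ C * Real.exp (-κ * x) * n + C * Real.exp (-κ * x) * (1 / σ * n) := by gcongr
      _ = _ := by ring
  have hee := exp_mul_exp_neg_self κ x
  rw [one_div, ← div_eq_inv_mul, div_le_iff₀ (by positivity)]
  calc Real.exp (κ * x) ≤ Real.exp (κ * x) * (C * Real.exp (-κ * x) * ((1 + 1 / σ) * n)) :=
        le_mul_of_one_le_right (Real.exp_pos _).le hone
    _ = n * (C * (1 + 1 / σ)) := by linear_combination C * (1 + 1 / σ) * n * hee

/-- The Floquet exponent of the bound state, and exponential bounds on both half-lines. -/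
theorem exists_floquet_exponent {V Vper Vdef : ℝ → ℝ} {ρ E : ℝ} {Φ : ℝ → ℂ} (hV : Continuous V)
    (hsum : ∀ x, V x = Vper x + Vdef x) (hper : ∀ x, Vper (x + 1) = Vper x) (hρ : 0 ≤ ρ)
    (hdef : ∀ x, ρ < |x| → Vdef x = 0) (hE : 0 < E) (hΦ : IsBoundState V E Φ) :
    starRingEnd ℂ (wZero Φ) = wZero Φ ∧
    ∃ κ : ℝ, 0 < κ ∧
      (∃ μ : ℂ, ‖μ‖ = Real.exp (-κ) ∧ ∀ x : ℝ, ρ ≤ x → Φ (x + 1) = μ * Φ x) ∧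
      ∃ C c : ℝ, 0 < C ∧ 0 < c ∧
        DecayPair V E κ C c (uSol V Φ (wZero Φ) E) (deriv (uSol V Φ (wZero Φ) E))
          (vSol V Φ (wZero Φ) E) (deriv (vSol V Φ (wZero Φ) E)) ∧
        DecayPair (fun x => V (-x)) E κ C c (fun x => uSol V Φ (wZero Φ) E (-x))
          (fun x => -deriv (uSol V Φ (wZero Φ) E) (-x))
          (fun x => -vSol V Φ (wZero Φ) E (-x)) (fun x => deriv (vSol V Φ (wZero Φ) E) (-x)) := by
  obtain ⟨hne, hL2, heq⟩ := hΦ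
  have hsol := (schrodingerEq_iff hV E Φ).1 heq
  have hq := continuous_pot hV E
  have h0 : ∃ x, Φ x ≠ 0 := Function.ne_iff.1 hne
  have hVout : ∀ x, ρ < |x| → V x = Vper x := fun x hx => by rw [hsum, hdef x hx, add_zero]
  have hV' : Continuous fun x => V (-x) := hV.comp continuous_neg
  have hR : ∀ x, ρ ≤ x → V (x + 1) = V x := continuousOn_extend_shift hV fun x hx => by
    rw [hVout x (hx.trans_le (le_abs_self x)),
      hVout (x + 1) (lt_of_lt_of_le (by linarith) (le_abs_self _)), hper]
  have hL : ∀ x, ρ ≤ x → V (-(x + 1)) = V (-x) := continuousOn_extend_shift hV' fun x hx => by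
    rw [hVout (-x) (by rw [abs_neg]; exact hx.trans_le (le_abs_self x)),
      hVout (-(x + 1)) (by rw [abs_neg]; exact lt_of_lt_of_le (by linarith) (le_abs_self _)),
      ← hper]
    ring_nf
  have hL2r : SqBdd Φ ρ := SqBdd.of_memLp hL2 ρ
  have hL2l : SqBdd (fun x => Φ (-x)) ρ := SqBdd.of_memLp
    (hL2.comp_measurePreserving (Measure.measurePreserving_neg volume)) ρ
  obtain ⟨μ, hμ0, hμ1, hμ⟩ := exists_floquet_multiplier hV hρ hR hsol h0 hL2r
  obtain ⟨ν, hν0, hν1, hν⟩ := exists_floquet_multiplier (V := fun x => V (-x)) hV' hρ hL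
    hsol.reflect (by obtain ⟨x, hx⟩ := h0; exact ⟨-x, by simpa using hx⟩) hL2l
  have hν' : ∀ x, ρ ≤ x → Φ (-(x + 1)) = ν * Φ (-x) ∧ deriv Φ (-(x + 1)) = ν * deriv Φ (-x) :=
    fun x hx => ⟨(hν x hx).1, by linear_combination -(hν x hx).2⟩
  -- A single exponent `κ` has to serve both half-lines.
  have hμν : μ = ν := by
    refine floquet_multipliers_eq hV ?_ hsol h0 hμ1 hν1 hμ hν'
    obtain ⟨n, hn⟩ := exists_nat_gt (2 * ρ + 2)
    refine ⟨n, hn, fun x hx hxn => ?_⟩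
    have hp : Function.Periodic Vper 1 := hper
    rw [hVout x (hx.trans_le (le_abs_self x)), hVout (x - n) (by
      rw [abs_of_neg (by linarith)]; linarith)]
    simpa using hp.sub_nat_mul_eq n (x := x)
  have hwr := conj_wZero hV hρ hR hsol hL2r
  have hw := one_add_sq_ne_zero hwr
  refine ⟨hwr, -Real.log ‖μ‖, neg_pos.2 (Real.log_neg (norm_pos_iff.2 hμ0) hμ1), ?_⟩
  have hexp : ‖μ‖ = Real.exp (-(-Real.log ‖μ‖)) := by
    rw [neg_neg, Real.exp_log (norm_pos_iff.2 hμ0)]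
  have hκ : 0 < -Real.log ‖μ‖ := neg_pos.2 (Real.log_neg (norm_pos_iff.2 hμ0) hμ1)
  refine ⟨⟨μ, hexp, fun x hx => (hμ x hx).1⟩, ?_⟩
  set u := uSol V Φ (wZero Φ) E
  set v := vSol V Φ (wZero Φ) E
  have hu : SolOn (pot V E) u (deriv u) univ := (uSol_spec hV Φ (wZero Φ) E).1
  have hv : SolOn (pot V E) v (deriv v) univ := (vSol_spec hV Φ (wZero Φ) E).1
  have hW : ∀ x, wronsk u (deriv u) v (deriv v) x = 1 := wronsk_uSol_vSol hV Φ hw E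
  obtain ⟨k, hk⟩ : ∃ k, ∀ x, u x = k * Φ x ∧ deriv u x = k * deriv Φ x :=
    exists_smul_eq_uSol hV hsol h0
  have hvr : ∀ x, (v x).im = 0 ∧ (deriv v x).im = 0 := by
    obtain ⟨-, hv1, hv2⟩ := vSol_spec hV Φ (wZero Φ) E
    refine hv.im_eq_zero hV ?_ ?_
    all_goals by_cases h : Φ 0 = 0
    · simp only [v, (hv1 h).1]; simp [hwr]
    · simp only [v, (hv2 h).1]; simp [hwr]
    · simp only [v, (hv1 h).2]; simp [hwr]
    · simp only [v, (hv2 h).2]; simp [hwr]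
  obtain ⟨C₁, c₁, hC₁, hc₁, h1⟩ := exists_decayPair hV hE hρ hκ hR hu hv hW hexp
    (fun x hx => by
      rw [(hk x).1, (hk (x + 1)).1, (hk x).2, (hk (x + 1)).2, (hμ x hx).1, (hμ x hx).2]
      constructor <;> ring) hvr
  -- Reflection reverses the sign of the Wronskian; taking `-v (-x)` restores the value `1`.
  obtain ⟨C₂, c₂, hC₂, hc₂, h2⟩ := exists_decayPair (V := fun x => V (-x)) hV' hE hρ hκ hL
    hu.reflect hv.neg_reflect (fun x => by rw [← hW (-x)]; simp only [wronsk]; ring) hexp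
    (fun x hx => by
      rw [(hk (-x)).1, (hk (-(x + 1))).1, (hk (-x)).2, (hk (-(x + 1))).2, (hν' x hx).1,
        (hν' x hx).2, hμν]
      constructor <;> ring) (fun x => by simpa using hvr (-x))
  exact ⟨max C₁ C₂, min c₁ c₂, lt_max_of_lt_left hC₁, lt_min hc₁ hc₂,
    h1.mono (le_max_left _ _) (min_le_left _ _), h2.mono (le_max_right _ _) (min_le_right _ _)⟩

/-! ### The resonance near the bound state energy -/

theorem differentiableAt_outVal {V : ℝ → ℝ} (hV : Continuous V) (a b : ℂ) (M E : ℝ) {l : ℂ}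
    (hl : 0 < ((E : ℂ) + l).re) :
    DifferentiableAt ℂ (fun l : ℂ => outVal (Complex.sqrt (E + l)) M (schrodingerSol V (E + l) a b)
      (deriv (schrodingerSol V (E + l) a b))) l ∧
    DifferentiableAt ℂ (fun l : ℂ => outVal (Complex.sqrt (E + l)) M
      (fun x => schrodingerSol V (E + l) a b (-x))
      (fun x => -deriv (schrodingerSol V (E + l) a b) (-x))) l := by
  have hadd : DifferentiableAt ℂ (fun l : ℂ => (E : ℂ) + l) l := by fun_prop
  have hs : DifferentiableAt ℂ (fun l : ℂ => Complex.sqrt (E + l)) l :=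
    (differentiableAt_csqrt hl).comp l hadd
  have h1 := fun x => ((differentiable_schrodingerSol hV a b x).1 _).comp l hadd
  have h2 := fun x => ((differentiable_schrodingerSol hV a b x).2 _).comp l hadd
  exact ⟨(h2 M).sub (((differentiableAt_const _).mul hs).mul (h1 M)),
    (h2 (-M)).neg.sub (((differentiableAt_const _).mul hs).mul (h1 (-M)))⟩

theorem DecayPair.norm_integral_sq_le {V : ℝ → ℝ} {E κ C c : ℝ} {u u' v v' : ℝ → ℂ}
    (h : DecayPair V E κ C c u u' v v') (hκ : 0 < κ) {M : ℝ} (hM : 0 ≤ M) :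
    ‖∫ t in (0 : ℝ)..M, u t ^ 2‖ ≤ C ^ 2 * (1 / (2 * κ)) := by
  have hb : ∀ t ∈ Icc 0 M, ‖u t * u t‖ ≤ C ^ 2 * Real.exp (-(2 * κ) * t) := fun t ht => by
    rw [norm_mul]
    calc _ ≤ (C * Real.exp (-κ * t)) * (C * Real.exp (-κ * t)) :=
          mul_le_mul (h.norm_u t ht.1) (h.norm_u t ht.1) (norm_nonneg _)
            ((norm_nonneg _).trans (h.norm_u t ht.1))
      _ = _ := by
        rw [show -(2 * κ) * t = -κ * t + -κ * t by ring, Real.exp_add]; ring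
  have h1 := norm_integral_mul_mul_le (h := fun _ => 1) (a := 1) hM (by fun_prop) hb
    (fun t _ => by simp)
  simp only [mul_one, intervalIntegral.integral_const_mul] at h1
  simp_rw [pow_two (u _)]
  refine h1.trans ?_
  gcongr
  exact integral_exp_neg_mul_le (by linarith)

-- The matching argument. The half-line estimates are used once for `u`, `v` at `M` and once for
-- their reflections at `-M`. The two outgoing conditions are reduced to a scalar equation for `l`,
-- from which `w` is then recovered.
set_option maxHeartbeats 2000000 in
theorem exists_resonance_parameters {V : ℝ → ℝ} {E κ C c : ℝ} {Φ : ℝ → ℂ} (hV : Continuous V)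
    (hE : 0 < E) (hκ : 0 < κ) (hC : 0 < C) (hc : 0 < c)
    (hwr : starRingEnd ℂ (wZero Φ) = wZero Φ)
    (hR : DecayPair V E κ C c (uSol V Φ (wZero Φ) E) (deriv (uSol V Φ (wZero Φ) E))
      (vSol V Φ (wZero Φ) E) (deriv (vSol V Φ (wZero Φ) E)))
    (hL : DecayPair (fun x => V (-x)) E κ C c (fun x => uSol V Φ (wZero Φ) E (-x))
      (fun x => -deriv (uSol V Φ (wZero Φ) E) (-x))
      (fun x => -vSol V Φ (wZero Φ) E (-x)) (fun x => deriv (vSol V Φ (wZero Φ) E) (-x))) :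
    ∃ M₀ D : ℝ, 1 ≤ M₀ ∧ 0 ≤ D ∧ ∀ M, M₀ ≤ M → ∃ w z : ℂ, 0 < z.re ∧
      deriv (uSol V Φ w z) M = Complex.I * Complex.sqrt z * uSol V Φ w z M ∧
      deriv (uSol V Φ w z) (-M) = -(Complex.I * Complex.sqrt z * uSol V Φ w z (-M)) ∧
      corrDenom E M (uSol V Φ (wZero Φ) E) (vSol V Φ (wZero Φ) E) ≠ 0 ∧
      ‖z - zApprox E M (uSol V Φ (wZero Φ) E) (vSol V Φ (wZero Φ) E)‖
        ≤ D * (M * Real.exp (-4 * κ * M)) ∧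
      ‖w - wApprox (wZero Φ) E M (uSol V Φ (wZero Φ) E) (vSol V Φ (wZero Φ) E)‖
        ≤ D * (M * Real.exp (-4 * κ * M)) := by
  have hw := one_add_sq_ne_zero hwr
  have hdata := fun d z => uSol_data hV Φ hw d z E
  have hune : ∃ x, uSol V Φ (wZero Φ) E x ≠ 0 := by
    by_contra hcon
    push Not at hcon
    have hz : uSol V Φ (wZero Φ) E = 0 := funext hcon
    rcases uSol_ne_zero hV Φ (wZero Φ) E 0 with h | h
    · exact h (hcon 0)
    · rw [hz] at h; simp at h
  have hur : ∀ x, (uSol V Φ (wZero Φ) E x).im = 0 := fun x => by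
    obtain ⟨hu, hu1, hu2⟩ := uSol_spec hV Φ (wZero Φ) E
    refine (hu.im_eq_zero hV ?_ ?_ x).1
    all_goals by_cases h : Φ 0 = 0
    · rw [(hu1 h).1]; simp [hwr]
    · rw [(hu2 h).1]; simp
    · rw [(hu1 h).2]; simp
    · rw [(hu2 h).2]; exact hwr
  have hsolζ := fun w z => (uSol_spec hV Φ w z).1
  set u := uSol V Φ (wZero Φ) E
  set v := vSol V Φ (wZero Φ) E
  set c₀ := wZero Φ / (1 + wZero Φ ^ 2)
  set σ := Real.sqrt E
  have hσ : 0 < σ := Real.sqrt_pos.2 hE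
  have huc : Continuous u := hR.solu.continuous
  set I₀ := ∫ t in (-1 : ℝ)..1, ‖u t‖ ^ 2 with hI₀
  have hI₀pos : 0 < I₀ := integral_sq_pos (continuous_pot hV E) hR.solu hune (by norm_num)
  set Dm := C * (1 + σ) / c
  have hDm : 0 < Dm := by positivity
  -- With `r = K e / 3 = 4 Dm e / I₀`, the expected zero `(m₁ + m₂) / (I₁ + I₂)`, of modulus at most
  -- `2 Dm e / I₀`, lies within `r / 2`, and the ball of radius `3 r` is the range allowed for `l`.
  set K := 12 * Dm / I₀
  have hK : 0 < K := by positivity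
  obtain ⟨M₁, D₁, hM₁, hD₁, hS⟩ := exists_scaled_bounds (K := K) hE hκ hC hc hK
  set Ib := C ^ 2 * (1 / (2 * κ))
  have hIb : 0 ≤ Ib := by positivity
  set Q := Dm + K * Ib + D₁
  have hQ : 0 < Q := by positivity
  set P := 2 * D₁ + 2 * Q * D₁
  have hP : 0 ≤ P := by positivity
  -- One threshold for four requirements on `X = M e^{-2κM}`: `X ≤ 1`, `X * P ≤ Dm`, `D₁ * X ≤ 1 /
  -- 2` and `2 * Q * ‖c₀‖ * X ≤ 1 / 2`.
  obtain ⟨M₂, hM₂, hX⟩ := exists_mul_exp_le (k := 2 * κ)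
    (ε := 1 / (1 + P / Dm + 2 * D₁ + 4 * Q * ‖c₀‖)) (by positivity) (by positivity)
  refine ⟨max M₁ M₂, P / I₀ + (8 * ‖c₀‖ * Q ^ 2 + D₁ + 2 * Q * D₁ + P / I₀ * Ib),
    hM₁.trans (le_max_left _ _), by positivity, fun M hM => ?_⟩
  have hMM₁ : M₁ ≤ M := (le_max_left _ _).trans hM
  have hM1 : 1 ≤ M := hM₁.trans hMM₁
  have hM0 : 0 ≤ M := by linarith
  replace hX := hX M ((le_max_right _ _).trans hM)
  rw [le_div_iff₀ (by positivity)] at hX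
  have he4 : Real.exp (-4 * κ * M) = Real.exp (-(2 * κ) * M) * Real.exp (-(2 * κ) * M) := by
    rw [← Real.exp_add]; ring_nf
  rw [he4]
  replace hS : ∀ (V : ℝ → ℝ) (u u' v v' : ℝ → ℂ), DecayPair V E κ C c u u' v v' → _ :=
    fun V u u' v v' h => hS V u u' v v' h M hMM₁
  have hratio : ∀ (V : ℝ → ℝ) (u u' v v' : ℝ → ℂ), DecayPair V E κ C c u u' v v' →
      ‖outVal σ M u u' / outVal σ M v v'‖ ≤ Dm * Real.exp (-(2 * κ) * M) := fun V u u' v v' h =>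
    h.norm_ratio_le hM0 (by rw [Complex.norm_real, Real.norm_of_nonneg hσ.le]) hc (h.lower M hM0)
  have hm₁ := hratio _ _ _ _ _ hR
  have hm₂ := hratio _ _ _ _ _ hL
  have hI₁b := hR.norm_integral_sq_le hκ hM0
  have hI₂b := hL.norm_integral_sq_le hκ hM0
  set e := Real.exp (-(2 * κ) * M) with he
  have he0 : 0 < e := Real.exp_pos _
  have heX : e ≤ M * e := by nlinarith
  set X := M * e with hXdef
  have hX0 : 0 < X := by positivity
  have hX1 : X ≤ 1 := by
    have : 0 ≤ X * (P / Dm + 2 * D₁ + 4 * Q * ‖c₀‖) := by positivity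
    linarith
  have hXP : X * P ≤ Dm := by
    have : 0 ≤ X * (1 + 2 * D₁ + 4 * Q * ‖c₀‖) := by positivity
    have h2 : X * (P / Dm) ≤ 1 := by linarith
    rwa [← mul_div_assoc, div_le_one hDm] at h2
  have hXD : D₁ * X ≤ 1 / 2 := by
    have : 0 ≤ X * (1 + P / Dm + 4 * Q * ‖c₀‖) := by positivity
    linarith
  have hXc : 2 * Q * ‖c₀‖ * X ≤ 1 / 2 := by
    have : 0 ≤ X * (1 + P / Dm + 2 * D₁) := by positivity
    linarith
  set I₁ := ∫ t in (0 : ℝ)..M, u t ^ 2 with hI₁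
  set I₂ := ∫ t in (0 : ℝ)..M, u (-t) ^ 2 with hI₂
  have hI₂' : I₂ = ∫ t in (-M)..0, u t ^ 2 := by
    rw [hI₂, intervalIntegral.integral_comp_neg (fun t => u t ^ 2), neg_zero]
  have hu2c : Continuous fun t => u t ^ 2 := by fun_prop
  have hI : (∫ t in (-M)..M, u t ^ 2) = I₁ + I₂ := by
    rw [hI₂', add_comm, hI₁]
    exact (intervalIntegral.integral_add_adjacent_intervals (hu2c.intervalIntegrable _ _)
      (hu2c.intervalIntegrable _ _)).symm
  -- Since `u` is real, `∫ u²` is the integral of `‖u‖²` and increases with `M`; its value on `[-1,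
  -- 1]` bounds it below uniformly.
  have hIlow : I₀ ≤ ‖I₁ + I₂‖ := by
    have e1 : ∀ t, u t ^ 2 = ((‖u t‖ ^ 2 : ℝ) : ℂ) := fun t => by
      have : u t = ((u t).re : ℂ) := by
        apply Complex.ext <;> simp [hur t]
      rw [this, Complex.norm_real, Real.norm_eq_abs, sq_abs]
      push_cast; rfl
    rw [← hI]
    simp_rw [e1]
    rw [intervalIntegral.integral_ofReal, Complex.norm_real]
    refine le_trans ?_ (Real.le_norm_self _)
    rw [hI₀]
    have hc1 : Continuous fun t => ‖u t‖ ^ 2 := by fun_prop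
    exact intervalIntegral.integral_mono_interval (by linarith) (by norm_num) hM1
      (Filter.Eventually.of_forall fun t => by positivity) (hc1.intervalIntegrable _ _)
  have hI0 : I₁ + I₂ ≠ 0 := norm_pos_iff.1 (hI₀pos.trans_le hIlow)
  have hIpos : 0 < ‖I₁ + I₂‖ := norm_pos_iff.2 hI0
  set û : ℝ → ℂ := fun x => u (-x)
  set û' : ℝ → ℂ := fun x => -deriv u (-x)
  set vv : ℝ → ℂ := fun x => -v (-x)
  set vv' : ℝ → ℂ := fun x => deriv v (-x)
  set m₁ := outVal σ M u (deriv u) / outVal σ M v (deriv v) with hm₁def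
  set m₂ := outVal σ M û û' / outVal σ M vv vv' with hm₂def
  -- normalised boundary values of the perturbed solutions
  let Y : ℂ → ℝ → ℂ := fun l => schrodingerSol V (E + l) (u 0) (deriv u 0)
  let Z : ℂ → ℝ → ℂ := fun l => schrodingerSol V (E + l) (v 0) (deriv v 0)
  have hY := fun l : ℂ => schrodingerSol_spec hV (E + l) (u 0) (deriv u 0)
  have hZ := fun l : ℂ => schrodingerSol_spec hV (E + l) (v 0) (deriv v 0)
  let s : ℂ → ℂ := fun l => Complex.sqrt (E + l)
  let S₁ : ℂ → ℂ := fun l => outVal (s l) M (Y l) (deriv (Y l)) / outVal (s l) M v (deriv v)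
  let S₂ : ℂ → ℂ := fun l => outVal (s l) M (Z l) (deriv (Z l)) / outVal (s l) M v (deriv v)
  let T₁ : ℂ → ℂ := fun l => outVal (s l) M (fun x => Y l (-x)) (fun x => -deriv (Y l) (-x)) /
    outVal (s l) M vv vv'
  let T₂ : ℂ → ℂ := fun l => outVal (s l) M (fun x => -Z l (-x)) (fun x => deriv (Z l) (-x)) /
    outVal (s l) M vv vv'
  have hRl : ∀ l : ℂ, ‖l‖ ≤ K * e → 0 < ((E : ℂ) + l).re ∧ outVal (s l) M v (deriv v) ≠ 0 ∧
      ‖S₁ l - (m₁ - l * I₁)‖ ≤ D₁ * (X * e) ∧ ‖S₂ l - 1‖ ≤ D₁ * X := fun l hl => by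
    obtain ⟨h1, h2, h3⟩ := hS _ _ _ _ _ hR l hl
    exact ⟨h1, h2, (h3 (Y l) (deriv (Y l)) (hY l).1).1 (hY l).2.1 (hY l).2.2,
      (h3 (Z l) (deriv (Z l)) (hZ l).1).2 (hZ l).2.1 (hZ l).2.2⟩
  have hLl : ∀ l : ℂ, ‖l‖ ≤ K * e → outVal (s l) M vv vv' ≠ 0 ∧
      ‖T₁ l - (m₂ - l * I₂)‖ ≤ D₁ * (X * e) ∧ ‖T₂ l - 1‖ ≤ D₁ * X := fun l hl => by
    obtain ⟨h1, h2, h3⟩ := hS _ _ _ _ _ hL l hl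
    refine ⟨h2, (h3 _ _ (hY l).1.reflect).1 ?_ ?_, (h3 _ _ (hZ l).1.neg_reflect).2 ?_ ?_⟩
    · simp only [û, neg_zero]; exact (hY l).2.1
    · simp only [û', neg_zero, neg_inj]; exact (hY l).2.2
    · simp only [vv, neg_zero, neg_inj]; exact (hZ l).2.1
    · simp only [vv', neg_zero]; exact (hZ l).2.2
  have hbd : ∀ l : ℂ, ‖l‖ ≤ K * e → ‖S₁ l‖ ≤ Q * e ∧ ‖T₁ l‖ ≤ Q * e := fun l hl => by
    have key : ∀ a m I : ℂ, ‖a - (m - l * I)‖ ≤ D₁ * (X * e) → ‖m‖ ≤ Dm * e → ‖I‖ ≤ Ib →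
        ‖a‖ ≤ Q * e := fun a m I h1 h2 h3 => by
      have h4 : ‖a‖ ≤ ‖a - (m - l * I)‖ + ‖m - l * I‖ := by
        simpa using norm_add_le (a - (m - l * I)) (m - l * I)
      have h5 : ‖m - l * I‖ ≤ ‖m‖ + ‖l‖ * ‖I‖ := by
        rw [← norm_mul]; exact norm_sub_le _ _
      have h6 : ‖l‖ * ‖I‖ ≤ K * e * Ib := by gcongr
      have h7 : D₁ * (X * e) ≤ D₁ * (1 * e) := by gcongr
      have h8 : Q * e = Dm * e + K * e * Ib + D₁ * (1 * e) := by simp only [Q]; ring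
      linarith
    exact ⟨key _ _ _ (hRl l hl).2.2.1 hm₁ hI₁b, key _ _ _ (hLl l hl).2.1 hm₂ hI₂b⟩
  set r := K * e / 3 with hr
  have hr0 : 0 < r := by positivity
  have hball : ∀ l ∈ Metric.ball (0 : ℂ) (3 * r), ‖l‖ ≤ K * e := fun l hl => by
    rw [mem_ball_zero_iff] at hl
    have : 3 * r = K * e := by rw [hr]; ring
    linarith
  have hfd : DifferentiableOn ℂ (fun l => S₁ l * T₂ l + T₁ l * S₂ l) (Metric.ball 0 (3 * r)) := by
    intro l hl
    obtain ⟨h1, h2, -, -⟩ := hRl l (hball l hl)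
    obtain ⟨h3, -, -⟩ := hLl l (hball l hl)
    have hs : DifferentiableAt ℂ s l :=
      (differentiableAt_csqrt h1).comp l (by fun_prop : DifferentiableAt ℂ (fun l : ℂ => E + l) l)
    have d1 : DifferentiableAt ℂ (fun l => outVal (s l) M v (deriv v)) l :=
      (differentiableAt_const _).sub (((differentiableAt_const _).mul hs).mul
        (differentiableAt_const _))
    have d2 : DifferentiableAt ℂ (fun l => outVal (s l) M vv vv') l :=
      (differentiableAt_const _).sub (((differentiableAt_const _).mul hs).mul
        (differentiableAt_const _))
    obtain ⟨dY, dY'⟩ := differentiableAt_outVal hV (u 0) (deriv u 0) M E h1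
    obtain ⟨dZ, dZ'⟩ := differentiableAt_outVal hV (v 0) (deriv v 0) M E h1
    have dZ'' : DifferentiableAt ℂ (fun l => outVal (s l) M (fun x => -Z l (-x))
        (fun x => deriv (Z l) (-x))) l := by
      refine dZ'.neg.congr_of_eventuallyEq (Filter.Eventually.of_forall fun l => ?_)
      simp only [outVal, Z, s, Pi.neg_apply]; ring
    exact (((dY.div d1 h2).mul (dZ''.div d2 h3)).add
      ((dY'.div d2 h3).mul (dZ.div d1 h2))).differentiableWithinAt
  have hfb : ∀ l ∈ Metric.ball (0 : ℂ) (3 * r),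
      ‖S₁ l * T₂ l + T₁ l * S₂ l - (m₁ + m₂ - l * (I₁ + I₂))‖ ≤ P * (X * e) := by
    intro l hl
    have hl' := hball l hl
    obtain ⟨-, -, h1, h2⟩ := hRl l hl'
    obtain ⟨-, h3, h4⟩ := hLl l hl'
    obtain ⟨h5, h6⟩ := hbd l hl'
    have e1 : S₁ l * T₂ l + T₁ l * S₂ l - (m₁ + m₂ - l * (I₁ + I₂)) =
        (S₁ l - (m₁ - l * I₁)) + S₁ l * (T₂ l - 1) + (T₁ l - (m₂ - l * I₂))
          + T₁ l * (S₂ l - 1) := by ring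
    simp only [e1]
    refine (norm_add_le _ _).trans ?_
    have h7 := norm_add_le ((S₁ l - (m₁ - l * I₁)) + S₁ l * (T₂ l - 1)) (T₁ l - (m₂ - l * I₂))
    have h8 := norm_add_le (S₁ l - (m₁ - l * I₁)) (S₁ l * (T₂ l - 1))
    have h9 : ‖S₁ l * (T₂ l - 1)‖ ≤ Q * e * (D₁ * X) := by rw [norm_mul]; gcongr
    have h10 : ‖T₁ l * (S₂ l - 1)‖ ≤ Q * e * (D₁ * X) := by rw [norm_mul]; gcongr
    have h11 : P * (X * e) = D₁ * (X * e) + Q * e * (D₁ * X) + D₁ * (X * e) + Q * e * (D₁ * X) := by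
      simp only [P]; ring
    linarith
  have hfm : ‖(m₁ + m₂) / (I₁ + I₂)‖ ≤ r / 2 := by
    rw [norm_div, div_le_iff₀ hIpos]
    have h1 := norm_add_le m₁ m₂
    have h2 : r / 2 * I₀ = 2 * (Dm * e) := by
      simp only [r, K]; field_simp; norm_num
    have h3 : r / 2 * I₀ ≤ r / 2 * ‖I₁ + I₂‖ := by gcongr
    linarith
  have hfε : P * (X * e) / ‖I₁ + I₂‖ ≤ r / 4 := by
    rw [div_le_iff₀ hIpos]
    have h2 : r / 4 * I₀ = Dm * e := by
      simp only [r, K]; field_simp; norm_num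
    have h3 : r / 4 * I₀ ≤ r / 4 * ‖I₁ + I₂‖ := by gcongr
    have h4 : P * (X * e) ≤ Dm * e := by
      calc _ = X * P * e := by ring
        _ ≤ _ := by gcongr
    linarith
  -- The function is the determinant of the two linear conditions `S₁ + τ S₂ = 0` and `T₁ - τ T₂ =
  -- 0` on `τ`.
  obtain ⟨l, hlr, hzero, hlerr⟩ := exists_zero_near_affine
    (f := fun l => S₁ l * T₂ l + T₁ l * S₂ l) hr0 hI0 hfd hfb hfm hfε
  have hl : ‖l‖ ≤ K * e := hball l (by rw [mem_ball_zero_iff]; linarith)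
  obtain ⟨hre, hbR, hS₁, hS₂⟩ := hRl l hl
  obtain ⟨hbL, hT₁, hT₂⟩ := hLl l hl
  obtain ⟨hS₁b, hT₁b⟩ := hbd l hl
  have hlerr' : ‖l - (m₁ + m₂) / (I₁ + I₂)‖ ≤ P / I₀ * (X * e) := by
    refine hlerr.trans ?_
    rw [div_mul_eq_mul_div]
    gcongr
  have hS₂low : 1 / 2 ≤ ‖S₂ l‖ := by
    have := norm_sub_norm_le (1 : ℂ) (1 - S₂ l)
    rw [norm_one, sub_sub_cancel, norm_sub_rev] at this
    linarith
  have hS₂0 : S₂ l ≠ 0 := norm_pos_iff.1 (by linarith)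
  set τ := -S₁ l / S₂ l with hτ
  have hτb : ‖τ‖ ≤ 2 * Q * e := by
    rw [hτ, norm_div, norm_neg, div_le_iff₀ (by linarith)]
    have : 0 ≤ 2 * Q * e := by positivity
    nlinarith
  have hτS : τ * S₂ l = -S₁ l := by rw [hτ]; field_simp
  have hcτ : ‖c₀ * τ‖ ≤ 1 / 2 := by
    rw [norm_mul]
    calc _ ≤ ‖c₀‖ * (2 * Q * e) := by gcongr
      _ ≤ ‖c₀‖ * (2 * Q * X) := by gcongr
      _ = 2 * Q * ‖c₀‖ * X := by ring
      _ ≤ _ := hXc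
  have hden : 1 / 2 ≤ ‖1 - c₀ * τ‖ := by
    have := norm_sub_norm_le (1 : ℂ) (c₀ * τ)
    rw [norm_one] at this
    linarith
  have hden0 : 1 - c₀ * τ ≠ 0 := norm_pos_iff.1 (by linarith)
  -- This solves `d = τ (1 + c₀ d)`, so `u_ζ` with `w = w₀ + d` is `1 + c₀ d` times `Y + τ Z`.
  set d := τ / (1 - c₀ * τ) with hd
  have hα : 1 + c₀ * d = 1 / (1 - c₀ * τ) := by rw [hd]; field_simp; ring
  have hdα : d = 1 / (1 - c₀ * τ) * τ := by rw [hd]; ring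
  have hbp : outVal σ M v (deriv v) ≠ 0 := norm_pos_iff.1 (lt_of_lt_of_le (by positivity)
    (hR.lower M hM0))
  have hbm : outVal σ M vv vv' ≠ 0 := norm_pos_iff.1 (lt_of_lt_of_le (by positivity)
    (hL.lower M hM0))
  have ebp : ∀ y, bPlus E M y = outVal σ M y (deriv y) := fun y => rfl
  have ebm : bMinus E M v = outVal σ M vv vv' := by
    simp only [bMinus, outVal, vv, vv', σ]; ring
  have eam : bMinus E M u = -outVal σ M û û' := by
    simp only [bMinus, outVal, û, û', σ]; ring
  have em₁ : outVal σ M u (deriv u) = m₁ * outVal σ M v (deriv v) := by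
    rw [hm₁def]; field_simp
  have em₂ : outVal σ M û û' = m₂ * outVal σ M vv vv' := by
    rw [hm₂def]; field_simp
  have hcomb : ∀ x, uSol V Φ (wZero Φ + d) (E + l) x = (1 + c₀ * d) * Y l x + d * Z l x ∧
      deriv (uSol V Φ (wZero Φ + d) (E + l)) x =
        (1 + c₀ * d) * deriv (Y l) x + d * deriv (Z l) x := fun x =>
    (hsolζ (wZero Φ + d) (E + l)).unique_lin (continuous_pot hV _) ordConnected_univ (hY l).1
      (hZ l).1 (mem_univ 0)
      (by rw [(hY l).2.1, (hZ l).2.1]; exact (hdata d (E + l)).1)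
      (by rw [(hY l).2.2, (hZ l).2.2]; exact (hdata d (E + l)).2) (mem_univ x)
  have hYv : outVal (s l) M (Y l) (deriv (Y l)) = S₁ l * outVal (s l) M v (deriv v) := by
    simp only [S₁]; field_simp
  have hZv : outVal (s l) M (Z l) (deriv (Z l)) = S₂ l * outVal (s l) M v (deriv v) := by
    simp only [S₂]; field_simp
  have hYv' : outVal (s l) M (fun x => Y l (-x)) (fun x => -deriv (Y l) (-x))
      = T₁ l * outVal (s l) M vv vv' := by
    simp only [T₁]; field_simp
  have hZv' : outVal (s l) M (fun x => -Z l (-x)) (fun x => deriv (Z l) (-x))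
      = T₂ l * outVal (s l) M vv vv' := by
    simp only [T₂]; field_simp
  have hTτ : T₁ l - τ * T₂ l = 0 := by
    have h1 : (T₁ l - τ * T₂ l) * S₂ l = 0 := by linear_combination hzero - T₂ l * hτS
    exact (mul_eq_zero.1 h1).resolve_right hS₂0
  refine ⟨wZero Φ + d, E + l, hre, ?_, ?_, ?_, ?_, ?_⟩
  · rw [(hcomb M).1, (hcomb M).2, hα, hdα]
    have alg : ∀ a y y' z z' k B S T : ℂ, y' - k * y = S * B → z' - k * z = T * B → τ * T = -S →
        a * y' + a * τ * z' = k * (a * y + a * τ * z) := fun a y y' z z' k B S T h1 h2 h3 => by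
      linear_combination a * (h1 + τ * h2 + B * h3)
    exact alg _ _ _ _ _ _ _ _ _ hYv hZv hτS
  · rw [(hcomb (-M)).1, (hcomb (-M)).2, hα, hdα]
    have alg : ∀ a y y' z z' k B S T : ℂ, -y' - k * y = S * B → z' - k * -z = T * B →
        S - τ * T = 0 → a * y' + a * τ * z' = -(k * (a * y + a * τ * z)) :=
      fun a y y' z z' k B S T h1 h2 h3 => by
        linear_combination a * (-h1 + τ * h2 - B * h3)
    exact alg _ _ _ _ _ _ _ _ _ hYv' hZv' hTτ
  · simp only [corrDenom, hI, ebm, ebp]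
    exact mul_ne_zero (mul_ne_zero hI0 hbp) hbm
  -- Here `m₁ = a₊ / b₊` and `m₂ = -a₋ / b₋`; the sign comes from reflecting `u` to `u (-x)` but `v`
  -- to `-v (-x)`.
  · have e1 : zApprox E M u v = E + (m₁ + m₂) / (I₁ + I₂) := by
      simp only [zApprox, corrDenom, hI, ebm, ebp, eam, em₁, em₂]
      field_simp
      ring
    rw [e1, show (E : ℂ) + l - (E + (m₁ + m₂) / (I₁ + I₂)) = l - (m₁ + m₂) / (I₁ + I₂) by ring]
    refine hlerr'.trans ?_
    have : 0 ≤ (8 * ‖c₀‖ * Q ^ 2 + D₁ + 2 * Q * D₁ + P / I₀ * Ib) * (X * e) := by positivity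
    rw [← mul_assoc M, ← hXdef]
    linarith
  · have e1 : wApprox (wZero Φ) E M u v = wZero Φ + ((m₁ + m₂) / (I₁ + I₂) * I₁ - m₁) := by
      simp only [wApprox, corrDenom, hI, ← hI₂', ← hI₁, ebm, ebp, eam, em₁, em₂]
      field_simp
      ring
    -- Three sources of error: replacing `d` by `τ`, which is quadratic in `τ`; replacing `S₁`, `S₂`
    -- by their leading terms in `τ S₂ = -S₁`; and replacing `l` by its approximation.
    have e2 : wZero Φ + d - (wZero Φ + ((m₁ + m₂) / (I₁ + I₂) * I₁ - m₁)) =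
        (d - τ) + (-(S₁ l - (m₁ - l * I₁)) - τ * (S₂ l - 1))
          + (l - (m₁ + m₂) / (I₁ + I₂)) * I₁ := by
      linear_combination hτS
    have h1 : ‖d - τ‖ ≤ 8 * ‖c₀‖ * Q ^ 2 * (X * e) := by
      have e3 : d - τ = c₀ * τ * τ / (1 - c₀ * τ) := by
        rw [hd, eq_div_iff hden0, sub_mul, div_mul_cancel₀ _ hden0]; ring
      rw [e3, norm_div, div_le_iff₀ (by linarith), norm_mul, norm_mul]
      calc ‖c₀‖ * ‖τ‖ * ‖τ‖ ≤ ‖c₀‖ * (2 * Q * e) * (2 * Q * e) := by gcongr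
        _ = 8 * ‖c₀‖ * Q ^ 2 * (e * e) * (1 / 2) := by ring
        _ ≤ 8 * ‖c₀‖ * Q ^ 2 * (X * e) * ‖1 - c₀ * τ‖ := by gcongr
    have h2 : ‖τ * (S₂ l - 1)‖ ≤ 2 * Q * D₁ * (X * e) := by
      rw [norm_mul]
      calc _ ≤ 2 * Q * e * (D₁ * X) := by gcongr
        _ = _ := by ring
    have h3 : ‖-(S₁ l - (m₁ - l * I₁)) - τ * (S₂ l - 1)‖
        ≤ D₁ * (X * e) + 2 * Q * D₁ * (X * e) := by
      refine (norm_sub_le _ _).trans ?_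
      rw [norm_neg]
      exact add_le_add hS₁ h2
    have h4 : ‖(l - (m₁ + m₂) / (I₁ + I₂)) * I₁‖ ≤ P / I₀ * (X * e) * Ib := by
      rw [norm_mul]; gcongr
    rw [e1, e2]
    refine (norm_add_le _ _).trans ?_
    have h5 := norm_add_le (d - τ) (-(S₁ l - (m₁ - l * I₁)) - τ * (S₂ l - 1))
    have : 0 ≤ P / I₀ * (X * e) := by positivity
    rw [← mul_assoc M, ← hXdef]
    linarith

/-! ### Resonant states of the truncated operator -/

/-- An integral equation is insensitive to null sets, so agreement almost everywhere with a
continuous right-hand side is enough. This disposes of the jumps of the truncated potential and of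
the source at interval ends. -/
theorem SchrodingerEq.hasDerivWithinAt_deriv {U : ℝ → ℝ} {w h g : ℝ → ℂ} {s : Set ℝ}
    (H : SchrodingerEq U w h) (hs : OrdConnected s) (hg : Continuous g)
    (heq : ∀ᵐ t, t ∈ s → (U t : ℂ) * w t - h t = g t) {x : ℝ} (hx : x ∈ s) :
    HasDerivWithinAt (deriv w) (g x) s x := by
  have h1 : ∀ b ∈ s, deriv w b = deriv w x + ∫ t in x..b, g t := fun b hb => by
    have h2 := H.2.2 x b
    rw [intervalIntegral.integral_congr_ae (g := g)] at h2
    · rw [← h2]; ring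
    · filter_upwards [heq] with t ht htb
      exact ht (hs.uIcc_subset hx hb (uIoc_subset_uIcc htb))
  have h2 := (intervalIntegral.integral_hasDerivAt_right (hg.intervalIntegrable x x)
      (hg.stronglyMeasurableAtFilter _ _) hg.continuousAt).const_add (deriv w x)
  exact h2.hasDerivWithinAt.congr h1 (h1 x hx)

theorem SchrodingerEq.solOn {U : ℝ → ℝ} {w h q : ℝ → ℂ} {s : Set ℝ}
    (H : SchrodingerEq U w h) (hs : OrdConnected s) (hq : Continuous q)
    (heq : ∀ᵐ t, t ∈ s → (U t : ℂ) * w t - h t = q t * w t) : SolOn q w (deriv w) s := fun x hx =>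
  ⟨(H.1 x).hasDerivAt.hasDerivWithinAt,
    H.hasDerivWithinAt_deriv hs (hq.mul H.1.continuous) heq hx⟩

theorem ae_ne_real (c : ℝ) : ∀ᵐ t : ℝ, t ≠ c := by
  simp [ae_iff]

theorem truncate_of_mem {V : ℝ → ℝ} {M x : ℝ} (hx : x ∈ Icc (-M) M) : truncate V M x = V x :=
  if_pos (abs_le.2 hx)

theorem truncate_of_gt {V : ℝ → ℝ} {M x : ℝ} (hx : M < x) : truncate V M x = 0 :=
  if_neg (by rw [not_le]; exact hx.trans_le (le_abs_self x))

theorem truncate_of_lt {V : ℝ → ℝ} {M x : ℝ} (hx : x < -M) : truncate V M x = 0 :=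
  if_neg (by rw [not_le]; linarith [neg_le_abs x])

theorem solOn_exp (k a c : ℂ) : SolOn (fun _ => -(k ^ 2))
    (fun x => a * Complex.exp (Complex.I * k * (x - c)))
    (fun x => Complex.I * k * (a * Complex.exp (Complex.I * k * (x - c)))) univ := fun x _ => by
  have h1 : HasDerivAt (fun x : ℝ => a * Complex.exp (Complex.I * k * (x - c)))
      (Complex.I * k * (a * Complex.exp (Complex.I * k * (x - c)))) x := by
    have := (((Complex.ofRealCLM.hasDerivAt (x := x)).sub_const c).const_mul
      (Complex.I * k)).cexp.const_mul a
    refine this.congr_deriv ?_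
    rw [Complex.ofRealCLM_apply, Complex.ofRealCLM_apply, Complex.ofReal_one]
    ring
  refine ⟨h1.hasDerivWithinAt, ((h1.const_mul (Complex.I * k)).congr_deriv ?_).hasDerivWithinAt⟩
  linear_combination k ^ 2 * a * Complex.exp (Complex.I * k * (x - c)) * Complex.I_sq

theorem hasDerivAt_ite_le {f g f' g' : ℝ → ℂ} {c : ℝ} (hf : ∀ x, HasDerivAt f (f' x) x)
    (hg : ∀ x, HasDerivAt g (g' x) x) (h : f c = g c) (h' : f' c = g' c) (x : ℝ) :
    HasDerivAt (fun x => if x ≤ c then f x else g x) (if x ≤ c then f' x else g' x) x := by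
  have hl : ∀ y ∈ Iic c, (if y ≤ c then f y else g y) = f y := fun y hy => if_pos hy
  have hr : ∀ y ∈ Ici c, (if y ≤ c then f y else g y) = g y := fun y hy => by
    split_ifs with h1
    · rw [le_antisymm h1 hy, h]
    · rfl
  rcases lt_trichotomy x c with hx | rfl | hx
  · rw [if_pos hx.le]
    exact ((hf x).hasDerivWithinAt.congr hl (hl x hx.le)).hasDerivAt (Iic_mem_nhds hx)
  · rw [if_pos le_rfl, ← hasDerivWithinAt_univ, ← Iic_union_Ici (a := x)]
    refine ((hf x).hasDerivWithinAt.congr hl (hl x self_mem_Iic)).union ?_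
    rw [h']
    exact (hg x).hasDerivWithinAt.congr hr (hr x self_mem_Ici)
  · rw [if_neg (not_le.2 hx)]
    exact ((hg x).hasDerivWithinAt.congr hr (hr x hx.le)).hasDerivAt (Ici_mem_nhds hx)

theorem intervalIntegrable_truncate_mul {V : ℝ → ℝ} (hV : Continuous V) (M : ℝ) {w : ℝ → ℂ}
    (hw : Continuous w) (a b : ℝ) :
    IntervalIntegrable (fun t => (truncate V M t : ℂ) * w t) volume a b := by
  have h1 : (fun t => (truncate V M t : ℂ) * w t) =
      (Icc (-M) M).indicator fun t => (V t : ℂ) * w t := by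
    funext t
    by_cases ht : t ∈ Icc (-M) M
    · rw [indicator_of_mem ht, truncate_of_mem ht]
    · rw [indicator_of_notMem ht, truncate, if_neg (fun h => ht (abs_le.1 h))]; simp
  rw [h1, intervalIntegrable_iff]
  have hc : Continuous fun t => (V t : ℂ) * w t := by fun_prop
  exact ((intervalIntegrable_iff.1 (hc.intervalIntegrable a b)).indicator measurableSet_Icc)

/-- Gluing three classical solutions to a solution for the truncated potential. -/
theorem schrodingerEq_truncate_of_glue {V : ℝ → ℝ} (hV : Continuous V) {z : ℂ} {M : ℝ}
    (hM : 0 ≤ M) {l l' u u' r r' : ℝ → ℂ} (hl : SolOn (fun _ => -z) l l' univ)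
    (hu : SolOn (pot V z) u u' univ) (hr : SolOn (fun _ => -z) r r' univ)
    (h1 : l (-M) = u (-M)) (h1' : l' (-M) = u' (-M)) (h2 : u M = r M) (h2' : u' M = r' M) :
    SchrodingerEq (truncate V M)
      (fun x => if x ≤ -M then l x else if x ≤ M then u x else r x)
      (fun x => z * if x ≤ -M then l x else if x ≤ M then u x else r x) := by
  have hMM : -M ≤ M := by linarith
  set w : ℝ → ℂ := fun x => if x ≤ -M then l x else if x ≤ M then u x else r x with hw
  set w' : ℝ → ℂ := fun x => if x ≤ -M then l' x else if x ≤ M then u' x else r' x with hw'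
  have hd : ∀ x, HasDerivAt w (w' x) x := hasDerivAt_ite_le hl.hasDerivAt
    (hasDerivAt_ite_le hu.hasDerivAt hr.hasDerivAt h2 h2') (by rw [if_pos hMM, h1])
    (by rw [if_pos hMM, h1'])
  have hcw : Continuous w := continuous_iff_continuousAt.2 fun x => (hd x).continuousAt
  have hcw' : Continuous w' := by
    refine Continuous.if_le hl.continuous' (Continuous.if_le hu.continuous' hr.continuous'
      continuous_id continuous_const ?_) continuous_id continuous_const ?_
    · rintro x rfl; exact h2'
    · rintro x rfl; rw [if_pos hMM]; exact h1'
  have hi : ∀ a b : ℝ, IntervalIntegrable (fun t => (truncate V M t : ℂ) * w t - z * w t)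
      volume a b := fun a b =>
    (intervalIntegrable_truncate_mul hV M hcw a b).sub
      ((continuous_const.mul hcw).intervalIntegrable a b)
  refine ⟨fun x => (hd x).differentiableAt, hi, fun a b => ?_⟩
  rw [show deriv w = w' from funext fun x => (hd x).deriv]
  -- At `± M` the potential may jump and `w'` need only be continuous; the fundamental theorem
  -- tolerates these two points.
  refine (integral_eq_of_hasDerivAt_off_countable w' _
    (s := {-M, M}) (Set.toFinite _).countable hcw'.continuousOn (fun x hx => ?_) (hi a b)).symm
  have hx1 : x ≠ -M := fun h => hx.2 (by simp [h])
  have hx2 : x ≠ M := fun h => hx.2 (by simp [h])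
  rcases lt_or_gt_of_ne hx1 with hx1 | hx1
  · refine ((hl.hasDerivAt' x).congr_of_eventuallyEq ?_).congr_deriv ?_
    · filter_upwards [Iio_mem_nhds hx1] with y hy
      exact if_pos hy.le
    · rw [truncate_of_lt hx1]
      simp [hw, hx1.le]
  · rcases lt_or_gt_of_ne hx2 with hx2 | hx2
    · refine ((hu.hasDerivAt' x).congr_of_eventuallyEq ?_).congr_deriv ?_
      · filter_upwards [Ioo_mem_nhds hx1 hx2] with y hy
        simp [hw', not_le.2 hy.1, hy.2.le]
      · rw [truncate_of_mem ⟨hx1.le, hx2.le⟩]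
        simp [hw, not_le.2 hx1, hx2.le, pot, sub_mul]
    · refine ((hr.hasDerivAt' x).congr_of_eventuallyEq ?_).congr_deriv ?_
      · filter_upwards [Ioi_mem_nhds hx2] with y hy
        have : -M < y := hMM.trans_lt hy
        simp [hw', not_le.2 this, not_le.2 (show M < y from hy)]
      · rw [truncate_of_gt hx2]
        simp [hw, not_le.2 hx1, not_le.2 hx2]

theorem schrodingerEq_outgoingExtension {V : ℝ → ℝ} (hV : Continuous V) {z : ℂ} {M : ℝ}
    (hM : 0 ≤ M) {u u' : ℝ → ℂ} (hu : SolOn (pot V z) u u' univ)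
    (hp : u' M = Complex.I * Complex.sqrt z * u M)
    (hm : u' (-M) = -(Complex.I * Complex.sqrt z * u (-M))) :
    SchrodingerEq (truncate V M) (outgoingExtension M z u)
      (fun x => z * outgoingExtension M z u x) := by
  have hl := solOn_exp (-Complex.sqrt z) (u (-M)) (-M)
  have hr := solOn_exp (Complex.sqrt z) (u M) M
  rw [neg_sq, csqrt_sq] at hl
  rw [csqrt_sq] at hr
  have key := schrodingerEq_truncate_of_glue hV hM hl hu hr (by simp) (by simp [hm]) (by simp)
    (by simp [hp])
  have he : outgoingExtension M z u = fun x : ℝ => if x ≤ -M then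
      u (-M) * Complex.exp (Complex.I * -Complex.sqrt z * (x - -M)) else if x ≤ M then u x else
      u M * Complex.exp (Complex.I * Complex.sqrt z * (x - M)) := by
    funext x
    simp only [outgoingExtension]
    rcases lt_trichotomy x (-M) with hx | rfl | hx
    · rw [if_pos hx, if_pos hx.le]
      congr 2; ring
    · rw [if_neg (lt_irrefl _), if_pos le_rfl, if_pos (by linarith)]
      simp
    · rw [if_neg hx.not_gt, if_neg hx.not_ge]
  rw [he]
  exact key

/-- The outgoing form of a resonant state is assumed only far out; agreement near one point extends
it over the free half-line up to `± M`. -/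
theorem SolOn.eq_of_eventually {z : ℂ} {s : Set ℝ} (hs : OrdConnected s) {y y' e e' : ℝ → ℂ}
    (hy : SolOn (fun _ => -z) y y' s) (he : SolOn (fun _ => -z) e e' univ) {c : ℝ}
    (hc : s ∈ nhds c) (h : y =ᶠ[nhds c] e) {x : ℝ} (hx : x ∈ s) : y x = e x ∧ y' x = e' x := by
  have hcs := mem_of_mem_nhds hc
  refine hy.unique continuous_const hs (he.mono (subset_univ s)) hcs h.eq_of_nhds ?_ hx
  exact (((hy c hcs).1.hasDerivAt hc).congr_of_eventuallyEq h.symm).unique (he.hasDerivAt c)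

/-- A resonant state is exponential up to `± M`, so it inherits at `M` the boundary condition of
`u`. By uniqueness it is proportional to `u` on `[-M, M]`, and continuity at `± M` fixes the two
exponentials. Conversely the boundary conditions glue the pieces in `C¹`. -/
theorem isResonantState_truncate_iff {V : ℝ → ℝ} (hV : Continuous V) {z : ℂ} {M : ℝ}
    (hM : 0 ≤ M) {u u' : ℝ → ℂ} (hu : SolOn (pot V z) u u' univ)
    (hu0 : ∀ x, u x ≠ 0 ∨ u' x ≠ 0)
    (hp : u' M = Complex.I * Complex.sqrt z * u M)
    (hm : u' (-M) = -(Complex.I * Complex.sqrt z * u (-M))) (ψ : ℝ → ℂ) :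
    IsResonantState (truncate V M) z ψ ↔ ∃ c : ℂ, c ≠ 0 ∧ ψ = c • outgoingExtension M z u := by
  have huM : u M ≠ 0 := fun h => (hu0 M).elim (fun h1 => h1 h) fun h1 => h1 (by rw [hp, h, mul_zero])
  have hext : outgoingExtension M z u M = u M := by
    simp only [outgoingExtension]
    rw [if_neg (by linarith), if_pos le_rfl]
  constructor
  · rintro ⟨h0, hψ, r, a, b, ha, hb⟩
    have hR : SolOn (fun _ => -z) ψ (deriv ψ) (Ici M) := by
      refine hψ.solOn ordConnected_Ici continuous_const ?_
      filter_upwards [ae_ne_real M] with t ht htM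
      rw [truncate_of_gt (lt_of_le_of_ne htM ht.symm)]
      simp
    have hL : SolOn (fun _ => -z) ψ (deriv ψ) (Iic (-M)) := by
      refine hψ.solOn ordConnected_Iic continuous_const ?_
      filter_upwards [ae_ne_real (-M)] with t ht htM
      rw [truncate_of_lt (lt_of_le_of_ne htM ht)]
      simp
    have hI : SolOn (pot V z) ψ (deriv ψ) (Icc (-M) M) := by
      refine hψ.solOn ordConnected_Icc (continuous_pot hV z) (Filter.Eventually.of_forall ?_)
      intro t ht
      rw [truncate_of_mem ht, pot, sub_mul]
    have er := solOn_exp (Complex.sqrt z) a 0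
    have el := solOn_exp (-Complex.sqrt z) b 0
    rw [csqrt_sq] at er
    rw [neg_sq, csqrt_sq] at el
    have hr1 : ∀ x ∈ Ici M, _ := fun x hx => hR.eq_of_eventually ordConnected_Ici er
      (c := max M r + 1) (Ici_mem_nhds (by linarith [le_max_left M r])) (by
        filter_upwards [Ioi_mem_nhds (show r < max M r + 1 by linarith [le_max_right M r])]
          with y hy
        rw [ha y hy, sub_zero]) hx
    have hl1 : ∀ x ∈ Iic (-M), _ := fun x hx => hL.eq_of_eventually ordConnected_Iic el
      (c := -(max M r + 1)) (Iic_mem_nhds (by linarith [le_max_left M r])) (by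
        filter_upwards [Iio_mem_nhds (show -(max M r + 1) < -r by linarith [le_max_right M r])]
          with y hy
        rw [hb y hy, sub_zero, mul_neg, neg_mul]) hx
    simp only [sub_zero] at hr1 hl1
    have hψM : deriv ψ M = Complex.I * Complex.sqrt z * ψ M := by
      rw [(hr1 M self_mem_Ici).1, (hr1 M self_mem_Ici).2]
    have hin : ∀ x ∈ Icc (-M) M, ψ x = ψ M / u M * u x := fun x hx =>
      (hI.unique (continuous_pot hV z) ordConnected_Icc
        ((hu.lin hu (ψ M / u M) 0).mono (subset_univ _)) (c := M) ⟨by linarith, le_rfl⟩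
        (by simp [huM]) (by simp only [hψM, hp]; field_simp; ring) hx).1.trans (by ring)
    have heq : ψ = (ψ M / u M) • outgoingExtension M z u := by
      funext x
      simp only [Pi.smul_apply, smul_eq_mul, outgoingExtension]
      rcases lt_or_ge x (-M) with hx | hx
      · rw [if_pos hx, (hl1 x hx.le).1, ← mul_assoc, ← hin (-M) ⟨le_rfl, by linarith⟩,
          (hl1 (-M) self_mem_Iic).1, mul_assoc _ (Complex.exp _) (Complex.exp _), ← Complex.exp_add]
        congr 2; push_cast; ring
      · rw [if_neg hx.not_gt]
        rcases le_or_gt x M with hx' | hx'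
        · rw [if_pos hx', hin x ⟨hx, hx'⟩]
        · rw [if_neg hx'.not_ge, (hr1 x hx'.le).1, ← mul_assoc, div_mul_cancel₀ _ huM,
            (hr1 M self_mem_Ici).1, mul_assoc _ (Complex.exp _) (Complex.exp _), ← Complex.exp_add]
          congr 2; ring
    refine ⟨ψ M / u M, fun h => h0 ?_, heq⟩
    rw [heq, h, zero_smul]
  · rintro ⟨c, hc, rfl⟩
    have hcu : SolOn (pot V z) (fun x => c * u x) (fun x => c * u' x) univ := fun x _ =>
      ⟨((hu.hasDerivAt x).const_mul c).hasDerivWithinAt,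
        (((hu.hasDerivAt' x).const_mul c).congr_deriv (by ring)).hasDerivWithinAt⟩
    have he : c • outgoingExtension M z u = outgoingExtension M z (fun x => c * u x) := by
      funext x
      simp only [Pi.smul_apply, smul_eq_mul, outgoingExtension]
      split_ifs <;> ring
    refine ⟨fun h => ?_, ?_, M, c * u M * Complex.exp (-(Complex.I * Complex.sqrt z * M)),
      c * u (-M) * Complex.exp (-(Complex.I * Complex.sqrt z * M)), fun x hx => ?_, fun x hx => ?_⟩
    · have := congrFun h M
      simp [hext, hc, huM] at this
    · rw [he]
      exact schrodingerEq_outgoingExtension hV hM hcu (by simp only [hp]; ring)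
        (by simp only [hm]; ring)
    · rw [he]
      simp only [outgoingExtension]
      rw [if_neg (by linarith), if_neg (by linarith), mul_assoc _ (Complex.exp _) (Complex.exp _),
        ← Complex.exp_add]
      congr 2; ring
    · rw [he]
      simp only [outgoingExtension]
      rw [if_pos hx, mul_assoc _ (Complex.exp _) (Complex.exp _), ← Complex.exp_add]
      congr 2; ring

/-! ### The resolvent of the truncated operator -/

theorem SolOn.reflect_Iic {q : ℂ} {y y' : ℝ → ℂ} {c : ℝ} (h : SolOn (fun _ => q) y y' (Iic (-c))) :
    SolOn (fun _ => q) (fun x => y (-x)) (fun x => -y' (-x)) (Ici c) := fun x hx => by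
  have hm : MapsTo (fun x : ℝ => -x) (Ici c) (Iic (-c)) := fun t ht =>
    neg_le_neg (show c ≤ t from ht)
  have hn : HasDerivWithinAt (fun x : ℝ => -x) (-1) (Ici c) x := (hasDerivAt_neg x).hasDerivWithinAt
  obtain ⟨h1, h2⟩ := h (-x) (hm hx)
  exact ⟨(h1.scomp x hn hm).congr_deriv (by simp), (h2.scomp x hn hm).neg.congr_deriv (by simp)⟩

/-- In the free region `y` is `A e^{iξ(x-c)} + B e^{-iξ(x-c)}`, and for `Im ξ > 0` the second
exponential grows. Square integrability forces `B = 0`, so in the upper half-plane `L²` means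
outgoing. -/
theorem SolOn.deriv_eq_of_memLp {ξ : ℂ} (hξ : 0 < ξ.im) {y y' : ℝ → ℂ} {c : ℝ}
    (hc : Continuous y) (hy : SolOn (fun _ => -(ξ ^ 2)) y y' (Ici c)) (hL : MemLp y 2 volume) :
    y' c = Complex.I * ξ * y c := by
  have hξ0 : ξ ≠ 0 := fun h => by simp [h] at hξ
  have hI0 := Complex.I_ne_zero
  set B := (y c - y' c / (Complex.I * ξ)) / 2 with hB
  set A := (y c + y' c / (Complex.I * ξ)) / 2 with hA
  suffices B = 0 by
    rw [hB, div_eq_zero_iff, or_iff_left two_ne_zero, sub_eq_zero] at this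
    rw [this]; field_simp
  by_contra hB0
  have hBpos : 0 < ‖B‖ := norm_pos_iff.2 hB0
  have e1 := solOn_exp ξ 1 c
  have e2 := solOn_exp (-ξ) 1 c
  rw [neg_sq] at e2
  have hyx : ∀ x, c ≤ x → y x = A * Complex.exp (Complex.I * ξ * (x - c)) +
      B * Complex.exp (Complex.I * -ξ * (x - c)) := fun x hx => by
    have := (hy.unique_lin (x := x) continuous_const ordConnected_Ici (e1.mono (subset_univ _))
      (e2.mono (subset_univ _)) (a := A) (b := B) (c := c) self_mem_Ici
      (by simp [hA, hB]; ring) (by simp [hA, hB]; field_simp; ring) hx).1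
    simpa using this
  -- Beyond `c + T` the inequality `e^t ≥ 1 + t` makes the growing term at least `‖A‖ + 1`, hence
  -- `‖y‖ ≥ 1`.
  set T := (‖A‖ + 1) / (‖B‖ * ξ.im) with hT
  have hT0 : 0 ≤ T := by positivity
  have hlow : ∀ x, c + T ≤ x → 1 ≤ ‖y x‖ ^ 2 := fun x hx => by
    have hcx : 0 ≤ x - c := by linarith
    have n1 : ‖Complex.exp (Complex.I * ξ * (x - c))‖ ≤ 1 := by
      rw [Complex.norm_exp, Real.exp_le_one_iff]
      simp
      nlinarith
    have n2 : (‖A‖ + 1) / ‖B‖ ≤ ‖Complex.exp (Complex.I * -ξ * (x - c))‖ := by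
      rw [Complex.norm_exp]
      have h1 : (Complex.I * -ξ * (x - c)).re = ξ.im * (x - c) := by simp
      rw [h1]
      have h2 : (‖A‖ + 1) / ‖B‖ = ξ.im * T := by rw [hT]; field_simp
      have h3 : ξ.im * T ≤ ξ.im * (x - c) := by gcongr; linarith
      linarith [Real.add_one_le_exp (ξ.im * (x - c))]
    have h1 : ‖B * Complex.exp (Complex.I * -ξ * (x - c))‖ ≤ ‖y x‖ +
        ‖A * Complex.exp (Complex.I * ξ * (x - c))‖ := by
      rw [hyx x (by linarith)]
      refine le_trans (le_of_eq ?_) (norm_sub_le _ _)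
      congr 1; ring
    rw [norm_mul, norm_mul] at h1
    rw [div_le_iff₀ hBpos] at n2
    have h2 : ‖A‖ * ‖Complex.exp (Complex.I * ξ * (x - c))‖ ≤ ‖A‖ :=
      mul_le_of_le_one_right (norm_nonneg _) n1
    have h3 : 1 ≤ ‖y x‖ := by linarith
    nlinarith
  obtain ⟨K, hK⟩ := SqBdd.of_memLp hL (c + T)
  have hcc : Continuous fun x => ‖y x‖ ^ 2 := by fun_prop
  have hle : c + T ≤ c + T + (|K| + 1) := by linarith [abs_nonneg K]
  have h1 : ∫ _x in (c + T)..(c + T + (|K| + 1)), (1 : ℝ) ≤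
      ∫ x in (c + T)..(c + T + (|K| + 1)), ‖y x‖ ^ 2 :=
    intervalIntegral.integral_mono_on hle (continuous_const.intervalIntegrable _ _)
      (hcc.intervalIntegrable _ _) fun x hx => hlow x hx.1
  rw [intervalIntegral.integral_const, smul_eq_mul, mul_one, add_sub_cancel_left] at h1
  linarith [hK _ hle, le_abs_self K]

/-- `∫₀¹ e^{iξt} dt` -/
def expAverage (ξ : ℂ) : ℂ := (Complex.exp (Complex.I * ξ) - 1) / (Complex.I * ξ)

theorem expAverage_ne_zero {ξ : ℂ} (hξ : ξ.im ≠ 0) : expAverage ξ ≠ 0 := by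
  have hξ0 : ξ ≠ 0 := fun h => by simp [h] at hξ
  refine div_ne_zero (fun h => hξ ?_) (mul_ne_zero Complex.I_ne_zero hξ0)
  have h1 := congrArg norm (sub_eq_zero.1 h)
  rw [Complex.norm_exp, norm_one, Real.exp_eq_one_iff] at h1
  simpa using h1

/-- On the support of the unit source, `h = w' - iξ w` satisfies `h' = -iξ h - 1`, and outgoing data
at `M + 1` mean `h (M + 1) = 0`. The integrating factor `e^{iξ(x-M)}` gives `h M`. -/
theorem outgoing_mul_eq_expAverage {ξ : ℂ} (hξ0 : ξ ≠ 0) {w w' : ℝ → ℂ} {M : ℝ}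
    (hw : ∀ x ∈ Icc M (M + 1), HasDerivWithinAt w (w' x) (Icc M (M + 1)) x)
    (hw' : ∀ x ∈ Icc M (M + 1), HasDerivWithinAt w' (-(ξ ^ 2) * w x - 1) (Icc M (M + 1)) x)
    (h1 : w' (M + 1) = Complex.I * ξ * w (M + 1)) :
    w' M - Complex.I * ξ * w M = expAverage ξ := by
  have hI0 := Complex.I_ne_zero
  have he : ∀ x : ℝ, HasDerivAt (fun x : ℝ => Complex.exp (Complex.I * ξ * (x - M)))
      (Complex.I * ξ * Complex.exp (Complex.I * ξ * (x - M))) x := fun x => by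
    simpa using (solOn_exp ξ 1 M).hasDerivAt x
  have hd : ∀ x ∈ Icc M (M + 1), HasDerivWithinAt
      (fun x : ℝ => (w' x - Complex.I * ξ * w x + (Complex.I * ξ)⁻¹) *
        Complex.exp (Complex.I * ξ * (x - M))) 0 (Icc M (M + 1)) x := fun x hx => by
    refine ((((hw' x hx).sub ((hw x hx).const_mul (Complex.I * ξ))).add_const
      (Complex.I * ξ)⁻¹).mul (he x).hasDerivWithinAt).congr_deriv ?_
    have h2 : (Complex.I * ξ)⁻¹ * (Complex.I * ξ) = 1 :=
      inv_mul_cancel₀ (mul_ne_zero hI0 hξ0)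
    simp only [Pi.sub_apply]
    linear_combination Complex.exp (Complex.I * ξ * (x - M)) * h2 -
      Complex.exp (Complex.I * ξ * (x - M)) * ξ ^ 2 * w x * Complex.I_sq
  have key := integral_eq_sub_of_hasDerivWithinAt (f' := fun _ => 0) ordConnected_Icc hd
    continuousOn_const (a := M) (b := M + 1) ⟨le_rfl, by linarith⟩ ⟨by linarith, le_rfl⟩
  rw [intervalIntegral.integral_zero, h1, sub_self, zero_add, Complex.ofReal_add, sub_self,
    add_sub_cancel_left, mul_zero, Complex.exp_zero, Complex.ofReal_one, mul_one, mul_one] at key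
  rw [expAverage, div_eq_mul_inv]
  linear_combination key

theorem integral_outgoing_left {ξ : ℂ} (hξ0 : ξ ≠ 0) (a : ℂ) (M : ℝ) :
    ∫ x in (-M - 1)..(-M), a * Complex.exp (Complex.I * -ξ * (x - (-M : ℝ))) =
      a * expAverage ξ := by
  have hI0 := Complex.I_ne_zero
  have h := solOn_exp (-ξ) (a / (Complex.I * -ξ)) (-M : ℝ)
  rw [integral_eq_sub_of_hasDerivWithinAt (f := fun x : ℝ => a / (Complex.I * -ξ) *
      Complex.exp (Complex.I * -ξ * (x - (-M : ℝ)))) ordConnected_univ (fun x hx => ?_)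
      (by fun_prop) (mem_univ _) (mem_univ _), expAverage]
  · push_cast
    rw [show Complex.I * -ξ * (-M - -M) = 0 by ring,
      show Complex.I * -ξ * (-M - 1 - -M) = Complex.I * ξ by ring, Complex.exp_zero]
    field_simp
    ring
  · refine (h x hx).1.congr_deriv ?_
    field_simp

/-- The matrix element of the resolvent between the indicator functions of `[M, M + 1]` and of
`[-M - 1, -M]`, in terms of the solution `e` which is outgoing at `-∞`. -/
theorem resolvent_matrix_element {V : ℝ → ℝ} (hV : Continuous V) {M : ℝ} (hM : 0 ≤ M) {ξ : ℂ}
    (hξ : 0 < ξ.im) {w k : ℝ → ℂ} (hw : MemLp w 2 volume) (H : SchrodingerEq (truncate V M) w k)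
    (hk : ∀ᵐ t, k t = (Icc M (M + 1)).indicator (fun _ => 1) t + ξ ^ 2 * w t)
    {e e' : ℝ → ℂ} (he : SolOn (pot V (ξ ^ 2)) e e' univ) (h0 : e (-M) = 1)
    (h0' : e' (-M) = -(Complex.I * ξ)) :
    ∫ x in (-M - 1)..(-M), w x = expAverage ξ ^ 2 / (e' M - Complex.I * ξ * e M) := by
  have hξ0 : ξ ≠ 0 := fun h => by simp [h] at hξ
  have hc := H.1.continuous
  have hL : SolOn (fun _ => -(ξ ^ 2)) w (deriv w) (Iic (-M)) := by
    refine H.solOn ordConnected_Iic continuous_const ?_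
    filter_upwards [ae_ne_real (-M), hk] with t ht hkt htM
    have h1 : t < -M := lt_of_le_of_ne htM ht
    rw [truncate_of_lt h1, hkt, indicator_of_notMem (fun h => by linarith [h.1])]
    simp
  have hIn : SolOn (pot V (ξ ^ 2)) w (deriv w) (Icc (-M) M) := by
    refine H.solOn ordConnected_Icc (continuous_pot hV _) ?_
    filter_upwards [ae_ne_real M, hk] with t ht hkt htM
    have h1 : t < M := lt_of_le_of_ne htM.2 ht
    rw [truncate_of_mem htM, hkt, indicator_of_notMem (fun h => by linarith [h.1]), pot]
    ring
  have hR : SolOn (fun _ => -(ξ ^ 2)) w (deriv w) (Ici (M + 1)) := by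
    refine H.solOn ordConnected_Ici continuous_const ?_
    filter_upwards [ae_ne_real (M + 1), hk] with t ht hkt htM
    have h1 : M + 1 < t := lt_of_le_of_ne htM ht.symm
    rw [truncate_of_gt (by linarith), hkt, indicator_of_notMem (fun h => by linarith [h.2])]
    simp
  have hS : ∀ x ∈ Icc M (M + 1),
      HasDerivWithinAt (deriv w) (-(ξ ^ 2) * w x - 1) (Icc M (M + 1)) x := fun x hx => by
    refine H.hasDerivWithinAt_deriv (g := fun x => -(ξ ^ 2) * w x - 1) ordConnected_Icc
      (by fun_prop) ?_ hx
    filter_upwards [ae_ne_real M, hk] with t ht hkt htM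
    rw [truncate_of_gt (lt_of_le_of_ne htM.1 ht.symm), hkt, indicator_of_mem htM]
    push_cast; ring
  have hRd := hR.deriv_eq_of_memLp hξ hc hw
  have hLd : deriv w (-M) = -(Complex.I * ξ * w (-M)) := by
    have h1 := hL.reflect_Iic.deriv_eq_of_memLp hξ (by fun_prop)
      (hw.comp_measurePreserving (Measure.measurePreserving_neg volume))
    rw [← h1, neg_neg]
  have hJ := outgoing_mul_eq_expAverage hξ0
    (fun x _ => (H.1 x).hasDerivAt.hasDerivWithinAt) hS hRd
  have hwe := hIn.unique (continuous_pot hV _) ordConnected_Icc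
    ((he.lin he (w (-M)) 0).mono (subset_univ _)) (c := -M) ⟨le_rfl, by linarith⟩
    (by simp [h0]) (by simp only [h0', hLd]; ring) (x := M) ⟨by linarith, le_rfl⟩
  simp only [zero_mul, add_zero] at hwe
  -- To the left of the source, `w` is outgoing at `-M`, hence equal to `w (-M) * e` on `[-M, M]`;
  -- the source then determines the factor `w (-M)`. The identity also shows that the denominator
  -- does not vanish.
  have hD : w (-M) * (e' M - Complex.I * ξ * e M) = expAverage ξ := by
    rw [← hJ, hwe.1, hwe.2]; ring
  have hJ0 : expAverage ξ ≠ 0 := expAverage_ne_zero hξ.ne'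
  have hD0 : e' M - Complex.I * ξ * e M ≠ 0 := fun h => hJ0 (by rw [← hD, h, mul_zero])
  have el := solOn_exp (-ξ) (w (-M)) (-M : ℝ)
  rw [neg_sq] at el
  have hwL : ∀ x ∈ Iic (-M), w x = w (-M) * Complex.exp (Complex.I * -ξ * (x - (-M : ℝ))) :=
    fun x hx => (hL.unique continuous_const ordConnected_Iic (el.mono (subset_univ _))
      (c := -M) self_mem_Iic (by simp) (by rw [hLd]; simp) hx).1
  rw [intervalIntegral.integral_congr (g := fun x : ℝ => w (-M) *
    Complex.exp (Complex.I * -ξ * (x - (-M : ℝ)))) fun x hx => ?_, integral_outgoing_left hξ0,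
    eq_div_iff hD0]
  · linear_combination expAverage ξ * hD
  · rw [uIcc_of_le (by linarith)] at hx
    exact hwL x hx.2

/-! ### The resonance -/

/-- A fundamental system with fixed data at `0` is entire in `ξ`, and so are the coefficients that
produce the data at `-M`. The last function vanishes precisely when the solution outgoing on the
left is also outgoing on the right. -/
theorem exists_outgoing_left {V : ℝ → ℝ} (hV : Continuous V) (M : ℝ) :
    ∃ e e' : ℂ → ℝ → ℂ, (∀ ξ, SolOn (pot V (ξ ^ 2)) (e ξ) (e' ξ) univ) ∧ (∀ ξ, e ξ (-M) = 1) ∧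
      (∀ ξ, e' ξ (-M) = -(Complex.I * ξ)) ∧
      Differentiable ℂ fun ξ => e' ξ M - Complex.I * ξ * e ξ M := by
  let p := fun ξ : ℂ => schrodingerSol V (ξ ^ 2) 1 0
  let s := fun ξ : ℂ => schrodingerSol V (ξ ^ 2) 0 1
  have hp := fun ξ : ℂ => schrodingerSol_spec hV (ξ ^ 2) 1 0
  have hs := fun ξ : ℂ => schrodingerSol_spec hV (ξ ^ 2) 0 1
  have hW : ∀ ξ, p ξ (-M) * deriv (s ξ) (-M) - deriv (p ξ) (-M) * s ξ (-M) = 1 := fun ξ => by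
    have := wronsk_const ordConnected_univ (hp ξ).1 (hs ξ).1 (mem_univ (-M)) (mem_univ 0)
    rw [wronsk, wronsk, (hp ξ).2.1, (hp ξ).2.2, (hs ξ).2.1, (hs ξ).2.2] at this
    rw [this]; ring
  have hsq : Differentiable ℂ fun ξ : ℂ => ξ ^ 2 := by fun_prop
  have dp := fun x => (differentiable_schrodingerSol hV 1 0 x).1.comp hsq
  have dp' := fun x => (differentiable_schrodingerSol hV 1 0 x).2.comp hsq
  have ds := fun x => (differentiable_schrodingerSol hV 0 1 x).1.comp hsq
  have ds' := fun x => (differentiable_schrodingerSol hV 0 1 x).2.comp hsq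
  let α := fun ξ => deriv (s ξ) (-M) + Complex.I * ξ * s ξ (-M)
  let β := fun ξ => -(Complex.I * ξ * p ξ (-M) + deriv (p ξ) (-M))
  have hid : Differentiable ℂ fun ξ : ℂ => Complex.I * ξ := by fun_prop
  have dα : Differentiable ℂ α := (ds' (-M)).add (hid.mul (ds (-M)))
  have dβ : Differentiable ℂ β := ((hid.mul (dp (-M))).add (dp' (-M))).neg
  refine ⟨fun ξ x => α ξ * p ξ x + β ξ * s ξ x, fun ξ x => α ξ * deriv (p ξ) x + β ξ * deriv (s ξ) x,
    fun ξ => (hp ξ).1.lin (hs ξ).1 _ _, fun ξ => ?_, fun ξ => ?_, ?_⟩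
  · simp only [α, β]
    linear_combination hW ξ
  · simp only [α, β]
    linear_combination -(Complex.I * ξ) * hW ξ
  · exact ((dα.mul (dp' M)).add (dβ.mul (ds' M))).sub
      (hid.mul ((dα.mul (dp M)).add (dβ.mul (ds M))))

/-- The value at `x₁` excludes infinite order by the identity theorem, so the zero at `x₀` has
finite positive order and becomes a pole of the inverse. -/
theorem meromorphicOrderAt_inv_neg {D : ℂ → ℂ} (hD : Differentiable ℂ D) {x₀ x₁ : ℂ}
    (h0 : D x₀ = 0) (h1 : D x₁ ≠ 0) : meromorphicOrderAt D⁻¹ x₀ < 0 := by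
  have ha : AnalyticAt ℂ D x₀ := hD.analyticAt x₀
  have hne : analyticOrderAt D x₀ ≠ ⊤ := fun h => by
    rw [analyticOrderAt_eq_top] at h
    have h2 : AnalyticOnNhd ℂ D univ := fun x _ => hD.analyticAt x
    exact h1 (h2.eqOn_zero_of_preconnected_of_eventuallyEq_zero isPreconnected_univ
      (mem_univ x₀) h (mem_univ x₁))
  have hne0 : analyticOrderAt D x₀ ≠ 0 := by
    rw [ha.analyticOrderAt_ne_zero]; exact h0
  rw [meromorphicOrderAt_inv, ha.meromorphicOrderAt_eq]
  obtain ⟨n, hn⟩ := ENat.ne_top_iff_exists.1 hne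
  rw [← hn] at hne0 ⊢
  have hn0 : 0 < n := Nat.pos_of_ne_zero fun h => hne0 (by simp [h])
  rw [ENat.map_natCast, ← WithTop.LinearOrderedAddCommGroup.coe_neg]
  exact_mod_cast (by simpa using hn0 : -(n : ℤ) < 0)

theorem hasBoundedSupport_indicatorConstLp (a b : ℝ) (c : ℂ) :
    HasBoundedSupport (indicatorConstLp 2 (measurableSet_Icc (a := a) (b := b))
      (measure_Icc_lt_top (μ := volume)).ne c) := by
  refine ⟨max |a| |b|, ?_⟩
  filter_upwards [indicatorConstLp_coeFn_notMem (p := 2) (hs := measurableSet_Icc (a := a) (b := b))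
    (hμs := (measure_Icc_lt_top (μ := volume)).ne) (c := c)] with x hx hax
  exact hx fun h => absurd (abs_le_max_abs_abs h.1 h.2) (not_le.2 hax)

/-- The matrix element between indicators of `[M, M + 1]` and `[-M - 1, -M]` continues to
`expAverage ^ 2 * D⁻¹`. Since `u` is outgoing on both sides, `D` vanishes at `√z`. The numerator
does not, because `Im √z ≠ 0`, so the pole survives. -/
theorem isResonance_truncate {V : ℝ → ℝ} (hV : Continuous V) {z : ℂ} {M : ℝ} (hM : 0 ≤ M)
    {u u' : ℝ → ℂ} (hu : SolOn (pot V z) u u' univ) (hu0 : ∀ x, u x ≠ 0 ∨ u' x ≠ 0)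
    (hp : u' M = Complex.I * Complex.sqrt z * u M)
    (hm : u' (-M) = -(Complex.I * Complex.sqrt z * u (-M))) (hz : (Complex.sqrt z).im ≠ 0) :
    IsResonance (truncate V M) z := by
  obtain ⟨e, e', he, he0, he0', hdiff⟩ := exists_outgoing_left hV M
  set D : ℂ → ℂ := fun ξ => e' ξ M - Complex.I * ξ * e ξ M with hD
  have hMM : -M ≤ M := by linarith
  -- A zero at the real frequency `1` would be an outgoing solution with `Im ξ = 0`, which the flux
  -- identity excludes.
  have hD1 : D 1 ≠ 0 := fun h => by
    have := im_neg_of_outgoing hV (ξ := 1) (by simp) hM ((he 1).mono (subset_univ _))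
      (sub_eq_zero.1 h) (by simp [he0', he0]) ⟨-M, ⟨le_rfl, hMM⟩, by simp [he0]⟩
    simp at this
  have hum : u (-M) ≠ 0 := fun h =>
    (hu0 (-M)).elim (fun h1 => h1 h) fun h1 => h1 (by rw [hm, h, mul_zero, neg_zero])
  have hDz : D (Complex.sqrt z) = 0 := by
    have hez := he (Complex.sqrt z)
    rw [csqrt_sq] at hez
    have h1 := hu.unique_lin (continuous_pot hV z) ordConnected_univ hez hez (a := u (-M)) (b := 0)
      (mem_univ (-M)) (by rw [he0]; ring) (by rw [he0', hm]; ring) (mem_univ M)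
    rw [h1.1, h1.2] at hp
    refine (mul_eq_zero.1 (?_ : u (-M) * D (Complex.sqrt z) = 0)).resolve_left hum
    simp only [hD]
    linear_combination hp
  have haJ : ∀ ξ : ℂ, ξ ≠ 0 → AnalyticAt ℂ expAverage ξ := fun ξ hξ =>
    ((analyticAt_const.mul analyticAt_id).cexp.sub analyticAt_const).div
      (analyticAt_const.mul analyticAt_id) (mul_ne_zero Complex.I_ne_zero hξ)
  have hmJ : ∀ ξ : ℂ, MeromorphicAt expAverage ξ := fun ξ =>
    ((analyticAt_const.mul analyticAt_id).cexp.sub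
      analyticAt_const).meromorphicAt.div (analyticAt_const.mul analyticAt_id).meromorphicAt
  have hz0 : Complex.sqrt z ≠ 0 := fun h => hz (by simp [h])
  refine ⟨indicatorConstLp 2 (measurableSet_Icc (a := M) (b := M + 1)) measure_Icc_lt_top.ne 1,
    indicatorConstLp 2 (measurableSet_Icc (a := -M - 1) (b := -M)) measure_Icc_lt_top.ne 1,
    hasBoundedSupport_indicatorConstLp _ _ _, hasBoundedSupport_indicatorConstLp _ _ _,
    expAverage ^ 2 * D⁻¹, ⟨fun ξ => ((hmJ ξ).pow 2).mul (hdiff.analyticAt ξ).meromorphicAt.inv,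
      fun ξ hξ R hR => ?_⟩, ?_⟩
  · set f : Lp ℂ 2 (volume : Measure ℝ) :=
      indicatorConstLp 2 (measurableSet_Icc (a := M) (b := M + 1)) measure_Icc_lt_top.ne 1
    obtain ⟨w, hw, hS⟩ := (hR (R f) f).1 rfl
    rw [L2.inner_indicatorConstLp_one, setIntegral_congr_ae measurableSet_Icc
      (hw.mono fun x hx _ => hx), integral_Icc_eq_integral_Ioc,
      ← intervalIntegral.integral_of_le (by linarith),
      resolvent_matrix_element hV hM hξ ((Lp.memLp (R f)).ae_eq hw) hS ?_ (he ξ) (he0 ξ) (he0' ξ)]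
    · simp [div_eq_mul_inv, hD]
    · filter_upwards [hw, Lp.coeFn_add f (ξ ^ 2 • R f), Lp.coeFn_smul (ξ ^ 2) (R f),
        indicatorConstLp_coeFn (p := 2) (hs := measurableSet_Icc (a := M) (b := M + 1))
          (hμs := (measure_Icc_lt_top (μ := volume)).ne) (c := (1 : ℂ))] with x h1 h2 h3 h4
      rw [h2, Pi.add_apply, h3, Pi.smul_apply, h1, h4, smul_eq_mul]
  · rw [meromorphicOrderAt_mul_of_ne_zero ((haJ _ hz0).pow 2)
      (pow_ne_zero 2 (expAverage_ne_zero hz))]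
    exact meromorphicOrderAt_inv_neg hdiff hDz hD1

/-- The factor `M` is traded for the loss from `κ` to `k`, by `t ≤ e^t` with `t = 4 (κ - k) M`. -/
theorem exists_mul_exp_le_exp {κ k : ℝ} (hk : k < κ) :
    ∃ C : ℝ, 0 ≤ C ∧ ∀ M : ℝ, M * Real.exp (-4 * κ * M) ≤ C * Real.exp (-4 * k * M) := by
  have ha : 0 < 4 * (κ - k) := by linarith
  refine ⟨1 / (4 * (κ - k)), by positivity, fun M => ?_⟩
  have h1 := Real.add_one_le_exp (4 * (κ - k) * M)
  have h2 : M ≤ 1 / (4 * (κ - k)) * Real.exp (4 * (κ - k) * M) := by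
    rw [one_div_mul_eq_div, le_div_iff₀ ha]; linarith
  calc M * Real.exp (-4 * κ * M)
      ≤ 1 / (4 * (κ - k)) * Real.exp (4 * (κ - k) * M) * Real.exp (-4 * κ * M) := by gcongr
    _ = _ := by rw [mul_assoc, ← Real.exp_add]; ring_nf

end

/-! ### The main theorem -/

theorem mainTheorem6 (V Vper Vdef : ℝ → ℝ) (ρ E : ℝ) (Φ : ℝ → ℂ)
    (hV : ContDiff ℝ ∞ V) (hsum : ∀ x, V x = Vper x + Vdef x)
    (hper : ∀ x, Vper (x + 1) = Vper x)
    (hρ : 0 ≤ ρ) (hdef : ∀ x, ρ < |x| → Vdef x = 0)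
    (hE : 0 < E) (hΦ : IsBoundState V E Φ) :
    ∃ κ : ℝ, 0 < κ ∧
      (∃ μ : ℂ, ‖μ‖ = Real.exp (-κ) ∧ ∀ x : ℝ, ρ ≤ x → Φ (x + 1) = μ * Φ x) ∧
      ∃ (M₀ C : ℝ) (wstar zstar : ℝ → ℂ), ρ < M₀ ∧
        (∀ M : ℝ, M₀ ≤ M →
          0 < (zstar M).re ∧ (zstar M).im < 0 ∧
          IsResonance (truncate V M) (zstar M) ∧
          (∀ ψ : ℝ → ℂ, IsResonantState (truncate V M) (zstar M) ψ ↔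
            ∃ c : ℂ, c ≠ 0 ∧
              ψ = c • outgoingExtension M (zstar M) (uSol V Φ (wstar M) (zstar M))) ∧
          corrDenom E M (uSol V Φ (wZero Φ) E) (vSol V Φ (wZero Φ) E) ≠ 0 ∧
          ‖zstar M - zApprox E M (uSol V Φ (wZero Φ) E) (vSol V Φ (wZero Φ) E)‖
            ≤ C * (M * Real.exp (-4 * κ * M)) ∧
          ‖wstar M - wApprox (wZero Φ) E M (uSol V Φ (wZero Φ) E) (vSol V Φ (wZero Φ) E)‖
            ≤ C * (M * Real.exp (-4 * κ * M))) ∧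
        ∀ k : ℝ, 0 < k → k < κ → ∃ C' : ℝ, ∀ M : ℝ, M₀ ≤ M →
          ‖zstar M - zApprox E M (uSol V Φ (wZero Φ) E) (vSol V Φ (wZero Φ) E)‖
            ≤ C' * Real.exp (-4 * k * M) ∧
          ‖wstar M - wApprox (wZero Φ) E M (uSol V Φ (wZero Φ) E) (vSol V Φ (wZero Φ) E)‖
            ≤ C' * Real.exp (-4 * k * M) := by
  have hVc : Continuous V := hV.continuous
  obtain ⟨hwr, κ, hκ, hμ, C, c, hC, hc, hR, hL⟩ :=
    exists_floquet_exponent hVc hsum hper hρ hdef hE hΦ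
  obtain ⟨M₀, D, hM₀, hD, hM⟩ := exists_resonance_parameters hVc hE hκ hC hc hwr hR hL
  choose! w z hz hp hm hN hze hwe using hM
  refine ⟨κ, hκ, hμ, max M₀ (ρ + 1), D, w, z,
    lt_of_lt_of_le (by linarith) (le_max_right _ _), fun M hM => ?_, fun k _ hk => ?_⟩
  · have hM1 : M₀ ≤ M := (le_max_left _ _).trans hM
    have hM0 : 0 ≤ M := by linarith
    have hu := (uSol_spec hVc Φ (w M) (z M)).1
    have hu0 := uSol_ne_zero hVc Φ (w M) (z M)
    have hre : 0 < (Complex.sqrt (z M)).re := csqrt_re_pos (hz M hM1)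
    have huM : uSol V Φ (w M) (z M) M ≠ 0 := fun h =>
      (hu0 M).elim (fun h1 => h1 h) fun h1 => h1 (by rw [hp M hM1, h, mul_zero])
    -- Together with `Re √z > 0` this gives `Im z = 2 Re √z Im √z < 0`; it also supplies the `Im √z
    -- ≠ 0` needed for the pole.
    have him : (Complex.sqrt (z M)).im < 0 :=
      im_neg_of_outgoing hVc hre.ne' hM0 (by rw [csqrt_sq]; exact hu.mono (subset_univ _))
        (hp M hM1) (hm M hM1) ⟨M, ⟨by linarith, le_rfl⟩, huM⟩
    refine ⟨hz M hM1, ?_, isResonance_truncate hVc hM0 hu hu0 (hp M hM1) (hm M hM1) him.ne,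
      isResonantState_truncate_iff hVc hM0 hu hu0 (hp M hM1) (hm M hM1), hN M hM1, hze M hM1,
      hwe M hM1⟩
    rw [← csqrt_sq (z M), sq, Complex.mul_im]
    nlinarith
  · obtain ⟨B, -, hB⟩ := exists_mul_exp_le_exp hk
    refine ⟨D * B, fun M hM => ?_⟩
    have hM1 : M₀ ≤ M := (le_max_left _ _).trans hM
    have key : D * (M * Real.exp (-4 * κ * M)) ≤ D * B * Real.exp (-4 * k * M) := by
      rw [mul_assoc D]; exact mul_le_mul_of_nonneg_left (hB M) hD
    exact ⟨(hze M hM1).trans key, (hwe M hM1).trans key⟩
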